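/- Let $\mu>0$ and let $\sigma:(0,\infty)\to\mathbb R$, with $W(p)=\int_1^p\sigma(z)\,dz$, satisfy: $\sigma$ is locally Lipschitz continuous; $\sigma(p)\to-\infty$ as $p\to0+$; there are $\alpha,\theta>0$ with $\sigma'(p)\ge\alpha$ for (almost every) $p\in(0,\theta)$; $W$ is strictly convex for $p$ sufficiently large; $\sigma(p)>0$ for $p$ sufficiently large and $\int_{p_++1}^\infty \frac{dz}{\sigma(z)}<\infty$, where $p_+$ is the largest root of $\sigma$. Let $$X=\Big\{q\in L^2(0,1): q\ge 0 \text{ a.e.},\ \int_0^1 q\,dx=\mu\Big\},$$ a metric space with the $L^2(0,1)$ distance. Consider the problem $$p_t(x,t)=-\sigma(p(x,t))+\int_0^1\sigma(p(y,t))\,dy,\qquad p(x,0)=p_0(x),\qquad \int_0^1p(x,t)\,dx=\mu.\tag{P}$$ A solution of (P) on $(0,1)\times[0,T]$ is a function $p\in C([0,T];L^2(0,1))$ with $p(\cdot,0)=p_0$ and $\int_0^1p(x,t)\,dx=\mu$ for all $t\in[0,T]$, such that (for a suitable representative) $p>0$ a.e. in $(0,1)\times[0,T]$, $\sigma(p(\cdot,t))\in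 L^1(0,1)$ for a.e. $t\in[0,T]$, $\sigma(p(x,\cdot))-\int_0^1\sigma(p(y,\cdot))\,dy\in L^1(\tau,T)$ for a.e. $x\in(0,1)$ and all $\tau\in(0,T)$, and, for a.e. $x\in(0,1)$ and all $s,t\in(0,T]$, $$p(x,t)=p(x,s)-\int_s^t\Big(\sigma(p(x,r))-\int_0^1\sigma(p(y,r))\,dy\Big)dr .$$ Then (P) generates a semiflow $\{T(t)\}_{t\ge0}$ on $X$: there is a family of maps $T(t):X\to X$ with $T(0)=\mathrm{id}$, $T(s+t)=T(s)T(t)$ and $(p_0,t)\mapsto T(t)p_0$ continuous on $X\times[0,\infty)$, such that for every $p_0\in X$ and every finite time horizon $[0,T_0]$, $T_0>0$, the unique solution of (P) on $(0,1)\times[0,T_0]$ is $p(\cdot,t)=T(t)p_0$. Moreover, for any $p_0\in X$, the $\omega$-limit set $$\omega(p_0)=\{\chi\in X: T(t_j)p_0\to\chi \text{ in } L^2(0,1)\text{ for some sequence } t_j\to\infty\}$$ is a nonempty, compact subset of the set of equilibria $$\mathcal E_\mu=\Big\{\bar p\in L^2(0,1):\ \bar p>0\text{ a.e.},\ \sigma(\bar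 p(x))=C \text{ a.e. for some } C\in\mathbb R,\ \int_0^1\bar p\,dx=\mu\Big\},$$ and $$\operatorname{dist}_{L^2(0,1)}\big(T(t)p_0,\omega(p_0)\big)\to0\quad\text{as }t\to\infty .$$ -/

import Mathlib

open Set Filter Topology MeasureTheory
open scoped NNReal ENNReal

noncomputable section

namespace Viscoelastic

/-- The Hilbert space `L²(0,1)`. -/
abbrev L2 : Type := Lp ℝ 2 (volume.restrict (Ioo (0 : ℝ) 1))

/-- The stored-energy function `W(p) = ∫₁ᵖ σ(z) dz`, used for `p > 0`. -/
def storedEnergy (σ : ℝ → ℝ) (p : ℝ) : ℝ := ∫ z in (1 : ℝ)..p, σ z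

/-- The standing assumptions on the stress `σ : (0,∞) → ℝ`; the values of the Lean function `σ`
outside `(0,∞)` are irrelevant. As `σ` is only locally Lipschitz, its derivative exists almost
everywhere, and the bound `σ' ≥ α > 0` near `0` is meant almost everywhere. -/
structure IsAdmissibleStress (σ : ℝ → ℝ) : Prop where
  /-- `σ` is locally Lipschitz on `(0,∞)`. -/
  locallyLipschitz : ∀ C : ℝ, 1 < C → ∃ L : ℝ≥0, LipschitzOnWith L σ (Icc (1 / C) C)
  /-- `σ(p) → -∞` as `p → 0+`. -/
  tendsto_zero : Tendsto σ (𝓝[>] 0) atBot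
  /-- `σ'(p) ≥ α > 0` for `p < θ`. -/
  deriv_lower : ∃ α θ : ℝ, 0 < α ∧ 0 < θ ∧
    ∀ᵐ p ∂(volume.restrict (Ioo (0 : ℝ) θ)), α ≤ deriv σ p
  /-- `W` is strictly convex for `p` sufficiently large. -/
  strictConvex_large : ∃ M : ℝ, 0 < M ∧ StrictConvexOn ℝ (Ici M) (storedEnergy σ)
  /-- `σ(p) > 0` for `p` sufficiently large. -/
  pos_large : ∀ᶠ p in atTop, 0 < σ p
  /-- `1/σ` is integrable on `(p₊ + 1, ∞)`, where `p₊` is the largest root of `σ`. -/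
  integrable_inv : ∃ pPlus : ℝ, IsGreatest {p : ℝ | 0 < p ∧ σ p = 0} pPlus ∧
    IntegrableOn (fun z => 1 / σ z) (Ioi (pPlus + 1))

/-- The phase space `X = {q ∈ L²(0,1) : q ≥ 0 a.e., ∫₀¹ q = μ}`. -/
def phaseSpace (μ : ℝ) : Set L2 :=
  {q | (∀ᵐ x ∂(volume.restrict (Ioo (0 : ℝ) 1)), 0 ≤ q x) ∧ ∫ x in Ioo (0 : ℝ) 1, q x = μ}

/-- `u : [0,T] → L²(0,1)` is a solution on `(0,1) × [0,T]` of
`p_t(x,t) = -σ(p(x,t)) + ∫₀¹ σ(p(y,t)) dy`, `p(x,0) = p₀(x)`, `∫₀¹ p(x,t) dx = μ`.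
The function `p = p(x,t)` is a representative of the path `u`. -/
structure IsSolutionOn (σ : ℝ → ℝ) (μ : ℝ) (p₀ : L2) (T : ℝ) (u : ℝ → L2) : Prop where
  continuousOn : ContinuousOn u (Icc 0 T)
  initial : u 0 = p₀
  mass : ∀ t ∈ Icc 0 T, ∫ x in Ioo (0 : ℝ) 1, u t x = μ
  exists_rep : ∃ p : ℝ → ℝ → ℝ,
    AEStronglyMeasurable (fun z : ℝ × ℝ => p z.1 z.2)
      (volume.restrict (Ioo (0 : ℝ) 1 ×ˢ Icc 0 T)) ∧
    (∀ t ∈ Icc 0 T, ∀ᵐ x ∂(volume.restrict (Ioo (0 : ℝ) 1)), p x t = u t x) ∧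
    (∀ᵐ z : ℝ × ℝ ∂(volume.restrict (Ioo (0 : ℝ) 1 ×ˢ Icc 0 T)), 0 < p z.1 z.2) ∧
    (∀ᵐ t ∂(volume.restrict (Icc 0 T)), IntegrableOn (fun x => σ (p x t)) (Ioo 0 1)) ∧
    (∀ᵐ x ∂(volume.restrict (Ioo (0 : ℝ) 1)), ∀ τ ∈ Ioo 0 T,
      IntegrableOn (fun t => σ (p x t) - ∫ y in Ioo (0 : ℝ) 1, σ (p y t)) (Ioo τ T)) ∧
    (∀ᵐ x ∂(volume.restrict (Ioo (0 : ℝ) 1)), ∀ s ∈ Ioc 0 T, ∀ t ∈ Ioc 0 T,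
      p x t = p x s - ∫ r in s..t, (σ (p x r) - ∫ y in Ioo (0 : ℝ) 1, σ (p y r)))

/-- The semiflow `S` on `X` consists of the solutions: for every `p₀ ∈ X` and every `T > 0`, a path
is a solution on `[0,T]` with initial value `p₀` if and only if it is `t ↦ S(t)p₀` on `[0,T]`. -/
def IsSolutionSemiflow (σ : ℝ → ℝ) (μ : ℝ) (S : Flow ℝ≥0 (phaseSpace μ)) : Prop :=
  ∀ (p₀ : phaseSpace μ) (T : ℝ), 0 < T → ∀ u : ℝ → L2,
    IsSolutionOn σ μ (p₀ : L2) T u ↔ ∀ t : ℝ≥0, (t : ℝ) ≤ T → u t = (S t p₀ : L2)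

/-- The set of equilibria. -/
def equilibria (σ : ℝ → ℝ) (μ : ℝ) : Set L2 :=
  {q | (∀ᵐ x ∂(volume.restrict (Ioo (0 : ℝ) 1)), 0 < q x) ∧
    (∃ C : ℝ, ∀ᵐ x ∂(volume.restrict (Ioo (0 : ℝ) 1)), σ (q x) = C) ∧
    ∫ x in Ioo (0 : ℝ) 1, q x = μ}

/-- The `ω`-limit set of a point: all limits of `S(t_j)p₀` along sequences `t_j → ∞`. -/
def omegaLimitSet {α : Type} [TopologicalSpace α] (S : Flow ℝ≥0 α) (p₀ : α) : Set α :=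
  {χ | ∃ t : ℕ → ℝ≥0, Tendsto t atTop atTop ∧ Tendsto (fun j => S (t j) p₀) atTop (𝓝 χ)}

end Viscoelastic

end

/-! Write F(v) = ∫ σ(v) - σ(v). For states with values in a compact [ε, R] ⊂ (0,∞), σ may be
replaced by its `truncation`, and the problem becomes an ODE in L² with a bounded, globally
Lipschitz field. Two facts lead from such bounded data to all of X.

First, σ + K·id is increasing on (0,∞) for some K (`exists_monotoneOn_add_linear`), and the nonlocal
term is constant in x, hence orthogonal to differences of states of equal mass. So F is one-sided
Lipschitz, and ‖u(t) - v(t)‖ ≤ exp(Kt) ‖u(0) - v(0)‖ with K independent of the bounds on u and v.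
Second, after any positive time τ solutions take values in a compact subset of (0,∞) depending only
on τ (`exists_bounds_after`): integrability of 1/σ lets an upper barrier descend from any height in
bounded time, and σ → -∞ at 0 drives a lower barrier up from 0. States bounded away from 0 and ∞ are
dense in X, so limits of bounded solutions exist for all data and form a continuous semiflow
(`exists_isStrongSolution`).

To identify the semiflow with (P), a jointly measurable representative solving the equation
pointwise is built (`exists_isPointwiseSolution`). Uniqueness (`eqOn_of_isPointwiseSolution`) must
hold for competitors without known bounds; there (p - q)² is differentiated in time for fixed x and
then integrated over x.

For the asymptotics, all the p(x,·) solve one scalar equation with a common forcing, so the order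
between points persists and u(t) is an increasing function of u(1) with values in a fixed interval.
Helly's theorem then makes orbits precompact in L², although the equation does not smooth in x. The
energy ∫ W(p) decreases at rate ‖F(u)‖²; it is constant along limit trajectories, so F vanishes on
ω-limit points (LaSalle). -/

noncomputable section

set_option linter.unusedSectionVars false

namespace Viscoelastic

/-! ### Consequences of the assumptions on the stress -/

namespace IsAdmissibleStress

variable {σ : ℝ → ℝ}

theorem exists_lipschitzOnWith (hσ : IsAdmissibleStress σ) {a : ℝ} (ha : 0 < a) (b : ℝ) :
    ∃ L : ℝ≥0, LipschitzOnWith L σ (Icc a b) := by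
  obtain ⟨L, hL⟩ := hσ.locallyLipschitz (max (1 / a) b + 1 + 1)
    (by have : 0 < max (1 / a) b := lt_of_lt_of_le (by positivity) (le_max_left _ _)
        linarith)
  have h1 : 1 / a ≤ max (1 / a) b := le_max_left _ _
  have h2 : b ≤ max (1 / a) b := le_max_right _ _
  have hpos : 0 < 1 / a := by positivity
  refine ⟨L, hL.mono (Icc_subset_Icc ?_ (by linarith))⟩
  rw [div_le_iff₀ (by linarith)]
  have : a * (1 / a) = 1 := by field_simp
  nlinarith

theorem continuousOn (hσ : IsAdmissibleStress σ) : ContinuousOn σ (Ioi 0) := by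
  intro x hx
  have hx : 0 < x := hx
  obtain ⟨L, hL⟩ := hσ.exists_lipschitzOnWith (half_pos hx) (x + 1)
  exact ((hL.continuousOn x ⟨by linarith, by linarith⟩).continuousAt
    (Icc_mem_nhds (by linarith) (by linarith))).continuousWithinAt

/-- A locally Lipschitz function is absolutely continuous on compact intervals, so increments of σ
are integrals of σ', to which the almost everywhere lower bound applies. -/
theorem exists_monotoneOn_small (hσ : IsAdmissibleStress σ) :
    ∃ θ : ℝ, 0 < θ ∧ MonotoneOn σ (Ioo 0 θ) := by
  obtain ⟨α, θ, hα, hθ, h⟩ := hσ.deriv_lower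
  refine ⟨θ, hθ, fun a ha b hb hab => ?_⟩
  obtain ⟨L, hL⟩ := hσ.exists_lipschitzOnWith ha.1 b
  have hac : AbsolutelyContinuousOnInterval σ a b :=
    LipschitzOnWith.absolutelyContinuousOnInterval (K := L) (by rwa [uIcc_of_le hab])
  have hint := hac.integral_deriv_eq_sub
  have : 0 ≤ ∫ x in a..b, deriv σ x := by
    refine intervalIntegral.integral_nonneg_of_ae_restrict hab ?_
    have := ae_restrict_of_ae_restrict_of_subset
      (Icc_subset_Ioo ha.1 hb.2 : Icc a b ⊆ Ioo 0 θ) h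
    filter_upwards [this] with x hx
    exact hα.le.trans hx
  linarith

theorem hasDerivAt_storedEnergy (hσ : IsAdmissibleStress σ) {p : ℝ} (hp : 0 < p) :
    HasDerivAt (storedEnergy σ) (σ p) p := by
  have hcont := hσ.continuousOn
  have hsub : uIcc 1 p ⊆ Ioi 0 := fun z hz => lt_of_lt_of_le (lt_min one_pos hp) hz.1
  refine intervalIntegral.integral_hasDerivAt_right
    (hcont.mono hsub).intervalIntegrable ?_ (hcont.continuousAt (Ioi_mem_nhds hp))
  exact hcont.stronglyMeasurableAtFilter isOpen_Ioi p hp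

/-- W' = σ on (0,∞), and a slope of the convex function W lies between its derivatives at the two
end points. -/
theorem exists_monotoneOn_large (hσ : IsAdmissibleStress σ) :
    ∃ M : ℝ, 0 < M ∧ MonotoneOn σ (Ici M) := by
  obtain ⟨M, hM, hconv⟩ := hσ.strictConvex_large
  refine ⟨M, hM, fun x hx y hy hxy => ?_⟩
  have hx' : M ≤ x := hx
  rcases hxy.eq_or_lt with rfl | hlt
  · exact le_rfl
  · exact (hconv.convexOn.le_slope_of_hasDerivAt hx hy hlt
      (hσ.hasDerivAt_storedEnergy (hM.trans_le hx'))).trans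
      (hconv.convexOn.slope_le_of_hasDerivAt hx hy hlt
      (hσ.hasDerivAt_storedEnergy (hM.trans_le (hx'.trans hxy))))

/-- `σ` is monotone up to a linear perturbation. -/
theorem exists_monotoneOn_add_linear (hσ : IsAdmissibleStress σ) :
    ∃ K : ℝ, 0 ≤ K ∧ MonotoneOn (fun z => σ z + K * z) (Ioi 0) := by
  obtain ⟨θ, hθ, hs⟩ := hσ.exists_monotoneOn_small
  obtain ⟨M, hM, hl⟩ := hσ.exists_monotoneOn_large
  -- σ can decrease only between the two monotone regimes; its Lipschitz constant on that compact
  -- interval serves as K.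
  obtain ⟨L, hL⟩ := hσ.exists_lipschitzOnWith (half_pos hθ) (max M θ)
  have hlin : Monotone fun z : ℝ => (L : ℝ) * z := fun a b h =>
    mul_le_mul_of_nonneg_left h L.2
  have h1 : MonotoneOn (fun z => σ z + L * z) (Ioc 0 (θ / 2)) :=
    (hs.mono fun z hz => ⟨hz.1, by linarith [hz.2]⟩).add (hlin.monotoneOn _)
  have h2 : MonotoneOn (fun z => σ z + L * z) (Icc (θ / 2) (max M θ)) := by
    intro a ha b hb hab
    have := hL.dist_le_mul a ha b hb
    rw [Real.dist_eq, Real.dist_eq, abs_sub_comm a b, abs_of_nonneg (sub_nonneg.2 hab)] at this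
    have h3 := (abs_le.1 this).2
    simp only
    linarith
  have h3 : MonotoneOn (fun z => σ z + L * z) (Ici (max M θ)) :=
    (hl.mono (Ici_subset_Ici.2 (le_max_left _ _))).add (hlin.monotoneOn _)
  have hle : θ / 2 ≤ max M θ := by linarith [le_max_right M θ]
  have h12 := h1.union_right h2 (isGreatest_Ioc (half_pos hθ)) (isLeast_Icc hle)
  rw [Ioc_union_Icc_eq_Ioc (half_pos hθ) hle] at h12
  have h123 := h12.union_right h3 (isGreatest_Ioc ((half_pos hθ).trans_le hle)) isLeast_Ici
  rw [Ioc_union_Ici_eq_Ioi ((half_pos hθ).trans_le hle)] at h123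
  exact ⟨L, L.2, h123⟩

/-- Convexity alone would let σ level off; but if σ < B for all large arguments, then 1/σ ≥ 1/B is
not integrable on a half-line. -/
theorem tendsto_atTop (hσ : IsAdmissibleStress σ) : Tendsto σ atTop atTop := by
  obtain ⟨M, hM, hl⟩ := hσ.exists_monotoneOn_large
  obtain ⟨N, hN⟩ := eventually_atTop.1 hσ.pos_large
  obtain ⟨P, -, hint⟩ := hσ.integrable_inv
  refine Filter.tendsto_atTop.2 fun B => ?_
  by_contra hB
  have hbd : ∀ z, M ≤ z → σ z < B := by
    intro z hz
    by_contra h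
    refine hB (eventually_atTop.2 ⟨z, fun y hy => (not_lt.1 h).trans (hl hz (hz.trans hy) hy)⟩)
  set A := max (max M N) (P + 1)
  have hint' := hint.mono_set (Ioi_subset_Ioi (le_max_right (max M N) (P + 1)) : Ioi A ⊆ _)
  have hBpos : 0 < B := (hN A ((le_max_right M N).trans (le_max_left _ _))).trans
    (hbd A ((le_max_left M N).trans (le_max_left _ _)))
  have hconst : IntegrableOn (fun _ : ℝ => 1 / B) (Ioi A) := by
    refine hint'.mono' (by fun_prop) ?_
    filter_upwards [ae_restrict_mem measurableSet_Ioi] with z hz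
    have hz : A < z := hz
    have hMz : M ≤ z := ((le_max_left M N).trans (le_max_left _ _)).trans hz.le
    have hNz : N ≤ z := ((le_max_right M N).trans (le_max_left _ _)).trans hz.le
    rw [Real.norm_of_nonneg (by positivity)]
    exact one_div_le_one_div_of_le (hN z hNz) (hbd z hMz).le
  rw [integrableOn_const_iff (by finiteness)] at hconst
  simp at hconst
  linarith

/-- Beyond some point, `σ` is increasing and attains its maximum over `(0, R]` at `R`. -/
theorem exists_upper_threshold (hσ : IsAdmissibleStress σ) :
    ∃ R₀ : ℝ, 0 < R₀ ∧ MonotoneOn σ (Ici R₀) ∧ ∀ R, R₀ ≤ R → ∀ z ∈ Ioc 0 R, σ z ≤ σ R := by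
  obtain ⟨θ, hθ, hs⟩ := hσ.exists_monotoneOn_small
  obtain ⟨M, hM, hl⟩ := hσ.exists_monotoneOn_large
  obtain ⟨B, hB⟩ := (isCompact_Icc.image_of_continuousOn
    (hσ.continuousOn.mono fun z hz => (half_pos hθ).trans_le hz.1 :
      ContinuousOn σ (Icc (θ / 2) (max M θ)))).bddAbove
  have hB' : ∀ z ∈ Icc (θ / 2) (max M θ), σ z ≤ B := fun z hz => hB ⟨z, hz, rfl⟩
  have hle : θ / 2 ≤ max M θ := by linarith [le_max_right M θ]
  obtain ⟨N, hN⟩ := eventually_atTop.1 (hσ.tendsto_atTop.eventually_ge_atTop B)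
  refine ⟨max M N, hM.trans_le (le_max_left _ _), hl.mono (Ici_subset_Ici.2 (le_max_left _ _)),
    fun R hR z hz => ?_⟩
  have hBR : B ≤ σ R := hN R ((le_max_right _ _).trans hR)
  have hMR : M ≤ R := (le_max_left _ _).trans hR
  rcases le_or_gt z (θ / 2) with h | h
  · exact (hs ⟨hz.1, by linarith⟩ ⟨half_pos hθ, by linarith⟩ h).trans
      ((hB' _ ⟨le_rfl, hle⟩).trans hBR)
  · rcases le_or_gt z (max M θ) with h' | h'
    · exact (hB' z ⟨h.le, h'⟩).trans hBR
    · exact hl ((le_max_left M θ).trans h'.le) hMR hz.2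

/-- `σ` is bounded above on bounded subsets of `(0,∞)`. -/
theorem exists_le (hσ : IsAdmissibleStress σ) (a : ℝ) : ∃ B, ∀ z ∈ Ioc 0 a, σ z ≤ B := by
  obtain ⟨R₀, -, -, h⟩ := hσ.exists_upper_threshold
  exact ⟨σ (max R₀ a), fun z hz => h _ (le_max_left _ _) z ⟨hz.1, hz.2.trans (le_max_right _ _)⟩⟩

/-- `σ` is bounded below away from `0`. -/
theorem exists_ge (hσ : IsAdmissibleStress σ) {a : ℝ} (ha : 0 < a) : ∃ B, ∀ z, a ≤ z → B ≤ σ z := by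
  obtain ⟨M, hM, hl⟩ := hσ.exists_monotoneOn_large
  obtain ⟨B, hB⟩ := (isCompact_Icc.image_of_continuousOn
    (hσ.continuousOn.mono fun z hz => ha.trans_le hz.1 :
      ContinuousOn σ (Icc a (max M a)))).bddBelow
  refine ⟨B, fun z hz => ?_⟩
  rcases le_or_gt z (max M a) with h | h
  · exact hB ⟨z, ⟨hz, h⟩, rfl⟩
  · exact (hB ⟨max M a, ⟨le_max_right _ _, le_rfl⟩, rfl⟩).trans
      (hl (le_max_left M a) ((le_max_left M a).trans h.le) h.le)

theorem exists_forall_le_of_small (hσ : IsAdmissibleStress σ) (B : ℝ) :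
    ∃ δ : ℝ, 0 < δ ∧ ∀ m ∈ Ioc 0 δ, σ m ≤ B := by
  have := (hσ.tendsto_zero.eventually_le_atBot B)
  obtain ⟨δ, hδ, h⟩ := mem_nhdsGT_iff_exists_Ioc_subset.1 this
  exact ⟨δ, hδ, h⟩

/-- Near `0`, `σ` is increasing and attains its minimum over `[m, ∞)` at `m`. -/
theorem exists_lower_threshold (hσ : IsAdmissibleStress σ) :
    ∃ m₀ : ℝ, 0 < m₀ ∧ MonotoneOn σ (Ioc 0 m₀) ∧ ∀ m ∈ Ioc 0 m₀, ∀ z, m ≤ z → σ m ≤ σ z := by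
  obtain ⟨θ, hθ, hs⟩ := hσ.exists_monotoneOn_small
  obtain ⟨B, hB⟩ := hσ.exists_ge (half_pos hθ)
  obtain ⟨δ, hδ, h⟩ := hσ.exists_forall_le_of_small B
  have hθ2 := half_pos hθ
  refine ⟨min δ (θ / 2), lt_min hδ hθ2, hs.mono fun z hz => ⟨hz.1, ?_⟩, fun m hm z hz => ?_⟩
  · linarith [hz.2.trans (min_le_right _ _)]
  rcases le_or_gt (θ / 2) z with h' | h'
  · exact (h m ⟨hm.1, hm.2.trans (min_le_left _ _)⟩).trans (hB z h')
  · exact hs ⟨hm.1, by linarith⟩ ⟨hm.1.trans_le hz, by linarith⟩ hz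

/-- Integral test for the decreasing function 1/σ. Up to a constant factor, 1/σ(k) is the time an
upper barrier needs to fall from k + 1 to k, so the sum measures a descent from infinity. -/
theorem exists_summable_inv (hσ : IsAdmissibleStress σ) :
    ∃ k₀ : ℕ, (∀ z : ℝ, k₀ ≤ z → 0 < σ z) ∧ Summable fun k : ℕ => 1 / σ (k₀ + k : ℕ) := by
  obtain ⟨M, hM, hl⟩ := hσ.exists_monotoneOn_large
  obtain ⟨N, hN⟩ := eventually_atTop.1 hσ.pos_large
  obtain ⟨P, -, hint⟩ := hσ.integrable_inv
  obtain ⟨n, hn⟩ := exists_nat_gt (max (max M N) (P + 1))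
  have hMn : M ≤ n := ((le_max_left M N).trans (le_max_left _ _)).trans hn.le
  have hNn : N ≤ n := ((le_max_right M N).trans (le_max_left _ _)).trans hn.le
  have hPn : P + 1 ≤ n := (le_max_right _ _).trans hn.le
  have hpos : ∀ z : ℝ, n ≤ z → 0 < σ z := fun z hz => hN z (hNn.trans hz)
  have hanti : ∀ m : ℕ, AntitoneOn (fun z => 1 / σ z) (Icc (n : ℝ) (n + m)) := fun m x hx y hy hxy =>
    one_div_le_one_div_of_le (hpos x hx.1) (hl (hMn.trans hx.1) (hMn.trans hy.1) hxy)
  refine ⟨n, hpos, ?_⟩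
  rw [← summable_nat_add_iff 1]
  have hint' := hint.mono_set (Ioi_subset_Ioi hPn)
  refine summable_of_sum_range_le (c := ∫ z in Ioi (n : ℝ), 1 / σ z)
    (fun k => (one_div_pos.2 (hpos _ (by push_cast; linarith))).le) fun m => ?_
  have h := (hanti m).sum_le_integral
  have hle : ∫ z in (n : ℝ)..n + m, 1 / σ z ≤ ∫ z in Ioi (n : ℝ), 1 / σ z := by
    rw [intervalIntegral.integral_of_le (by simp)]
    refine setIntegral_mono_set hint' ?_ (Ioc_subset_Ioi_self.eventuallyLE)
    filter_upwards [ae_restrict_mem measurableSet_Ioi] with z hz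
    exact (one_div_pos.2 (hpos z (le_of_lt hz))).le
  refine le_trans (le_of_eq ?_) (h.trans hle)
  simp

end IsAdmissibleStress

/-! ### Gronwall inequalities and global solvability of Lipschitz ODEs -/

section RealAnalysis

/-- The factor exp(-K (t - a)) turns the inequality into antitonicity; neither K nor f needs a sign.
-/
theorem le_exp_mul_of_hasDerivAt_le {f f' : ℝ → ℝ} {K a b : ℝ} (hab : a ≤ b)
    (hf : ContinuousOn f (Icc a b)) (hf' : ∀ t ∈ Ioo a b, HasDerivAt f (f' t) t)
    (hle : ∀ t ∈ Ioo a b, f' t ≤ K * f t) : f b ≤ Real.exp (K * (b - a)) * f a := by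
  have hd : ∀ t ∈ Ioo a b, HasDerivAt (fun t => Real.exp (-K * (t - a)) * f t)
      (Real.exp (-K * (t - a)) * (f' t - K * f t)) t := by
    intro t ht
    have h1 : HasDerivAt (fun t => Real.exp (-K * (t - a))) (Real.exp (-K * (t - a)) * (-K)) t := by
      have := (((hasDerivAt_id t).sub_const a).const_mul (-K)).exp
      simpa using this
    exact (h1.mul (hf' t ht)).congr_deriv (by ring)
  have hanti : AntitoneOn (fun t => Real.exp (-K * (t - a)) * f t) (Icc a b) := by
    refine antitoneOn_of_deriv_nonpos (convex_Icc a b) (by fun_prop) ?_ ?_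
    · rw [interior_Icc]
      exact fun t ht => (hd t ht).differentiableAt.differentiableWithinAt
    · rw [interior_Icc]
      intro t ht
      rw [(hd t ht).deriv]
      exact mul_nonpos_of_nonneg_of_nonpos (Real.exp_pos _).le (by linarith [hle t ht])
  have := hanti (left_mem_Icc.2 hab) (right_mem_Icc.2 hab) hab
  simp only [sub_self, mul_zero, Real.exp_zero, one_mul] at this
  have h2 := mul_le_mul_of_nonneg_left this (Real.exp_pos (K * (b - a))).le
  rwa [← mul_assoc, ← Real.exp_add, neg_mul, add_neg_cancel, Real.exp_zero, one_mul] at h2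

/-- Gronwall's inequality in integral form, with zero initial value. -/
theorem nonpos_of_le_mul_integral {φ : ℝ → ℝ} {K a b : ℝ} (hK : 0 ≤ K)
    (hφ : ContinuousOn φ (Icc a b)) (hle : ∀ t ∈ Icc a b, φ t ≤ K * ∫ r in a..t, φ r) :
    ∀ t ∈ Icc a b, φ t ≤ 0 := by
  intro t ht
  have hsub : Icc a t ⊆ Icc a b := Icc_subset_Icc_right ht.2
  have hI : ∫ r in a..t, φ r ≤ 0 := by
    have := le_exp_mul_of_hasDerivAt_le (f := fun t => ∫ r in a..t, φ r) (f' := φ) (K := K)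
      ht.1 ?_ ?_ ?_
    · simpa using this
    · have hint : IntegrableOn φ (uIcc a t) := by
        rw [uIcc_of_le ht.1]; exact (hφ.mono hsub).integrableOn_Icc
      have := intervalIntegral.continuousOn_primitive_interval hint
      rwa [uIcc_of_le ht.1] at this
    · intro s hs
      have hs' : Icc a s ⊆ Icc a b := Icc_subset_Icc_right (hs.2.le.trans ht.2)
      refine intervalIntegral.integral_hasDerivAt_right ?_ ?_ ?_
      · exact ContinuousOn.intervalIntegrable_of_Icc hs.1.le (hφ.mono hs')
      · exact (hφ.mono Ioo_subset_Icc_self).stronglyMeasurableAtFilter isOpen_Ioo s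
          ⟨hs.1, hs.2.trans_le ht.2⟩
      · exact hφ.continuousAt (Icc_mem_nhds hs.1 (hs.2.trans_le ht.2))
    · exact fun s hs => hle s ⟨hs.1.le, hs.2.le.trans ht.2⟩
  exact (hle t ht).trans (mul_nonpos_of_nonneg_of_nonpos hK hI)

theorem norm_le_exp_mul_of_inner_le {H : Type*} [NormedAddCommGroup H] [InnerProductSpace ℝ H]
    {w w' : ℝ → H} {K a b : ℝ} (hab : a ≤ b)
    (hw : ContinuousOn w (Icc a b)) (hw' : ∀ t ∈ Ioo a b, HasDerivAt w (w' t) t)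
    (hle : ∀ t ∈ Ioo a b, inner ℝ (w t) (w' t) ≤ K * ‖w t‖ ^ 2) :
    ‖w b‖ ≤ Real.exp (K * (b - a)) * ‖w a‖ := by
  have h := le_exp_mul_of_hasDerivAt_le (f := fun t => ‖w t‖ ^ 2)
    (f' := fun t => 2 * inner ℝ (w t) (w' t)) (K := 2 * K) hab (hw.norm.pow 2)
    (fun t ht => (hw' t ht).norm_sq) (fun t ht => by linarith [hle t ht])
  have : Real.exp (2 * K * (b - a)) * ‖w a‖ ^ 2 = (Real.exp (K * (b - a)) * ‖w a‖) ^ 2 := by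
    rw [mul_pow, ← Real.exp_nat_mul]
    congr 2
    push_cast
    ring
  rw [this] at h
  exact le_of_sq_le_sq h (by positivity)

/-- Global solvability of autonomous differential equations with a bounded, globally Lipschitz
vector field. -/
theorem exists_forall_hasDerivAt_of_lipschitzWith {E : Type*} [NormedAddCommGroup E]
    [NormedSpace ℝ E] [CompleteSpace E] {F : E → E} {K B : ℝ≥0} (hF : LipschitzWith K F)
    (hB : ∀ x, ‖F x‖ ≤ B) (x₀ : E) :
    ∃ u : ℝ → E, u 0 = x₀ ∧ ∀ t, HasDerivAt u (F (u t)) t := by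
  have hloc : ∀ n : ℕ, ∃ u : ℝ → E, u 0 = x₀ ∧
      ∀ t ∈ Ioo (-(n : ℝ)) n, HasDerivAt u (F (u t)) t := by
    intro n
    have hn : (0 : ℝ) ∈ Icc (-(n : ℝ)) n := by simp
    -- The speed is at most B, so the ball of radius B * n suffices on all of [-n, n] and no
    -- smallness of the time interval is needed.
    have hPL : IsPicardLindelof (fun _ => F) (⟨0, hn⟩ : Icc (-(n : ℝ)) n) x₀ (B * n) 0 B K := by
      refine IsPicardLindelof.of_time_independent (fun x _ => hB x) (hF.lipschitzOnWith) ?_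
      simp
    obtain ⟨u, hu, hu'⟩ := hPL.exists_eq_forall_mem_Icc_hasDerivWithinAt₀
    exact ⟨u, hu, fun t ht => (hu' t ⟨ht.1.le, ht.2.le⟩).hasDerivAt (Icc_mem_nhds ht.1 ht.2)⟩
  choose u hu0 hu using hloc
  have heq : ∀ m n : ℕ, m ≤ n → EqOn (u m) (u n) (Ioo (-(m : ℝ)) m) := by
    intro m n hmn t ht
    have hmn' : (m : ℝ) ≤ n := by exact_mod_cast hmn
    have hm0 : (0 : ℝ) < m := by
      rcases ht with ⟨h1, h2⟩; linarith
    refine ODE_solution_unique_of_mem_Ioo (v := fun _ => F) (s := fun _ => univ) (K := K)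
      (t₀ := 0) (fun _ _ => hF.lipschitzOnWith) ⟨by linarith, hm0⟩
      (fun s hs => ⟨hu m s hs, mem_univ _⟩)
      (fun s hs => ⟨hu n s ⟨by linarith [hs.1], by linarith [hs.2]⟩, mem_univ _⟩)
      (by rw [hu0, hu0]) ht
  have hlt : ∀ t : ℝ, |t| < (⌈|t|⌉₊ + 1 : ℕ) := fun t => by
    push_cast; linarith [Nat.le_ceil |t|]
  -- The index ⌈|t|⌉₊ + 1 puts t inside the open interval of its local solution; the index ⌈|t|⌉₊ +
  -- 2 below serves all s near t at once.
  refine ⟨fun t => u (⌈|t|⌉₊ + 1) t, hu0 _, fun t => ?_⟩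
  have hev : (fun s => u (⌈|s|⌉₊ + 1) s) =ᶠ[𝓝 t] u (⌈|t|⌉₊ + 2) := by
    have h1 : Ioo (t - 1) (t + 1) ∈ 𝓝 t := Ioo_mem_nhds (by linarith) (by linarith)
    filter_upwards [h1] with s hs
    have hst : |s| ≤ |t| + 1 := by
      have := abs_sub_abs_le_abs_sub s t
      have h2 : |s - t| ≤ 1 := abs_le.2 ⟨by linarith [hs.1], by linarith [hs.2]⟩
      linarith
    refine heq _ _ ?_ (abs_lt.1 (hlt s))
    have : ⌈|s|⌉₊ ≤ ⌈|t|⌉₊ + 1 := by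
      rw [Nat.ceil_le]; push_cast; linarith [Nat.le_ceil |t|]
    omega
  have h3 := hu (⌈|t|⌉₊ + 2) t (abs_lt.1 ((hlt t).trans_le (by push_cast; linarith)))
  have h4 := h3.congr_of_eventuallyEq hev
  rw [← hev.self_of_nhds] at h4
  exact h4

end RealAnalysis

/-! ### The nonlocal vector field on L² -/

section NonlocalField

variable {Ω : Type*} [MeasurableSpace Ω] {P : Measure Ω} [IsProbabilityMeasure P]

/-- The superposition operator `v ↦ g ∘ v`, with value `0` where `g ∘ v ∉ L²`. -/
def nemytskii (g : ℝ → ℝ) (v : Lp ℝ 2 P) : Lp ℝ 2 P :=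
  open Classical in if h : MemLp (fun x => g (v x)) 2 P then h.toLp _ else 0

/-- The vector field `v ↦ -g ∘ v + ∫ g ∘ v`. -/
def nonlocalField (g : ℝ → ℝ) (v : Lp ℝ 2 P) : Lp ℝ 2 P :=
  Lp.const 2 P (∫ x, g (v x) ∂P) - nemytskii g v

theorem nemytskii_ae_eq {g : ℝ → ℝ} {v : Lp ℝ 2 P} (h : MemLp (fun x => g (v x)) 2 P) :
    nemytskii g v =ᵐ[P] fun x => g (v x) := by
  rw [nemytskii, dif_pos h]
  exact h.coeFn_toLp

theorem nonlocalField_ae_eq {g : ℝ → ℝ} {v : Lp ℝ 2 P} (h : MemLp (fun x => g (v x)) 2 P) :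
    nonlocalField g v =ᵐ[P] fun x => ∫ y, g (v y) ∂P - g (v x) := by
  filter_upwards [Lp.coeFn_sub (Lp.const 2 P (∫ x, g (v x) ∂P)) (nemytskii g v),
    nemytskii_ae_eq h, Lp.coeFn_const (p := 2) (μ := P) (∫ x, g (v x) ∂P)] with x h1 h2 h3
  rw [nonlocalField, h1, Pi.sub_apply, h2, h3]
  rfl

/-- Only the values of g along v matter, which lets σ and its truncations be exchanged on bounded
states. -/
theorem nonlocalField_congr {g h : ℝ → ℝ} {v : Lp ℝ 2 P}
    (hgh : (fun x => g (v x)) =ᵐ[P] fun x => h (v x)) : nonlocalField g v = nonlocalField h v := by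
  have : nemytskii g v = nemytskii h v := by
    unfold nemytskii
    by_cases H : MemLp (fun x => g (v x)) 2 P
    · rw [dif_pos H, dif_pos (H.ae_eq hgh)]
      exact MemLp.toLp_congr _ _ hgh
    · rw [dif_neg H, dif_neg (fun H' => H (H'.ae_eq hgh.symm))]
  rw [nonlocalField, nonlocalField, this, integral_congr_ae hgh]

theorem memLp_comp_of_lipschitzWith {g : ℝ → ℝ} {L : ℝ≥0} (hg : LipschitzWith L g)
    (v : Lp ℝ 2 P) : MemLp (fun x => g (v x)) 2 P := by
  have h1 : MemLp (fun x => |g 0| + L * |v x|) 2 P :=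
    (memLp_const |g 0|).add ((Lp.memLp v).norm.const_mul (L : ℝ))
  refine h1.of_le (hg.continuous.comp_aestronglyMeasurable (Lp.aestronglyMeasurable v))
    (Eventually.of_forall fun x => ?_)
  have := hg.dist_le_mul (v x) 0
  rw [Real.dist_eq, Real.dist_eq, sub_zero] at this
  rw [Real.norm_eq_abs, Real.norm_of_nonneg (by positivity)]
  have h2 := abs_sub_abs_le_abs_sub (g (v x)) (g 0)
  linarith

/-- As a pairing with the constant 1, the mass inherits linearity, continuity and differentiability
along paths from the Hilbert space structure. -/
theorem inner_Lp_const_one (v : Lp ℝ 2 P) : inner ℝ (Lp.const 2 P (1 : ℝ)) v = ∫ x, v x ∂P := by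
  rw [L2.inner_def]
  refine integral_congr_ae ?_
  filter_upwards [Lp.coeFn_const (p := 2) (μ := P) (1 : ℝ)] with x hx
  rw [hx]
  exact (real_inner_eq_re_inner ℝ _ _).trans (by simp)

theorem norm_Lp_const (c : ℝ) : ‖Lp.const 2 P c‖ = |c| := by
  have := Lp.norm_const (p := 2) (μ := P) c (by norm_num) 
  simpa using this

theorem abs_integral_le_norm (v : Lp ℝ 2 P) : |∫ x, v x ∂P| ≤ ‖v‖ := by
  rw [← inner_Lp_const_one]
  refine (abs_real_inner_le_norm _ _).trans ?_
  rw [norm_Lp_const]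
  simp

theorem integrable_coe (v : Lp ℝ 2 P) : Integrable v P := (Lp.memLp v).integrable (by norm_num)

theorem integrable_mul_coe (u v : Lp ℝ 2 P) : Integrable (fun x => u x * v x) P :=
  (Lp.memLp u).integrable_mul (Lp.memLp v)

theorem inner_eq_integral_mul (u v : Lp ℝ 2 P) : inner ℝ u v = ∫ x, u x * v x ∂P := by
  rw [L2.inner_def]
  exact integral_congr_ae (Eventually.of_forall fun x => by simp [mul_comm])

theorem norm_sq_eq_integral (u : Lp ℝ 2 P) : ‖u‖ ^ 2 = ∫ x, u x ^ 2 ∂P := by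
  rw [← real_inner_self_eq_norm_sq, inner_eq_integral_mul]
  simp_rw [sq]

theorem integral_nonlocalField {g : ℝ → ℝ} {v : Lp ℝ 2 P} (h : MemLp (fun x => g (v x)) 2 P) :
    ∫ x, nonlocalField g v x ∂P = 0 := by
  rw [integral_congr_ae (nonlocalField_ae_eq h), integral_sub (integrable_const _)
    (h.integrable (by norm_num))]
  simp

theorem lipschitzWith_nemytskii {g : ℝ → ℝ} {L : ℝ≥0} (hg : LipschitzWith L g) :
    LipschitzWith L (nemytskii g : Lp ℝ 2 P → Lp ℝ 2 P) := by
  refine LipschitzWith.of_dist_le_mul fun u v => ?_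
  rw [dist_eq_norm, dist_eq_norm]
  refine Lp.norm_le_mul_norm_of_ae_le_mul ?_
  filter_upwards [Lp.coeFn_sub (nemytskii g u) (nemytskii g v), Lp.coeFn_sub u v,
    nemytskii_ae_eq (memLp_comp_of_lipschitzWith hg u),
    nemytskii_ae_eq (memLp_comp_of_lipschitzWith hg v)] with x h1 h2 h3 h4
  rw [h1, h2, Pi.sub_apply, Pi.sub_apply, h3, h4]
  simpa [Real.dist_eq] using hg.dist_le_mul (u x) (v x)

theorem nonlocalField_eq {g : ℝ → ℝ} {L : ℝ≥0} (hg : LipschitzWith L g) (v : Lp ℝ 2 P) :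
    nonlocalField g v = Lp.const 2 P (∫ x, nemytskii g v x ∂P) - nemytskii g v := by
  rw [nonlocalField, integral_congr_ae (nemytskii_ae_eq (memLp_comp_of_lipschitzWith hg v))]

theorem lipschitzWith_nonlocalField {g : ℝ → ℝ} {L : ℝ≥0} (hg : LipschitzWith L g) :
    LipschitzWith (2 * L) (nonlocalField g : Lp ℝ 2 P → Lp ℝ 2 P) := by
  refine LipschitzWith.of_dist_le_mul fun u v => ?_
  have h := (lipschitzWith_nemytskii (P := P) hg).dist_le_mul u v
  rw [dist_eq_norm] at h ⊢
  have hsub : nonlocalField g u - nonlocalField g v =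
      Lp.const 2 P (∫ x, (nemytskii g u - nemytskii g v) x ∂P) - (nemytskii g u - nemytskii g v) := by
    rw [nonlocalField_eq hg, nonlocalField_eq hg, ← inner_Lp_const_one, ← inner_Lp_const_one,
      ← inner_Lp_const_one, inner_sub_right, map_sub]
    abel
  rw [hsub]
  refine (norm_sub_le _ _).trans ?_
  rw [norm_Lp_const]
  have h2 := abs_integral_le_norm (nemytskii g u - nemytskii g v)
  calc _ ≤ L * dist u v + L * dist u v := add_le_add (h2.trans h) h
    _ = _ := by push_cast; ring

theorem norm_nonlocalField_le {g : ℝ → ℝ} {L : ℝ≥0} {B : ℝ} (hg : LipschitzWith L g)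
    (hB : ∀ z, |g z| ≤ B) (v : Lp ℝ 2 P) : ‖nonlocalField g v‖ ≤ 2 * B := by
  have hB0 : 0 ≤ B := (abs_nonneg _).trans (hB 0)
  have h1 : ‖nemytskii g v‖ ≤ B := by
    have := Lp.norm_le_mul_norm_of_ae_le_mul (f := nemytskii g v) (g := Lp.const 2 P (1 : ℝ))
      (c := B) ?_
    · rw [norm_Lp_const] at this
      simpa using this
    · filter_upwards [nemytskii_ae_eq (memLp_comp_of_lipschitzWith hg v),
        Lp.coeFn_const (p := 2) (μ := P) (1 : ℝ)] with x h1 h2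
      rw [h1, h2]
      simpa using hB (v x)
  rw [nonlocalField_eq hg]
  refine (norm_sub_le _ _).trans ?_
  rw [norm_Lp_const]
  have := abs_integral_le_norm (nemytskii g v)
  linarith

/-- One-sided Lipschitz continuity of the nonlocal field between states of equal mass. -/
theorem inner_nonlocalField_sub_le {g : ℝ → ℝ} {K : ℝ} {s : Set ℝ}
    (hg : MonotoneOn (fun z => g z + K * z) s) {u v : Lp ℝ 2 P}
    (hu : ∀ᵐ x ∂P, u x ∈ s) (hv : ∀ᵐ x ∂P, v x ∈ s)
    (hgu : MemLp (fun x => g (u x)) 2 P) (hgv : MemLp (fun x => g (v x)) 2 P)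
    (hmass : ∫ x, u x ∂P = ∫ x, v x ∂P) :
    inner ℝ (u - v) (nonlocalField g u - nonlocalField g v) ≤ K * ‖u - v‖ ^ 2 := by
  set c := ∫ x, g (u x) ∂P - ∫ x, g (v x) ∂P with hc
  have hint : ∫ x, (u - v) x ∂P = 0 := by
    rw [← inner_Lp_const_one, inner_sub_right, inner_Lp_const_one, inner_Lp_const_one, hmass,
      sub_self]
  rw [inner_eq_integral_mul, norm_sq_eq_integral]
  have hsq : Integrable (fun x => (u - v) x ^ 2) P := by
    simpa only [sq] using integrable_mul_coe (u - v) (u - v)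
  -- The nonlocal terms differ by the constant c, which pairs to zero with u - v because the masses
  -- agree. Adding c * (u - v) therefore costs nothing and reduces the claim to a pointwise
  -- inequality.
  have : K * ∫ x, (u - v) x ^ 2 ∂P = ∫ x, (K * (u - v) x ^ 2 + c * (u - v) x) ∂P := by
    rw [integral_add (hsq.const_mul _) ((integrable_coe _).const_mul _), integral_const_mul,
      integral_const_mul, hint, mul_zero, add_zero]
  rw [this]
  refine integral_mono_ae (integrable_mul_coe _ _)
    ((hsq.const_mul _).add ((integrable_coe _).const_mul _)) ?_
  filter_upwards [hu, hv, Lp.coeFn_sub u v, Lp.coeFn_sub (nonlocalField g u) (nonlocalField g v),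
    nonlocalField_ae_eq hgu, nonlocalField_ae_eq hgv] with x hux hvx h1 h2 h3 h4
  simp only [h1, h2, h3, h4, Pi.sub_apply]
  rcases le_total (u x) (v x) with h | h
  · have := hg hux hvx h
    simp only at this
    nlinarith
  · have := hg hvx hux h
    simp only at this
    nlinarith

end NonlocalField

/-! ### Integral functionals on L² and a comparison principle -/

section Calculus

variable {Ω : Type*} [MeasurableSpace Ω] {P : Measure Ω} [IsProbabilityMeasure P]

/-- Mean value inequality. The constant is not sharp, but a quadratic remainder, uniform in a,
integrates to a multiple of the squared L² norm; this yields Fréchet differentiability of v ↦ ∫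
G(v). -/
theorem abs_sub_sub_le_of_lipschitz_deriv {G g : ℝ → ℝ} {L : ℝ≥0} (hg : LipschitzWith L g)
    (hG : ∀ z, HasDerivAt G (g z) z) (a b : ℝ) : |G b - G a - g a * (b - a)| ≤ L * (b - a) ^ 2 := by
  have key : ∀ z ∈ uIcc a b, HasDerivWithinAt (fun z => G z - g a * z) (g z - g a) (uIcc a b) z :=
    fun z _ => by
      exact (((hG z).sub ((hasDerivAt_id z).const_mul (g a))).congr_deriv
        (by simp)).hasDerivWithinAt
  have hbound : ∀ z ∈ uIcc a b, ‖g z - g a‖ ≤ L * |b - a| := by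
    intro z hz
    have := hg.dist_le_mul z a
    rw [Real.dist_eq, Real.dist_eq] at this
    rw [Real.norm_eq_abs]
    exact this.trans (mul_le_mul_of_nonneg_left (abs_sub_left_of_mem_uIcc hz) L.2)
  have := (convex_uIcc a b).norm_image_sub_le_of_norm_hasDerivWithin_le key hbound
    left_mem_uIcc right_mem_uIcc
  rw [Real.norm_eq_abs, Real.norm_eq_abs, mul_assoc, ← sq, sq_abs] at this
  convert! this using 2
  ring

theorem integrable_comp_of_lipschitz_deriv {G g : ℝ → ℝ} {L : ℝ≥0} (hg : LipschitzWith L g)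
    (hG : ∀ z, HasDerivAt G (g z) z) (v : Lp ℝ 2 P) : Integrable (fun x => G (v x)) P := by
  have hcont : Continuous G := continuous_iff_continuousAt.2 fun z => (hG z).continuousAt
  have h1 : Integrable (fun x => |G 0| + |g 0| * |v x| + L * (v x * v x)) P :=
    ((integrable_const _).add ((integrable_coe v).abs.const_mul _)).add
      ((integrable_mul_coe v v).const_mul _)
  refine h1.mono' (hcont.comp_aestronglyMeasurable (Lp.aestronglyMeasurable v))
    (Eventually.of_forall fun x => ?_)
  have := abs_sub_sub_le_of_lipschitz_deriv hg hG 0 (v x)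
  rw [sub_zero, sq] at this
  rw [Real.norm_eq_abs, ← abs_mul]
  have h3 : G (v x) = (G (v x) - G 0 - g 0 * v x) + G 0 + g 0 * v x := by ring
  rw [h3]
  have h4 := abs_add_le ((G (v x) - G 0 - g 0 * v x) + G 0) (g 0 * v x)
  have h5 := abs_add_le (G (v x) - G 0 - g 0 * v x) (G 0)
  linarith

/-- Integral functionals `v ↦ ∫ G ∘ v` with `G'` Lipschitz are differentiable on `L²`. -/
theorem hasFDerivAt_integral_comp {G g : ℝ → ℝ} {L : ℝ≥0} (hg : LipschitzWith L g)
    (hG : ∀ z, HasDerivAt G (g z) z) (v : Lp ℝ 2 P) :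
    HasFDerivAt (fun v : Lp ℝ 2 P => ∫ x, G (v x) ∂P) (innerSL ℝ (nemytskii g v)) v := by
  have hbd : ∀ w : Lp ℝ 2 P, ‖∫ x, G (w x) ∂P - ∫ x, G (v x) ∂P -
      innerSL ℝ (nemytskii g v) (w - v)‖ ≤ L * ‖w - v‖ ^ 2 := by
    intro w
    have hi1 := integrable_comp_of_lipschitz_deriv hg hG w
    have hi2 := integrable_comp_of_lipschitz_deriv hg hG v
    have hi3 := integrable_mul_coe (nemytskii g v) (w - v)
    have hi4 : Integrable (fun x => (w - v) x ^ 2) P := by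
      simpa only [sq] using integrable_mul_coe (w - v) (w - v)
    rw [innerSL_apply_apply, inner_eq_integral_mul, ← integral_sub hi1 hi2,
      ← integral_sub (f := fun x => G (w x) - G (v x)) (hi1.sub hi2) hi3,
      norm_sq_eq_integral, ← integral_const_mul]
    refine norm_integral_le_of_norm_le (hi4.const_mul _) ?_
    filter_upwards [Lp.coeFn_sub w v, nemytskii_ae_eq (memLp_comp_of_lipschitzWith hg v)]
      with x h1 h2
    simp only [h1, h2, Pi.sub_apply]
    exact abs_sub_sub_le_of_lipschitz_deriv hg hG (v x) (w x)
  rw [hasFDerivAt_iff_isLittleO]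
  refine (Asymptotics.IsBigO.of_bound L (Eventually.of_forall fun w => ?_)).trans_isLittleO
    (Asymptotics.isLittleO_norm_pow_id one_lt_two |>.comp_tendsto
      (tendsto_sub_nhds_zero_iff.2 (tendsto_id (x := 𝓝 v))))
  simpa using hbd w

theorem hasDerivAt_integral_comp {G g : ℝ → ℝ} {L : ℝ≥0} (hg : LipschitzWith L g)
    (hG : ∀ z, HasDerivAt G (g z) z) {u : ℝ → Lp ℝ 2 P} {u' : Lp ℝ 2 P} {t : ℝ}
    (hu : HasDerivAt u u' t) :
    HasDerivAt (fun s => ∫ x, G (u s x) ∂P) (inner ℝ (nemytskii g (u t)) u') t :=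
  (hasFDerivAt_integral_comp hg hG (u t)).comp_hasDerivAt t hu

theorem continuous_integral_comp {G g : ℝ → ℝ} {L : ℝ≥0} (hg : LipschitzWith L g)
    (hG : ∀ z, HasDerivAt G (g z) z) : Continuous fun v : Lp ℝ 2 P => ∫ x, G (v x) ∂P :=
  continuous_iff_continuousAt.2 fun v => (hasFDerivAt_integral_comp hg hG v).continuousAt

theorem lipschitzWith_max_zero : LipschitzWith 1 fun z : ℝ => max z 0 := by
  simpa using LipschitzWith.id.max_const (0 : ℝ)

theorem hasDerivAt_half_sq_max_zero (z : ℝ) :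
    HasDerivAt (fun z : ℝ => max z 0 ^ 2 / 2) (max z 0) z := by
  rcases lt_trichotomy z 0 with h | rfl | h
  · rw [max_eq_right h.le]
    refine (hasDerivAt_const z (0 : ℝ)).congr_of_eventuallyEq ?_
    filter_upwards [Iio_mem_nhds h] with y hy
    simp [max_eq_right (le_of_lt (show y < 0 from hy))]
  · rw [max_self, hasDerivAt_iff_isLittleO]
    refine (Asymptotics.IsBigO.of_bound 1 (Eventually.of_forall fun w => ?_)).trans_isLittleO
      (Asymptotics.isLittleO_norm_pow_id one_lt_two |>.comp_tendsto
      (tendsto_sub_nhds_zero_iff.2 (tendsto_id (x := 𝓝 (0 : ℝ)))))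
    have h1 : |max w 0| ≤ |w| := by
      rcases le_total w 0 with h | h
      · simp [max_eq_right h]
      · simp [max_eq_left h]
    have h2 : |max w 0| ^ 2 ≤ |w| ^ 2 := by gcongr
    simp only [max_self, sub_zero, smul_zero, Function.comp_apply, norm_pow, Real.norm_eq_abs,
      one_mul, ne_eq, OfNat.ofNat_ne_zero, not_false_eq_true, zero_pow, zero_div, abs_abs]
    rw [abs_div, abs_pow, abs_two]
    linarith [sq_nonneg |max w 0|]
  · rw [max_eq_left h.le]
    have : HasDerivAt (fun z : ℝ => z ^ 2 / 2) z z := by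
      simpa using ((hasDerivAt_id z).pow 2).div_const 2
    refine this.congr_of_eventuallyEq ?_
    filter_upwards [Ioi_mem_nhds h] with y hy
    simp [max_eq_left (le_of_lt (show 0 < y from hy))]

/-- A differential inequality for the positive part of a path in `L²` propagates the sign
condition `w ≤ 0`. -/
theorem ae_nonpos_of_deriv_le {w w' : ℝ → Lp ℝ 2 P} {L a b : ℝ} (hL : 0 ≤ L) (hab : a ≤ b)
    (hw : ContinuousOn w (Icc a b)) (hw' : ∀ t ∈ Ioo a b, HasDerivAt w (w' t) t)
    (hle : ∀ t ∈ Ioo a b, ∀ᵐ x ∂P, 0 < w t x → w' t x ≤ L * ∫ y, max (w t y) 0 ∂P)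
    (ha : ∀ᵐ x ∂P, w a x ≤ 0) : ∀ᵐ x ∂P, w b x ≤ 0 := by
  -- Gronwall for Φ(w) = ‖w⁺‖² / 2: its derivative is the pairing of w⁺ with w', and on a
  -- probability space L (∫ w⁺)² ≤ L ‖w⁺‖² = 2 L Φ(w).
  set Φ : Lp ℝ 2 P → ℝ := fun v => ∫ x, max (v x) 0 ^ 2 / 2 ∂P with hΦ
  have hΦc : Continuous Φ := continuous_integral_comp lipschitzWith_max_zero
    hasDerivAt_half_sq_max_zero
  have hint : ∀ v : Lp ℝ 2 P, Integrable (fun x => max (v x) 0 ^ 2 / 2) P := fun v =>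
    integrable_comp_of_lipschitz_deriv lipschitzWith_max_zero hasDerivAt_half_sq_max_zero v
  have hkey := le_exp_mul_of_hasDerivAt_le (f := fun t => Φ (w t)) (K := 2 * L)
    (f' := fun t => inner ℝ (nemytskii (fun z => max z 0) (w t)) (w' t)) hab
    (hΦc.comp_continuousOn hw)
    (fun t ht => hasDerivAt_integral_comp lipschitzWith_max_zero hasDerivAt_half_sq_max_zero
      (hw' t ht)) ?_
  · have h0 : Φ (w a) = 0 := by
      rw [hΦ]
      refine integral_eq_zero_of_ae ?_
      filter_upwards [ha] with x hx
      simp [max_eq_right hx]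
    rw [h0, mul_zero] at hkey
    have h1 : Φ (w b) = 0 := le_antisymm hkey (integral_nonneg fun x => by positivity)
    have h2 := (integral_eq_zero_iff_of_nonneg (fun x => by positivity) (hint (w b))).1 h1
    filter_upwards [h2] with x hx
    have h3 : max (w b x) 0 ^ 2 / 2 = 0 := hx
    have h4 : max (w b x) 0 = 0 := by
      have : max (w b x) 0 ^ 2 = 0 := by linarith
      exact pow_eq_zero_iff two_ne_zero |>.1 this
    exact max_eq_right_iff.1 h4
  · intro t ht
    set n := nemytskii (fun z => max z 0) (w t) with hn
    have hne : n =ᵐ[P] fun x => max (w t x) 0 :=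
      nemytskii_ae_eq (memLp_comp_of_lipschitzWith lipschitzWith_max_zero (w t))
    have hI : ∫ y, max (w t y) 0 ∂P = ∫ y, n y ∂P := (integral_congr_ae hne).symm
    have hnn : 0 ≤ ∫ y, n y ∂P := by
      rw [← hI]; exact integral_nonneg fun x => le_max_right _ _
    have h1 : inner ℝ n (w' t) ≤ L * (∫ y, n y ∂P) ^ 2 := by
      rw [inner_eq_integral_mul]
      have : L * (∫ y, n y ∂P) ^ 2 = ∫ x, (L * ∫ y, n y ∂P) * n x ∂P := by
        rw [integral_const_mul]; ring
      rw [this]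
      refine integral_mono_ae (integrable_mul_coe _ _) ((integrable_coe n).const_mul _) ?_
      filter_upwards [hle t ht, hne] with x hx hnx
      simp only [hnx]
      rcases le_or_gt (w t x) 0 with h | h
      · simp [max_eq_right h]
      · have := hx h
        rw [hI] at this
        rw [max_eq_left h.le]
        nlinarith
    have h2 : (∫ y, n y ∂P) ^ 2 ≤ ‖n‖ ^ 2 := by
      rw [← sq_abs]
      gcongr
      exact abs_integral_le_norm n
    have h3 : ‖n‖ ^ 2 = 2 * Φ (w t) := by
      rw [norm_sq_eq_integral, hΦ, ← integral_const_mul]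
      refine integral_congr_ae ?_
      filter_upwards [hne] with x hx
      rw [hx]; ring
    calc inner ℝ n (w' t) ≤ L * (∫ y, n y ∂P) ^ 2 := h1
      _ ≤ L * ‖n‖ ^ 2 := by gcongr
      _ = 2 * L * Φ (w t) := by rw [h3]; ring

end Calculus

/-- The stress, made constant outside `[ε, R]`. -/
def truncation (σ : ℝ → ℝ) (ε R : ℝ) (z : ℝ) : ℝ := σ (max ε (min z R))

/-! ### Regularity of the truncated stress -/

section Truncation

variable {σ : ℝ → ℝ} {ε R : ℝ}

theorem truncation_of_mem {z : ℝ} (hz : z ∈ Icc ε R) : truncation σ ε R z = σ z := by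
  rw [truncation, min_eq_left hz.2, max_eq_right hz.1]

theorem clamp_mem (hεR : ε ≤ R) (z : ℝ) : max ε (min z R) ∈ Icc ε R :=
  ⟨le_max_left _ _, max_le hεR (min_le_right _ _)⟩

theorem IsAdmissibleStress.exists_lipschitzWith_truncation (hσ : IsAdmissibleStress σ) (hε : 0 < ε)
    (hεR : ε ≤ R) : ∃ L : ℝ≥0, LipschitzWith L (truncation σ ε R) := by
  obtain ⟨L, hL⟩ := hσ.exists_lipschitzOnWith hε R
  refine ⟨L * 1, ?_⟩
  have h1 : LipschitzWith 1 fun z : ℝ => max ε (min z R) :=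
    (LipschitzWith.id.min_const R).const_max ε
  have h2 := hL.comp (h1.lipschitzOnWith (s := univ)) (fun z _ => clamp_mem hεR z)
  exact lipschitzOnWith_univ.1 h2

theorem IsAdmissibleStress.exists_abs_truncation_le (hσ : IsAdmissibleStress σ) (hε : 0 < ε)
    (hεR : ε ≤ R) : ∃ B : ℝ, ∀ z, |truncation σ ε R z| ≤ B := by
  obtain ⟨B, hB⟩ := isCompact_Icc.exists_bound_of_continuousOn
    (hσ.continuousOn.mono fun z hz => hε.trans_le hz.1 : ContinuousOn σ (Icc ε R))
  exact ⟨B, fun z => hB _ (clamp_mem hεR z)⟩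

end Truncation

/-! ### Bounded solutions: barriers, instantaneous bounds, existence, stability -/

section BoundedSolutions

variable {Ω : Type*} [MeasurableSpace Ω] {P : Measure Ω} [IsProbabilityMeasure P]
variable {σ : ℝ → ℝ} {μ : ℝ}

/-- A path in `L²` that solves the nonlocal equation after time `s`, with values in `[ε, R]` and
with mass `μ`. -/
structure IsBoundedSolution (σ : ℝ → ℝ) (μ ε R s : ℝ) (u : ℝ → Lp ℝ 2 P) : Prop where
  pos : 0 < ε
  continuousOn : ContinuousOn u (Ici s)
  mass : ∀ t, s ≤ t → ∫ x, u t x ∂P = μ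
  mem : ∀ t, s ≤ t → ∀ᵐ x ∂P, u t x ∈ Icc ε R
  hasDerivAt : ∀ t, s < t → HasDerivAt u (nonlocalField σ (u t)) t

theorem memLp_stress (hσ : IsAdmissibleStress σ) {ε R : ℝ} (hε : 0 < ε) {v : Lp ℝ 2 P}
    (hv : ∀ᵐ x ∂P, v x ∈ Icc ε R) : MemLp (fun x => σ (v x)) 2 P := by
  obtain ⟨x, hx⟩ := hv.exists
  obtain ⟨L, hL⟩ := hσ.exists_lipschitzWith_truncation hε (hx.1.trans hx.2)
  refine (memLp_comp_of_lipschitzWith hL v).ae_eq ?_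
  filter_upwards [hv] with x hx using truncation_of_mem hx

theorem nonlocalField_truncation {ε R : ℝ} {v : Lp ℝ 2 P} (hv : ∀ᵐ x ∂P, v x ∈ Icc ε R) :
    nonlocalField (truncation σ ε R) v = nonlocalField σ v := by
  refine nonlocalField_congr ?_
  filter_upwards [hv] with x hx using truncation_of_mem hx

theorem integral_mem_Icc {a b : ℝ} {v : Lp ℝ 2 P} (hv : ∀ᵐ x ∂P, v x ∈ Icc a b) :
    ∫ x, v x ∂P ∈ Icc a b := by
  have h1 := integral_mono_ae (integrable_const a) (integrable_coe v)
    (hv.mono fun x hx => hx.1)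
  have h2 := integral_mono_ae (integrable_coe v) (integrable_const b)
    (hv.mono fun x hx => hx.2)
  simpa using And.intro h1 h2

namespace IsBoundedSolution

variable {ε R s : ℝ} {u : ℝ → Lp ℝ 2 P}

theorem mono_start (h : IsBoundedSolution σ μ ε R s u) {s' : ℝ} (hs : s ≤ s') :
    IsBoundedSolution σ μ ε R s' u :=
  ⟨h.pos, h.continuousOn.mono (Ici_subset_Ici.2 hs), fun t ht => h.mass t (hs.trans ht),
    fun t ht => h.mem t (hs.trans ht), fun t ht => h.hasDerivAt t (hs.trans_lt ht)⟩

theorem mass_mem (h : IsBoundedSolution σ μ ε R s u) : μ ∈ Icc ε R := by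
  rw [← h.mass s le_rfl]
  exact integral_mem_Icc (h.mem s le_rfl)

theorem le (h : IsBoundedSolution σ μ ε R s u) : ε ≤ R := h.mass_mem.1.trans h.mass_mem.2

theorem memLp (h : IsBoundedSolution σ μ ε R s u) (hσ : IsAdmissibleStress σ) {t : ℝ}
    (ht : s ≤ t) : MemLp (fun x => σ (u t x)) 2 P :=
  memLp_stress hσ h.pos (h.mem t ht)

/-- A barrier from above, moving down with constant speed. -/
theorem upper_barrier (h : IsBoundedSolution σ μ ε R s u) (hσ : IsAdmissibleStress σ)
    (hμ : 0 < μ) {B κ r₁ r₂ a : ℝ} (hκ : 0 < κ) (hr : r₁ ≤ r₂) (hεr : ε ≤ r₁) (ha : s ≤ a)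
    (hmono : MonotoneOn σ (Ici r₁)) (hmax : ∀ ρ, r₁ ≤ ρ → ∀ z ∈ Ioc 0 ρ, σ z ≤ σ ρ)
    (hB : ∀ z ∈ Ioc 0 (2 * μ), σ z ≤ B) (hBκ : 2 * κ ≤ σ r₁ - B)
    (hu : ∀ᵐ x ∂P, u a x ≤ r₂) : ∀ᵐ x ∂P, u (a + (r₂ - r₁) / κ) x ≤ r₁ := by
  obtain ⟨L, hL⟩ := hσ.exists_lipschitzOnWith h.pos R
  -- The barrier falls with speed κ from r₂ to r₁. It suffices that (u - ρ)' ≤ L ∫ (u - ρ)⁺ wherever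
  -- u > ρ; L may depend on ε and R because it does not enter the conclusion.
  set ρ : ℝ → ℝ := fun t => r₂ - κ * (t - a) with hρ
  have hend : ρ (a + (r₂ - r₁) / κ) = r₁ := by rw [hρ]; field_simp; ring
  have hwc : ∀ t, ∀ᵐ x ∂P, (u t - Lp.const 2 P (ρ t)) x = u t x - ρ t := fun t => by
    filter_upwards [Lp.coeFn_sub (u t) (Lp.const 2 P (ρ t)),
      Lp.coeFn_const (p := 2) (μ := P) (ρ t)] with x h1 h2
    rw [h1, Pi.sub_apply, h2]
    rfl
  have hρd : ∀ t, HasDerivAt (fun t => Lp.const 2 P (ρ t)) (Lp.const 2 P (-κ)) t := by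
    intro t
    have h1 : HasDerivAt ρ (-κ) t := by
      have := ((hasDerivAt_id t).sub_const a).const_mul κ |>.const_sub r₂
      simpa using this
    exact (Lp.constL 2 P ℝ : ℝ →L[ℝ] Lp ℝ 2 P).hasFDerivAt.comp_hasDerivAt t h1
  have hle : a ≤ a + (r₂ - r₁) / κ := by
    have : 0 ≤ (r₂ - r₁) / κ := div_nonneg (sub_nonneg.2 hr) hκ.le
    linarith
  have key := ae_nonpos_of_deriv_le (P := P) (w := fun t => u t - Lp.const 2 P (ρ t))
    (w' := fun t => nonlocalField σ (u t) - Lp.const 2 P (-κ)) (L := L) L.2 hle ?_ ?_ ?_ ?_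
  · filter_upwards [key, hwc (a + (r₂ - r₁) / κ)] with x h1 h2
    rw [h2, hend] at h1
    linarith
  · refine ContinuousOn.sub (h.continuousOn.mono fun t ht => ha.trans ht.1) ?_
    exact fun t _ => (hρd t).continuousAt.continuousWithinAt
  · exact fun t ht => (h.hasDerivAt t (ha.trans_lt ht.1)).sub (hρd t)
  · intro t ht
    have hst : s ≤ t := ha.trans ht.1.le
    have hm := h.memLp hσ hst
    have hρt : r₁ ≤ ρ t := by
      rw [← hend]
      have : κ * (t - a) ≤ κ * (a + (r₂ - r₁) / κ - a) :=
        mul_le_mul_of_nonneg_left (by linarith [ht.2]) hκ.le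
      simp only [hρ]
      linarith
    have hσρ : σ r₁ ≤ σ (ρ t) := hmono self_mem_Ici hρt hρt
    -- Markov's inequality in linear form: u / (2μ) has integral 1/2 and dominates the indicator of
    -- {u > 2μ}. On that set σ(u) ≤ σ(ρ) up to L (u - ρ)⁺, and elsewhere σ(u) ≤ B. Above the barrier
    -- this leaves the drift -(σ(ρ) - B) / 2, which `hBκ` makes at most -κ.
    have hint : ∫ y, σ (u t y) ∂P ≤ B + (σ (ρ t) - B) / 2 +
        L * ∫ y, max ((u t - Lp.const 2 P (ρ t)) y) 0 ∂P := by
      have hi1 : Integrable (fun y => (σ (ρ t) - B) / (2 * μ) * u t y) P :=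
        (integrable_coe (u t)).const_mul _
      have hi2 : Integrable (fun y => L * max ((u t - Lp.const 2 P (ρ t)) y) 0) P :=
        ((integrable_coe (u t - Lp.const 2 P (ρ t))).pos_part).const_mul _
      have hi0 : Integrable (fun y => B + (σ (ρ t) - B) / (2 * μ) * u t y) P :=
        (integrable_const B).add hi1
      have : B + (σ (ρ t) - B) / 2 + L * ∫ y, max ((u t - Lp.const 2 P (ρ t)) y) 0 ∂P =
          ∫ y, (B + (σ (ρ t) - B) / (2 * μ) * u t y +
            L * max ((u t - Lp.const 2 P (ρ t)) y) 0) ∂P := by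
        rw [integral_add hi0 hi2, integral_add (integrable_const B) hi1, integral_const_mul,
          integral_const_mul, h.mass t hst]
        simp
        field_simp
      rw [this]
      refine integral_mono_ae (hm.integrable (by norm_num)) (hi0.add hi2) ?_
      filter_upwards [h.mem t hst, hwc t] with y hy hwy
      simp only [hwy]
      have hy0 : 0 < u t y := h.pos.trans_le hy.1
      have hD : 0 ≤ σ (ρ t) - B := by linarith
      have hmx : 0 ≤ L * max (u t y - ρ t) 0 := mul_nonneg L.2 (le_max_right _ _)
      rcases le_or_gt (u t y) (2 * μ) with h1 | h1
      · have h2 := hB _ ⟨hy0, h1⟩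
        have h3 : 0 ≤ (σ (ρ t) - B) / (2 * μ) * u t y := by positivity
        linarith
      · have h3 : σ (ρ t) - B ≤ (σ (ρ t) - B) / (2 * μ) * u t y := by
          rw [div_mul_eq_mul_div, le_div_iff₀ (by positivity)]
          exact mul_le_mul_of_nonneg_left h1.le hD
        rcases le_or_gt (u t y) (ρ t) with h4 | h4
        · have := hmax _ hρt _ ⟨hy0, h4⟩
          linarith
        · have h5 := hL.dist_le_mul _ hy (ρ t) ⟨hεr.trans hρt, h4.le.trans hy.2⟩
          rw [Real.dist_eq, Real.dist_eq, abs_of_pos (sub_pos.2 h4)] at h5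
          have h6 := (abs_le.1 h5).2
          rw [max_eq_left (sub_pos.2 h4).le]
          linarith
    filter_upwards [nonlocalField_ae_eq hm, hwc t, Lp.coeFn_const (p := 2) (μ := P) (-κ),
      Lp.coeFn_sub (nonlocalField σ (u t)) (Lp.const 2 P (-κ))] with x h1 h2 h3 h4 hpos
    rw [h4, Pi.sub_apply, h1, h3, Function.const_apply]
    rw [h2] at hpos
    have h5 : σ (ρ t) ≤ σ (u t x) := hmono hρt (hρt.trans (sub_pos.1 hpos).le) (sub_pos.1 hpos).le
    linarith
  · filter_upwards [hu, hwc a] with x h1 h2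
    rw [h2]
    simp only [hρ, sub_self, mul_zero, sub_zero]
    linarith

/-- A barrier from below, starting from `0` and moving up with speed `1`. -/
theorem lower_barrier (h : IsBoundedSolution σ μ ε R s u) (hσ : IsAdmissibleStress σ)
    {B e a : ℝ} (he : 0 ≤ e) (heμ : e ≤ μ) (ha : s ≤ a) (hμ : 0 < μ)
    (hmono : MonotoneOn σ (Ioc 0 e)) (hmin : ∀ m ∈ Ioc 0 e, ∀ z, m ≤ z → σ m ≤ σ z)
    (hB : ∀ z, μ / 2 ≤ z → B ≤ σ z) (hBe : ∀ m ∈ Ioc 0 e, σ m + 2 * R / μ ≤ B) :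
    ∀ᵐ x ∂P, e ≤ u (a + e) x := by
  obtain ⟨L, hL⟩ := hσ.exists_lipschitzOnWith h.pos R
  have hR : 0 < R := hμ.trans_le h.mass_mem.2
  set m : ℝ → ℝ := fun t => t - a with hm
  have hwc : ∀ t, ∀ᵐ x ∂P, (Lp.const 2 P (m t) - u t) x = m t - u t x := fun t => by
    filter_upwards [Lp.coeFn_sub (Lp.const 2 P (m t)) (u t),
      Lp.coeFn_const (p := 2) (μ := P) (m t)] with x h1 h2
    rw [h1, Pi.sub_apply, h2]
    rfl
  have hmd : ∀ t, HasDerivAt (fun t => Lp.const 2 P (m t)) (Lp.const 2 P 1) t := by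
    intro t
    have h1 : HasDerivAt m 1 t := (hasDerivAt_id t).sub_const a
    exact (Lp.constL 2 P ℝ : ℝ →L[ℝ] Lp ℝ 2 P).hasFDerivAt.comp_hasDerivAt t h1
  have key := ae_nonpos_of_deriv_le (P := P) (w := fun t => Lp.const 2 P (m t) - u t)
    (w' := fun t => Lp.const 2 P 1 - nonlocalField σ (u t)) (L := L) L.2
    (by linarith : a ≤ a + e) ?_ ?_ ?_ ?_
  · filter_upwards [key, hwc (a + e)] with x h1 h2
    rw [h2] at h1
    simp only [hm] at h1
    linarith
  · refine ContinuousOn.sub ?_ (h.continuousOn.mono fun t ht => ha.trans ht.1)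
    exact fun t _ => (hmd t).continuousAt.continuousWithinAt
  · exact fun t ht => (hmd t).sub (h.hasDerivAt t (ha.trans_lt ht.1))
  · intro t ht
    have hst : s ≤ t := ha.trans ht.1.le
    have hmem := h.memLp hσ hst
    have hmt : m t ∈ Ioc 0 e := ⟨sub_pos.2 ht.1, by simp only [hm]; linarith [ht.2]⟩
    have hD := hBe _ hmt
    have hRμ : 0 < 2 * R / μ := by positivity
    -- The weight (u - μ / 2) / R is at most 1, is negative where u < μ / 2, and has integral μ /
    -- (2R). So the points with u ≥ μ / 2, where σ(u) ≥ B, lift the average stress above σ(m) by (B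
    -- - σ(m)) μ / (2R), up to the L-term; by `hBe` the lift is at least 1, the speed of the
    -- barrier.
    have hint : σ (m t) + (B - σ (m t)) * (μ / (2 * R)) -
        L * ∫ y, max ((Lp.const 2 P (m t) - u t) y) 0 ∂P ≤ ∫ y, σ (u t y) ∂P := by
      have hi1 : Integrable (fun y => (B - σ (m t)) / R * (u t y - μ / 2)) P :=
        ((integrable_coe (u t)).sub (integrable_const _)).const_mul _
      have hi2 : Integrable (fun y => L * max ((Lp.const 2 P (m t) - u t) y) 0) P :=
        ((integrable_coe (Lp.const 2 P (m t) - u t)).pos_part).const_mul _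
      have hi0 : Integrable (fun y => σ (m t) + (B - σ (m t)) / R * (u t y - μ / 2)) P :=
        (integrable_const _).add hi1
      have : σ (m t) + (B - σ (m t)) * (μ / (2 * R)) -
          L * ∫ y, max ((Lp.const 2 P (m t) - u t) y) 0 ∂P =
          ∫ y, (σ (m t) + (B - σ (m t)) / R * (u t y - μ / 2) -
            L * max ((Lp.const 2 P (m t) - u t) y) 0) ∂P := by
        rw [integral_sub hi0 hi2, integral_add (integrable_const _) hi1, integral_const_mul,
          integral_const_mul, integral_sub (integrable_coe _) (integrable_const _), h.mass t hst]
        simp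
        field_simp
        ring
      rw [this]
      refine integral_mono_ae (hi0.sub hi2) (hmem.integrable (by norm_num)) ?_
      filter_upwards [h.mem t hst, hwc t] with y hy hwy
      simp only [hwy]
      have hmx : 0 ≤ L * max (m t - u t y) 0 := mul_nonneg L.2 (le_max_right _ _)
      have hD0 : 0 ≤ B - σ (m t) := by linarith
      rcases le_or_gt (μ / 2) (u t y) with h1 | h1
      · have h3 : (B - σ (m t)) / R * (u t y - μ / 2) ≤ B - σ (m t) := by
          rw [div_mul_eq_mul_div, div_le_iff₀ hR]
          exact mul_le_mul_of_nonneg_left (by linarith [hy.2]) hD0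
        have := hB _ h1
        linarith
      · have h3 : (B - σ (m t)) / R * (u t y - μ / 2) ≤ 0 :=
          mul_nonpos_of_nonneg_of_nonpos (by positivity) (by linarith)
        rcases le_or_gt (m t) (u t y) with h4 | h4
        · have := hmin _ hmt _ h4
          linarith
        · have h5 := hL.dist_le_mul (m t)
            ⟨hy.1.trans h4.le, (hmt.2.trans heμ).trans h.mass_mem.2⟩ _ hy
          rw [Real.dist_eq, Real.dist_eq, abs_of_pos (sub_pos.2 h4)] at h5
          have h6 := (abs_le.1 h5).2
          rw [max_eq_left (sub_pos.2 h4).le]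
          linarith
    have hlam : 1 ≤ (B - σ (m t)) * (μ / (2 * R)) := by
      have : 2 * R / μ * (μ / (2 * R)) = 1 := by field_simp
      rw [← this]
      exact mul_le_mul_of_nonneg_right (by linarith) (by positivity)
    filter_upwards [nonlocalField_ae_eq hmem, hwc t, Lp.coeFn_const (p := 2) (μ := P) (1 : ℝ),
      Lp.coeFn_sub (Lp.const 2 P 1) (nonlocalField σ (u t)), h.mem t hst] with x h1 h2 h3 h4 hx hpos
    rw [h4, Pi.sub_apply, h1, h3, Function.const_apply]
    rw [h2] at hpos
    have h0 : 0 < u t x := h.pos.trans_le hx.1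
    have h5 : σ (u t x) ≤ σ (m t) :=
      hmono ⟨h0, (sub_pos.1 hpos).le.trans hmt.2⟩ hmt (sub_pos.1 hpos).le
    linarith
  · filter_upwards [h.mem a ha, hwc a] with x h1 h2
    rw [h2]
    simp only [hm, sub_self]
    linarith [h.pos, h1.1]

end IsBoundedSolution

/-- From an arbitrary bound R the barrier descends one integer level at a time, spending 4 / σ(N +
i) between N + i + 1 and N + i. By summability the total time is at most τ once N is large, and N
does not depend on R. -/
theorem exists_upper_bound_after (hσ : IsAdmissibleStress σ) (hμ : 0 < μ) {τ : ℝ} (hτ : 0 < τ) :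
    ∃ r : ℝ, ∀ (ε R s : ℝ) (u : ℝ → Lp ℝ 2 P), IsBoundedSolution σ μ ε R s u →
      ∀ t, s + τ ≤ t → ∀ᵐ x ∂P, u t x ≤ r := by
  obtain ⟨R₀, hR₀, hmono, hmax⟩ := hσ.exists_upper_threshold
  obtain ⟨k₀, hpos, hsum⟩ := hσ.exists_summable_inv
  obtain ⟨B, hB⟩ := hσ.exists_le (2 * μ)
  obtain ⟨z₀, hz₀⟩ := eventually_atTop.1 (hσ.tendsto_atTop.eventually_ge_atTop (2 * B))
  have htail := tendsto_sum_nat_add fun k : ℕ => 1 / σ (k₀ + k : ℕ)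
  -- The tail is kept below τ / 4 because each step costs 4 / σ. Beyond z₀ one has σ ≥ 2B, which for
  -- κ = σ / 4 is the condition 2κ ≤ σ - B of `upper_barrier`.
  obtain ⟨n, hn, hnτ⟩ : ∃ n : ℕ, max (max R₀ z₀) μ ≤ (n : ℝ) ∧
      ∑' k : ℕ, 1 / σ (k₀ + (k + n) : ℕ) < τ / 4 :=
    ((tendsto_natCast_atTop_atTop.eventually_ge_atTop (max (max R₀ z₀) μ)).and
      (htail.eventually_lt_const (by linarith : (0 : ℝ) < τ / 4))).exists
  set N := k₀ + n with hN
  have hNn : (n : ℝ) ≤ N := by rw [hN]; push_cast; linarith [(Nat.cast_nonneg k₀ : (0 : ℝ) ≤ k₀)]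
  have hNR : R₀ ≤ N := ((le_max_left _ _).trans ((le_max_left _ _).trans hn)).trans hNn
  have hNz : z₀ ≤ N := ((le_max_right _ _).trans ((le_max_left _ _).trans hn)).trans hNn
  have hNμ : μ ≤ N := ((le_max_right _ _).trans hn).trans hNn
  have hNk : (k₀ : ℝ) ≤ N := by rw [hN]; push_cast; linarith [(Nat.cast_nonneg n : (0 : ℝ) ≤ n)]
  have hsN : Summable fun k : ℕ => 1 / σ ((N + k : ℕ) : ℝ) := by
    have := (summable_nat_add_iff n).2 hsum
    refine this.congr fun k => ?_
    rw [hN, show k₀ + (k + n) = k₀ + n + k by ring]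
  have htot : ∀ j : ℕ, ∑ i ∈ Finset.range j, 4 / σ ((N + i : ℕ) : ℝ) ≤ τ := by
    intro j
    have h1 : ∑ i ∈ Finset.range j, 1 / σ ((N + i : ℕ) : ℝ) ≤ ∑' k : ℕ, 1 / σ ((N + k : ℕ) : ℝ) :=
      hsN.sum_le_tsum _ fun k _ => (one_div_pos.2 (hpos _ (by push_cast; linarith [
        (Nat.cast_nonneg k : (0 : ℝ) ≤ k)]))).le
    have h2 : ∑' k : ℕ, 1 / σ ((N + k : ℕ) : ℝ) = ∑' k : ℕ, 1 / σ (k₀ + (k + n) : ℕ) :=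
      tsum_congr fun k => by rw [hN, show k₀ + (k + n) = k₀ + n + k by ring]
    have h3 : ∑ i ∈ Finset.range j, 4 / σ ((N + i : ℕ) : ℝ) =
        4 * ∑ i ∈ Finset.range j, 1 / σ ((N + i : ℕ) : ℝ) := by
      rw [Finset.mul_sum]
      exact Finset.sum_congr rfl fun i _ => by ring
    rw [h3]
    linarith
  refine ⟨N, fun ε R s u h => ?_⟩
  -- The bound N + j is assumed for all t ≥ s', so that for every later t' a separate barrier can be
  -- started one step duration earlier.
  have hdown : ∀ (j : ℕ) (s' : ℝ), s ≤ s' → (∀ t, s' ≤ t → ∀ᵐ x ∂P, u t x ≤ (N + j : ℕ)) →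
      ∀ t, s' + ∑ i ∈ Finset.range j, 4 / σ ((N + i : ℕ) : ℝ) ≤ t → ∀ᵐ x ∂P, u t x ≤ N := by
    intro j
    induction j with
    | zero =>
      intro s' _ h1 t ht
      simpa using h1 t (by simpa using ht)
    | succ j ih =>
      intro s' hs' h1 t ht
      have hNj : (N : ℝ) ≤ (N + j : ℕ) := by push_cast; linarith [(Nat.cast_nonneg j : (0 : ℝ) ≤ j)]
      have hσj : 0 < σ ((N + j : ℕ) : ℝ) := hpos _ (hNk.trans hNj)
      have hτj : 0 ≤ 4 / σ ((N + j : ℕ) : ℝ) := by positivity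
      refine ih (s' + 4 / σ ((N + j : ℕ) : ℝ)) (by linarith) (fun t' ht' => ?_) t ?_
      · have hb := h.upper_barrier hσ hμ (B := B) (κ := σ ((N + j : ℕ) : ℝ) / 4)
          (r₁ := (N + j : ℕ)) (r₂ := (N + (j + 1) : ℕ)) (a := t' - 4 / σ ((N + j : ℕ) : ℝ))
          (by positivity) (by push_cast; linarith) (h.mass_mem.1.trans (hNμ.trans hNj))
          (by linarith) (hmono.mono (Ici_subset_Ici.2 (hNR.trans hNj)))
          (fun ρ hρ => hmax ρ ((hNR.trans hNj).trans hρ)) hB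
          (by linarith [hz₀ _ (hNz.trans hNj)]) (h1 _ (by linarith))
        have : t' - 4 / σ ((N + j : ℕ) : ℝ) + (((N + (j + 1) : ℕ) : ℝ) - (N + j : ℕ)) /
            (σ ((N + j : ℕ) : ℝ) / 4) = t' := by
          have : (((N + (j + 1) : ℕ) : ℝ) - (N + j : ℕ)) = 1 := by push_cast; ring
          rw [this]
          field_simp
          ring
        rwa [this] at hb
      · rw [Finset.sum_range_succ] at ht
        linarith
  obtain ⟨j, hj⟩ := exists_nat_ge R
  intro t ht
  refine hdown j s le_rfl (fun t' ht' => ?_) t (by linarith [htot j])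
  filter_upwards [h.mem t' ht'] with x hx
  push_cast
  linarith [hx.2, (Nat.cast_nonneg N : (0 : ℝ) ≤ N)]

/-- Instantaneous bounds: after any positive time, bounded solutions take values in a compact
subset of `(0,∞)` that does not depend on the solution. -/
theorem exists_bounds_after (hσ : IsAdmissibleStress σ) (hμ : 0 < μ) {τ : ℝ} (hτ : 0 < τ) :
    ∃ e r : ℝ, ∀ (ε R s : ℝ) (u : ℝ → Lp ℝ 2 P), IsBoundedSolution σ μ ε R s u →
      IsBoundedSolution σ μ e r (s + τ) u := by
  obtain ⟨r₁, hr₁⟩ := exists_upper_bound_after (P := P) hσ hμ (half_pos hτ)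
  set r := max r₁ μ with hr
  have hrpos : 0 < r := hμ.trans_le (le_max_right _ _)
  obtain ⟨m₀, hm₀, hmono, hmin⟩ := hσ.exists_lower_threshold
  obtain ⟨B, hB⟩ := hσ.exists_ge (half_pos hμ)
  obtain ⟨δ, hδ, hδB⟩ := hσ.exists_forall_le_of_small (B - 2 * r / μ)
  -- m₀ gives monotonicity of σ, δ the smallness of σ that `lower_barrier` requires with R replaced
  -- by r, and e ≤ τ / 2 allows a barrier to start at t - e when the bound r already holds.
  set e := min (min m₀ δ) (min μ (τ / 2)) with he
  have he0 : 0 < e := lt_min (lt_min hm₀ hδ) (lt_min hμ (half_pos hτ))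
  have hem : e ≤ m₀ := (min_le_left _ _).trans (min_le_left _ _)
  have heδ : e ≤ δ := (min_le_left _ _).trans (min_le_right _ _)
  have heμ : e ≤ μ := (min_le_right _ _).trans (min_le_left _ _)
  have heτ : e ≤ τ / 2 := (min_le_right _ _).trans (min_le_right _ _)
  refine ⟨e, r, fun ε R s u h => ?_⟩
  have h1 : IsBoundedSolution σ μ ε r (s + τ / 2) u := by
    have h0 := h.mono_start (by linarith : s ≤ s + τ / 2)
    refine ⟨h0.pos, h0.continuousOn, h0.mass, fun t ht => ?_, h0.hasDerivAt⟩
    filter_upwards [h0.mem t ht, hr₁ ε R s u h t ht] with x hx1 hx2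
    exact ⟨hx1.1, hx2.trans (le_max_left _ _)⟩
  have h2 := h1.mono_start (by linarith : s + τ / 2 ≤ s + τ)
  refine ⟨he0, h2.continuousOn, h2.mass, fun t ht => ?_, h2.hasDerivAt⟩
  have h3 := h1.lower_barrier hσ (B := B) (e := e) (a := t - e) he0.le heμ (by linarith) hμ
    (hmono.mono (Ioc_subset_Ioc_right hem)) (fun m hm => hmin m ⟨hm.1, hm.2.trans hem⟩) hB
    (fun m hm => by linarith [hδB m ⟨hm.1, hm.2.trans heδ⟩])
  rw [sub_add_cancel] at h3
  filter_upwards [h3, h2.mem t ht] with x hx1 hx2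
  exact ⟨hx1, hx2.2⟩

/-- Existence for initial data with values in a compact subset of `(0,∞)`. -/
theorem exists_isBoundedSolution (hσ : IsAdmissibleStress σ) {ε R : ℝ} (hε : 0 < ε)
    (p₀ : Lp ℝ 2 P) (hp₀ : ∀ᵐ x ∂P, p₀ x ∈ Icc ε R) (hmass : ∫ x, p₀ x ∂P = μ) :
    ∃ (ε' R' : ℝ) (u : ℝ → Lp ℝ 2 P), u 0 = p₀ ∧ IsBoundedSolution σ μ ε' R' 0 u := by
  obtain ⟨R₀, hR₀, -, hmax⟩ := hσ.exists_upper_threshold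
  obtain ⟨m₀, hm₀, -, hmin⟩ := hσ.exists_lower_threshold
  have hεR : ε ≤ R := let ⟨x, hx⟩ := hp₀.exists; hx.1.trans hx.2
  -- The truncated stress attains its minimum σ(a) below a and its maximum σ(b) above b. Hence
  -- values below a cannot decrease and values above b cannot increase, so [a, b] is invariant and
  -- the truncation is never felt.
  set a := min ε m₀ with ha
  set b := max R R₀ with hb
  have ha0 : 0 < a := lt_min hε hm₀
  have hab : a ≤ b := (min_le_left _ _).trans (hεR.trans (le_max_left _ _))
  set g := truncation σ a b with hg
  obtain ⟨L, hL⟩ : ∃ L : ℝ≥0, LipschitzWith L g := hσ.exists_lipschitzWith_truncation ha0 hab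
  obtain ⟨B, hB⟩ := hσ.exists_abs_truncation_le ha0 hab
  have hB0 : 0 ≤ 2 * B := by linarith [(abs_nonneg _).trans (hB 0)]
  obtain ⟨u, hu0, hu⟩ := exists_forall_hasDerivAt_of_lipschitzWith
    (lipschitzWith_nonlocalField (P := P) hL) (B := ⟨2 * B, hB0⟩)
    (norm_nonlocalField_le hL hB) p₀
  have hucont : Continuous u := continuous_iff_continuousAt.2 fun t => (hu t).continuousAt
  have hlow : ∀ z, σ a ≤ g z := fun z => hmin a ⟨ha0, min_le_right _ _⟩ _ (clamp_mem hab z).1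
  have hupp : ∀ z, g z ≤ σ b := fun z =>
    hmax b (le_max_right _ _) _ ⟨ha0.trans_le (clamp_mem hab z).1, (clamp_mem hab z).2⟩
  have hgi : ∀ t, Integrable (fun x => g (u t x)) P := fun t =>
    (memLp_comp_of_lipschitzWith hL (u t)).integrable (by norm_num)
  have hcl : ∀ t, σ a ≤ ∫ x, g (u t x) ∂P := fun t => by
    simpa using integral_mono (integrable_const (σ a)) (hgi t) (fun x => hlow _)
  have hcu : ∀ t, ∫ x, g (u t x) ∂P ≤ σ b := fun t => by
    simpa using integral_mono (hgi t) (integrable_const (σ b)) (fun x => hupp _)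
  have hA : ∀ t, 0 ≤ t → ∀ᵐ x ∂P, a ≤ u t x := by
    intro t ht
    have hwc : ∀ t, ∀ᵐ x ∂P, (Lp.const 2 P a - u t) x = a - u t x := fun t => by
      filter_upwards [Lp.coeFn_sub (Lp.const 2 P a) (u t),
        Lp.coeFn_const (p := 2) (μ := P) a] with x h1 h2
      rw [h1, Pi.sub_apply, h2]
      rfl
    have := ae_nonpos_of_deriv_le (P := P) (w := fun t => Lp.const 2 P a - u t)
      (w' := fun t => - nonlocalField g (u t)) (L := 0) le_rfl ht
      (continuousOn_const.sub hucont.continuousOn) (fun t _ => (hu t).const_sub _) ?_ ?_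
    · filter_upwards [this, hwc t] with x h1 h2
      rw [h2] at h1
      linarith
    · intro t _
      filter_upwards [hwc t, nonlocalField_ae_eq (memLp_comp_of_lipschitzWith hL (u t)),
        Lp.coeFn_neg (nonlocalField g (u t))] with x h1 h2 h3 hpos
      rw [h1] at hpos
      rw [h3, Pi.neg_apply, h2]
      have : g (u t x) = σ a := by
        rw [hg, truncation, min_eq_left (by linarith), max_eq_left (by linarith)]
      rw [this]
      linarith [hcl t]
    · filter_upwards [hwc 0, hp₀] with x h1 h2
      rw [h1, hu0]
      linarith [h2.1, min_le_left ε m₀]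
  have hA' : ∀ t, 0 ≤ t → ∀ᵐ x ∂P, u t x ≤ b := by
    intro t ht
    have hwc : ∀ t, ∀ᵐ x ∂P, (u t - Lp.const 2 P b) x = u t x - b := fun t => by
      filter_upwards [Lp.coeFn_sub (u t) (Lp.const 2 P b),
        Lp.coeFn_const (p := 2) (μ := P) b] with x h1 h2
      rw [h1, Pi.sub_apply, h2]
      rfl
    have := ae_nonpos_of_deriv_le (P := P) (w := fun t => u t - Lp.const 2 P b)
      (w' := fun t => nonlocalField g (u t)) (L := 0) le_rfl ht
      (hucont.continuousOn.sub continuousOn_const) (fun t _ => (hu t).sub_const _) ?_ ?_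
    · filter_upwards [this, hwc t] with x h1 h2
      rw [h2] at h1
      linarith
    · intro t _
      filter_upwards [hwc t, nonlocalField_ae_eq (memLp_comp_of_lipschitzWith hL (u t))]
        with x h1 h2 hpos
      rw [h1] at hpos
      rw [h2]
      have : g (u t x) = σ b := by
        rw [hg, truncation, min_eq_right (by linarith), max_eq_right hab]
      rw [this]
      linarith [hcu t]
    · filter_upwards [hwc 0, hp₀] with x h1 h2
      rw [h1, hu0]
      linarith [h2.2, le_max_left R R₀]
  have hmem : ∀ t, 0 ≤ t → ∀ᵐ x ∂P, u t x ∈ Icc a b := fun t ht => by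
    filter_upwards [hA t ht, hA' t ht] with x h1 h2 using ⟨h1, h2⟩
  refine ⟨a, b, u, hu0, ha0, hucont.continuousOn, fun t ht => ?_, hmem, fun t ht => ?_⟩
  · have hd : ∀ t, HasDerivAt (fun t => ∫ x, u t x ∂P) 0 t := by
      intro t
      have := (innerSL ℝ (Lp.const 2 P (1 : ℝ))).hasFDerivAt.comp_hasDerivAt t (hu t)
      simp only [Function.comp_def, innerSL_apply_apply, inner_Lp_const_one] at this
      rwa [integral_nonlocalField (memLp_comp_of_lipschitzWith hL (u t))] at this
    have hconst := is_const_of_deriv_eq_zero (fun t => (hd t).differentiableAt)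
      (fun t => (hd t).deriv) t 0
    rw [hconst, hu0, hmass]
  · rw [← nonlocalField_truncation (hmem t ht.le)]
    exact hu t

/-- Bounded solutions of equal mass depend continuously on their initial values. -/
theorem norm_sub_le_of_isBoundedSolution (hσ : IsAdmissibleStress σ) {K : ℝ}
    (hK : MonotoneOn (fun z => σ z + K * z) (Ioi 0)) {ε R ε' R' s t : ℝ} {u v : ℝ → Lp ℝ 2 P}
    (hu : IsBoundedSolution σ μ ε R s u) (hv : IsBoundedSolution σ μ ε' R' s v) (hst : s ≤ t) :
    ‖u t - v t‖ ≤ Real.exp (K * (t - s)) * ‖u s - v s‖ := by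
  refine norm_le_exp_mul_of_inner_le (w := fun t => u t - v t)
    (w' := fun t => nonlocalField σ (u t) - nonlocalField σ (v t)) hst
    ((hu.continuousOn.mono Icc_subset_Ici_self).sub (hv.continuousOn.mono Icc_subset_Ici_self))
    (fun r hr => (hu.hasDerivAt r hr.1).sub (hv.hasDerivAt r hr.1)) fun r hr => ?_
  refine inner_nonlocalField_sub_le hK ?_ ?_ (hu.memLp hσ hr.1.le) (hv.memLp hσ hr.1.le) ?_
  · filter_upwards [hu.mem r hr.1.le] with x hx using hu.pos.trans_le hx.1
  · filter_upwards [hv.mem r hr.1.le] with x hx using hv.pos.trans_le hx.1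
  · rw [hu.mass r hr.1.le, hv.mass r hr.1.le]

end BoundedSolutions

/-! ### Strong solutions for arbitrary data in the phase space -/

section StrongSolutions

variable {Ω : Type*} [MeasurableSpace Ω] {P : Measure Ω} [IsProbabilityMeasure P]
variable {σ : ℝ → ℝ} {μ : ℝ}

/-- An L²-convergent sequence converges almost everywhere along a subsequence. -/
theorem isClosed_setOf_ae_mem {s : Set ℝ} (hs : IsClosed s) :
    IsClosed {v : Lp ℝ 2 P | ∀ᵐ x ∂P, v x ∈ s} := by
  refine IsSeqClosed.isClosed fun v w hv hvw => ?_
  obtain ⟨ns, -, hns⟩ := (tendstoInMeasure_of_tendsto_Lp hvw).exists_seq_tendsto_ae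
  have hall : ∀ᵐ x ∂P, ∀ n, v n x ∈ s := ae_all_iff.2 hv
  filter_upwards [hns, hall] with x h1 h2
  exact hs.mem_of_tendsto h1 (Eventually.of_forall fun n => h2 (ns n))

theorem continuous_integral_coe : Continuous fun v : Lp ℝ 2 P => ∫ x, v x ∂P := by
  have : (fun v : Lp ℝ 2 P => ∫ x, v x ∂P) = innerSL ℝ (Lp.const 2 P (1 : ℝ)) := by
    ext v
    rw [innerSL_apply_apply, inner_Lp_const_one]
  rw [this]
  exact ContinuousLinearMap.continuous _

theorem IsBoundedSolution.integral_nonlocalField_truncation (hσ : IsAdmissibleStress σ)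
    {ε R s a b : ℝ} {u : ℝ → Lp ℝ 2 P} (h : IsBoundedSolution σ μ ε R s u) (ha : s ≤ a)
    (hab : a ≤ b) : ∫ r in a..b, nonlocalField (truncation σ ε R) (u r) = u b - u a := by
  obtain ⟨L, hL⟩ := hσ.exists_lipschitzWith_truncation h.pos h.le
  have hc : ContinuousOn u (Icc a b) := h.continuousOn.mono fun r hr => ha.trans hr.1
  refine intervalIntegral.integral_eq_sub_of_hasDerivAt_of_le hab hc (fun r hr => ?_)
    (ContinuousOn.intervalIntegrable_of_Icc hab
      ((lipschitzWith_nonlocalField hL).continuous.comp_continuousOn hc))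
  rw [nonlocalField_truncation (h.mem r (ha.trans hr.1.le))]
  exact h.hasDerivAt r (ha.trans_lt hr.1)

/-- The bounds are common to all `w n`, so a single bounded continuous truncated field governs them,
and dominated convergence passes to the limit in the integral equation. -/
theorem isBoundedSolution_of_tendsto (hσ : IsAdmissibleStress σ) {ε R s : ℝ}
    {w : ℕ → ℝ → Lp ℝ 2 P} {u : ℝ → Lp ℝ 2 P} (hw : ∀ n, IsBoundedSolution σ μ ε R s (w n))
    (hwu : ∀ t, s ≤ t → Tendsto (fun n => w n t) atTop (𝓝 (u t)))
    (hu : ContinuousOn u (Ici s)) : IsBoundedSolution σ μ ε R s u := by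
  have hmem : ∀ t, s ≤ t → ∀ᵐ x ∂P, u t x ∈ Icc ε R := fun t ht =>
    (isClosed_setOf_ae_mem isClosed_Icc).mem_of_tendsto (hwu t ht)
      (Eventually.of_forall fun n => (hw n).mem t ht)
  have hε := (hw 0).pos
  have hεR := (hw 0).le
  refine ⟨hε, hu, fun t ht => ?_, hmem, fun t ht => ?_⟩
  · refine tendsto_nhds_unique ((continuous_integral_coe.tendsto (u t)).comp (hwu t ht)) ?_
    exact tendsto_const_nhds.congr fun n => ((hw n).mass t ht).symm
  obtain ⟨L, hL⟩ := hσ.exists_lipschitzWith_truncation hε hεR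
  obtain ⟨B, hB⟩ := hσ.exists_abs_truncation_le hε hεR
  set F : Lp ℝ 2 P → Lp ℝ 2 P := nonlocalField (truncation σ ε R) with hF
  have hFc : Continuous F := (lipschitzWith_nonlocalField hL).continuous
  have hFB : ∀ v, ‖F v‖ ≤ 2 * B := norm_nonlocalField_le hL hB
  have heq : ∀ t, s ≤ t → u t = u s + ∫ r in s..t, F (u r) := by
    intro t ht
    have hn : ∀ n, w n t = w n s + ∫ r in s..t, F (w n r) := by
      intro n
      rw [hF, (hw n).integral_nonlocalField_truncation hσ le_rfl ht]
      abel
    have hlim : Tendsto (fun n => ∫ r in s..t, F (w n r)) atTop (𝓝 (∫ r in s..t, F (u r))) := by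
      refine intervalIntegral.tendsto_integral_filter_of_dominated_convergence (fun _ => 2 * B)
        (Eventually.of_forall fun n => ?_) (Eventually.of_forall fun n => ?_)
        intervalIntegrable_const ?_
      · rw [uIoc_of_le ht]
        refine (hFc.comp_continuousOn ((hw n).continuousOn.mono ?_)).aestronglyMeasurable
          measurableSet_Ioc
        exact fun r hr => hr.1.le
      · exact Eventually.of_forall fun r _ => hFB _
      · refine Eventually.of_forall fun r hr => ?_
        rw [uIoc_of_le ht] at hr
        exact (hFc.tendsto _).comp (hwu r hr.1.le)
    refine tendsto_nhds_unique (hwu t ht) ?_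
    exact ((hwu s le_rfl).add hlim).congr fun n => (hn n).symm
  have hFu : ContinuousOn (fun r => F (u r)) (Ici s) := hFc.comp_continuousOn hu
  have hd : HasDerivAt (fun t => u s + ∫ r in s..t, F (u r)) (F (u t)) t := by
    refine (intervalIntegral.integral_hasDerivAt_right ?_ ?_ ?_).const_add _
    · exact ContinuousOn.intervalIntegrable_of_Icc ht.le (hFu.mono Icc_subset_Ici_self)
    · exact (hFu.mono Ioi_subset_Ici_self).stronglyMeasurableAtFilter isOpen_Ioi t ht
    · exact hFu.continuousAt (Ici_mem_nhds ht)
  rw [← nonlocalField_truncation (hmem t ht.le)]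
  refine hd.congr_of_eventuallyEq ?_
  filter_upwards [Ioi_mem_nhds ht] with r hr using heq r (le_of_lt hr)

/-- A path in `L²`, continuous up to time `0`, that is a bounded solution after every positive
time. -/
structure IsStrongSolution (σ : ℝ → ℝ) (μ : ℝ) (u : ℝ → Lp ℝ 2 P) : Prop where
  continuousOn : ContinuousOn u (Ici 0)
  bounded : ∀ τ, 0 < τ → ∃ ε R, IsBoundedSolution σ μ ε R τ u

/-- The estimate holds from every s > 0 with the same K, although the bounds on the solutions may
degenerate as s → 0; continuity in L² at time 0 gives the limit. -/
theorem IsStrongSolution.norm_sub_le (hσ : IsAdmissibleStress σ) {K : ℝ}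
    (hK : MonotoneOn (fun z => σ z + K * z) (Ioi 0)) {u v : ℝ → Lp ℝ 2 P}
    (hu : IsStrongSolution σ μ u) (hv : IsStrongSolution σ μ v) {t : ℝ} (ht : 0 ≤ t) :
    ‖u t - v t‖ ≤ Real.exp (K * t) * ‖u 0 - v 0‖ := by
  rcases ht.eq_or_lt with rfl | ht
  · simp
  have h1 : ∀ s ∈ Ioc 0 t, ‖u t - v t‖ ≤ Real.exp (K * (t - s)) * ‖u s - v s‖ := by
    intro s hs
    obtain ⟨ε, R, h⟩ := hu.bounded s hs.1
    obtain ⟨ε', R', h'⟩ := hv.bounded s hs.1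
    exact norm_sub_le_of_isBoundedSolution hσ hK h h' hs.2
  have hc : ContinuousWithinAt (fun s => Real.exp (K * (t - s)) * ‖u s - v s‖) (Ioi 0) 0 := by
    have hu0 := (hu.continuousOn 0 self_mem_Ici).mono Ioi_subset_Ici_self
    have hv0 := (hv.continuousOn 0 self_mem_Ici).mono Ioi_subset_Ici_self
    exact (Continuous.continuousWithinAt (by fun_prop)).mul (hu0.sub hv0).norm
  have h2 := ge_of_tendsto hc.tendsto (b := ‖u t - v t‖) (by
    filter_upwards [Ioc_mem_nhdsGT ht] with s hs using h1 s hs)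
  simpa using h2

theorem IsStrongSolution.eqOn (hσ : IsAdmissibleStress σ) {u v : ℝ → Lp ℝ 2 P}
    (hu : IsStrongSolution σ μ u) (hv : IsStrongSolution σ μ v) (h0 : u 0 = v 0) :
    EqOn u v (Ici 0) := by
  intro t ht
  obtain ⟨K, -, hK⟩ := hσ.exists_monotoneOn_add_linear
  have := hu.norm_sub_le hσ hK hv ht
  rw [h0, sub_self, norm_zero, mul_zero] at this
  exact sub_eq_zero.1 (norm_le_zero_iff.1 this)

theorem IsStrongSolution.shift {u : ℝ → Lp ℝ 2 P} (hu : IsStrongSolution σ μ u) {s : ℝ}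
    (hs : 0 ≤ s) : IsStrongSolution σ μ fun t => u (s + t) := by
  refine ⟨hu.continuousOn.comp (by fun_prop) fun t (ht : 0 ≤ t) => add_nonneg hs ht,
    fun τ hτ => ?_⟩
  obtain ⟨ε, R, h⟩ := hu.bounded τ hτ
  refine ⟨ε, R, h.pos, h.continuousOn.comp (by fun_prop) fun t (ht : τ ≤ t) => ?_,
    fun t ht => h.mass _ (by linarith), fun t ht => h.mem _ (by linarith),
    fun t ht => (h.hasDerivAt (s + t) (by linarith)).comp_const_add s t⟩
  exact (by linarith : τ ≤ s + t)

theorem tendsto_nemytskii_clamp (v : Lp ℝ 2 P) (hv : ∀ᵐ x ∂P, 0 ≤ v x) :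
    Tendsto (fun n : ℕ => nemytskii (fun z => max (1 / ((n : ℝ) + 1)) (min z ((n : ℝ) + 1))) v)
      atTop (𝓝 v) := by
  have hlip : ∀ a b : ℝ, LipschitzWith 1 fun z : ℝ => max a (min z b) := fun a b =>
    (LipschitzWith.id.min_const b).const_max a
  have hae : ∀ n : ℕ, ∀ᵐ x ∂P,
      nemytskii (fun z => max (1 / ((n : ℝ) + 1)) (min z ((n : ℝ) + 1))) v x =
        max (1 / ((n : ℝ) + 1)) (min (v x) ((n : ℝ) + 1)) := fun n =>
    nemytskii_ae_eq (memLp_comp_of_lipschitzWith (hlip _ _) v)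
  rw [tendsto_iff_norm_sub_tendsto_zero]
  have hsq : Tendsto (fun n : ℕ =>
      ‖nemytskii (fun z => max (1 / ((n : ℝ) + 1)) (min z ((n : ℝ) + 1))) v - v‖ ^ 2)
      atTop (𝓝 0) := by
    have hlim : Tendsto (fun n : ℕ =>
        ∫ x, (max (1 / ((n : ℝ) + 1)) (min (v x) ((n : ℝ) + 1)) - v x) ^ 2 ∂P)
        atTop (𝓝 (∫ _, (0 : ℝ) ∂P)) := by
      refine tendsto_integral_of_dominated_convergence (fun x => (|v x| + 1) ^ 2) (fun n => ?_) ?_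
        (fun n => ?_) ?_
      · exact (((hlip _ _).continuous.comp_aestronglyMeasurable (Lp.aestronglyMeasurable v)).sub
          (Lp.aestronglyMeasurable v)).pow 2
      · exact ((Lp.memLp v).norm.add (memLp_const 1)).integrable_sq
      · filter_upwards [hv] with x hx
        have hn1 : 1 / ((n : ℝ) + 1) ≤ 1 := by
          rw [div_le_one (by positivity)]
          linarith [(Nat.cast_nonneg n : (0 : ℝ) ≤ n)]
        have hn0 : 0 < 1 / ((n : ℝ) + 1) := by positivity
        rw [Real.norm_of_nonneg (sq_nonneg _), ← sq_abs, abs_of_nonneg hx]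
        have : |max (1 / ((n : ℝ) + 1)) (min (v x) ((n : ℝ) + 1)) - v x| ≤ v x + 1 := by
          rw [abs_le]
          constructor
          · linarith [le_max_left (1 / ((n : ℝ) + 1)) (min (v x) ((n : ℝ) + 1))]
          · have : max (1 / ((n : ℝ) + 1)) (min (v x) ((n : ℝ) + 1)) ≤ v x + 1 :=
              max_le (by linarith) ((min_le_left _ _).trans (by linarith))
            linarith
        gcongr
      · filter_upwards [hv] with x hx
        have h1 : Tendsto (fun n : ℕ => max (1 / ((n : ℝ) + 1)) (v x)) atTop (𝓝 (max 0 (v x))) :=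
          tendsto_one_div_add_atTop_nhds_zero_nat.max tendsto_const_nhds
        rw [max_eq_right hx] at h1
        have h2 : Tendsto (fun n : ℕ => max (1 / ((n : ℝ) + 1)) (min (v x) ((n : ℝ) + 1)))
            atTop (𝓝 (v x)) := by
          refine h1.congr' ?_
          obtain ⟨N, hN⟩ := exists_nat_ge (v x)
          filter_upwards [eventually_ge_atTop N] with n hn
          have : (N : ℝ) ≤ n := by exact_mod_cast hn
          rw [min_eq_left (by linarith)]
        have := (h2.sub_const (v x)).pow 2
        simpa using this
    rw [integral_zero] at hlim
    refine hlim.congr fun n => ?_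
    rw [norm_sq_eq_integral]
    refine integral_congr_ae ?_
    filter_upwards [hae n, Lp.coeFn_sub (nemytskii
      (fun z => max (1 / ((n : ℝ) + 1)) (min z ((n : ℝ) + 1))) v) v] with x h1 h2
    rw [h2, Pi.sub_apply, h1]
  have := hsq.sqrt
  simpa [Real.sqrt_sq] using this

/-- States with values in compact subsets of `(0,∞)` are dense in the phase space. -/
theorem exists_seq_tendsto_of_nonneg (hμ : 0 < μ) (v : Lp ℝ 2 P) (hv : ∀ᵐ x ∂P, 0 ≤ v x)
    (hmass : ∫ x, v x ∂P = μ) : ∃ q : ℕ → Lp ℝ 2 P, Tendsto q atTop (𝓝 v) ∧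
      ∀ n, ∫ x, q n x ∂P = μ ∧ ∃ ε R, 0 < ε ∧ ∀ᵐ x ∂P, q n x ∈ Icc ε R := by
  set c : ℕ → Lp ℝ 2 P := fun n =>
    nemytskii (fun z => max (1 / ((n : ℝ) + 1)) (min z ((n : ℝ) + 1))) v with hc
  have hct : Tendsto c atTop (𝓝 v) := tendsto_nemytskii_clamp v hv
  have hmem : ∀ n : ℕ, ∀ᵐ x ∂P, c n x ∈ Icc (1 / ((n : ℝ) + 1)) ((n : ℝ) + 1) := by
    intro n
    have hlip : LipschitzWith 1 fun z : ℝ => max (1 / ((n : ℝ) + 1)) (min z ((n : ℝ) + 1)) :=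
      (LipschitzWith.id.min_const _).const_max _
    have hae : c n =ᵐ[P] fun x => max (1 / ((n : ℝ) + 1)) (min (v x) ((n : ℝ) + 1)) :=
      nemytskii_ae_eq (memLp_comp_of_lipschitzWith hlip v)
    filter_upwards [hae] with x hx
    rw [hx]
    refine clamp_mem ?_ _
    rw [div_le_iff₀ (by positivity)]
    nlinarith [(Nat.cast_nonneg n : (0 : ℝ) ≤ n)]
  have hpos : ∀ n, 0 < ∫ x, c n x ∂P := fun n =>
    lt_of_lt_of_le (by positivity) (integral_mem_Icc (hmem n)).1
  have hint : Tendsto (fun n => ∫ x, c n x ∂P) atTop (𝓝 μ) := by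
    rw [← hmass]
    exact (continuous_integral_coe.tendsto v).comp hct
  -- Clamping changes the mass; the factor that restores it tends to 1.
  refine ⟨fun n => (μ / ∫ x, c n x ∂P) • c n, ?_, fun n => ⟨?_, ?_⟩⟩
  · have h1 : Tendsto (fun n => μ / ∫ x, c n x ∂P) atTop (𝓝 (μ / μ)) :=
      tendsto_const_nhds.div hint hμ.ne'
    rw [div_self hμ.ne'] at h1
    simpa using h1.smul hct
  · rw [← inner_Lp_const_one, inner_smul_right, inner_Lp_const_one]
    exact div_mul_cancel₀ _ (hpos n).ne'
  · have hk : 0 < μ / ∫ x, c n x ∂P := div_pos hμ (hpos n)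
    refine ⟨(μ / ∫ x, c n x ∂P) * (1 / ((n : ℝ) + 1)), (μ / ∫ x, c n x ∂P) * ((n : ℝ) + 1),
      by positivity, ?_⟩
    filter_upwards [hmem n, Lp.coeFn_smul (μ / ∫ x, c n x ∂P) (c n)] with x h1 h2
    rw [h2, Pi.smul_apply, smul_eq_mul]
    exact ⟨mul_le_mul_of_nonneg_left h1.1 hk.le, mul_le_mul_of_nonneg_left h1.2 hk.le⟩

/-- Solutions from approximating data are Cauchy locally uniformly in time by
`norm_sub_le_of_isBoundedSolution`. The bounds of `exists_bounds_after` hold for all of them at once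
and hence survive in the limit. -/
theorem exists_isStrongSolution (hσ : IsAdmissibleStress σ) (hμ : 0 < μ) (p₀ : Lp ℝ 2 P)
    (hp₀ : ∀ᵐ x ∂P, 0 ≤ p₀ x) (hmass : ∫ x, p₀ x ∂P = μ) :
    ∃ u : ℝ → Lp ℝ 2 P, u 0 = p₀ ∧ IsStrongSolution σ μ u := by
  obtain ⟨K, hK0, hK⟩ := hσ.exists_monotoneOn_add_linear
  obtain ⟨q, hq, hq'⟩ := exists_seq_tendsto_of_nonneg hμ p₀ hp₀ hmass
  have hex : ∀ n, ∃ (ε' R' : ℝ) (u : ℝ → Lp ℝ 2 P), u 0 = q n ∧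
      IsBoundedSolution σ μ ε' R' 0 u := fun n => by
    obtain ⟨hm, ε, R, hε, hmem⟩ := hq' n
    exact exists_isBoundedSolution hσ hε (q n) hmem hm
  choose ε R w hw0 hw using hex
  have hcon : ∀ m n t, 0 ≤ t → ‖w m t - w n t‖ ≤ Real.exp (K * t) * ‖q m - q n‖ := by
    intro m n t ht
    have := norm_sub_le_of_isBoundedSolution hσ hK (hw m) (hw n) ht
    rwa [hw0, hw0, sub_zero] at this
  have hcau : ∀ t, 0 ≤ t → ∃ y, Tendsto (fun n => w n t) atTop (𝓝 y) := by
    intro t ht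
    refine cauchySeq_tendsto_of_complete (Metric.cauchySeq_iff.2 fun δ hδ => ?_)
    obtain ⟨N, hN⟩ := Metric.cauchySeq_iff.1 hq.cauchySeq (δ / Real.exp (K * t))
      (div_pos hδ (Real.exp_pos _))
    refine ⟨N, fun m hm n hn => ?_⟩
    have h1 := hN m hm n hn
    rw [dist_eq_norm, lt_div_iff₀ (Real.exp_pos _)] at h1
    rw [dist_eq_norm]
    linarith [hcon m n t ht]
  choose! u hu using hcau
  have hub : ∀ n t, 0 ≤ t → ‖w n t - u t‖ ≤ Real.exp (K * t) * ‖q n - p₀‖ := by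
    intro n t ht
    refine le_of_tendsto_of_tendsto (tendsto_const_nhds.sub (hu t ht)).norm
      ((tendsto_const_nhds.sub hq).norm.const_mul _) (Eventually.of_forall fun m => ?_)
    exact hcon n m t ht
  have huc : ContinuousOn u (Ici 0) := by
    intro t ht
    have ht : 0 ≤ t := ht
    have hunif : TendstoUniformlyOn w u atTop (Icc 0 (t + 1)) := by
      rw [Metric.tendstoUniformlyOn_iff]
      intro δ hδ
      have h1 : Tendsto (fun n => Real.exp (K * (t + 1)) * ‖q n - p₀‖) atTop (𝓝 0) := by
        simpa using (tendsto_iff_norm_sub_tendsto_zero.1 hq).const_mul (Real.exp (K * (t + 1)))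
      filter_upwards [h1.eventually_lt_const hδ] with n hn r hr
      rw [dist_comm, dist_eq_norm]
      refine (hub n r hr.1).trans_lt (lt_of_le_of_lt ?_ hn)
      gcongr
      exact hr.2
    have hc := hunif.continuousOn (Eventually.of_forall fun n =>
      (hw n).continuousOn.mono Icc_subset_Ici_self).frequently
    refine (hc t ⟨ht, by linarith⟩).mono_of_mem_nhdsWithin ?_
    have : Icc 0 (t + 1) = Ici 0 ∩ Iic (t + 1) := rfl
    rw [this]
    exact inter_mem_nhdsWithin _ (Iic_mem_nhds (by linarith))
  refine ⟨u, ?_, huc, fun τ hτ => ?_⟩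
  · refine tendsto_nhds_unique (hu 0 le_rfl) (hq.congr fun n => (hw0 n).symm)
  · obtain ⟨e, r, her⟩ := exists_bounds_after (P := P) hσ hμ hτ
    refine ⟨e, r, isBoundedSolution_of_tendsto hσ (w := w) (fun n => ?_)
      (fun t ht => hu t (hτ.le.trans ht)) (huc.mono (Ici_subset_Ici.2 hτ.le))⟩
    simpa using her _ _ _ _ (hw n)

theorem IsStrongSolution.mem {u : ℝ → Lp ℝ 2 P} (hu : IsStrongSolution σ μ u)
    {t : ℝ} (ht : 0 < t) : (∀ᵐ x ∂P, 0 ≤ u t x) ∧ ∫ x, u t x ∂P = μ := by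
  obtain ⟨ε, R, h⟩ := hu.bounded t ht
  refine ⟨?_, h.mass t le_rfl⟩
  filter_upwards [h.mem t le_rfl] with x hx using h.pos.le.trans hx.1

end StrongSolutions

/-! ### Pointwise representatives of strong solutions -/

section Representatives

variable {Ω : Type*} [MeasurableSpace Ω] {P : Measure Ω} [IsProbabilityMeasure P]
variable {σ : ℝ → ℝ} {μ : ℝ}

/-- A continuous path of nonnegative functions of fixed mass has a jointly measurable
representative. -/
theorem exists_measurable_representative [MeasurableSpace.CountablyGenerated Ω]
    {u : ℝ → Lp ℝ 2 P} (hu : Continuous u) (hnn : ∀ t, ∀ᵐ x ∂P, 0 ≤ u t x)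
    (hmass : ∀ t, ∫ x, u t x ∂P = μ) :
    ∃ q : Ω → ℝ → ℝ, Measurable (Function.uncurry q) ∧ ∀ t, ∀ᵐ x ∂P, q x t = u t x := by
  have hset : ∀ A : Set Ω, MeasurableSet A →
      ∀ t, P.withDensity (fun x => ENNReal.ofReal (u t x)) A =
        ENNReal.ofReal (∫ x in A, u t x ∂P) := by
    intro A hA t
    rw [withDensity_apply _ hA, ofReal_integral_eq_lintegral_ofReal
      (integrable_coe (u t)).integrableOn (ae_restrict_of_ae (hnn t))]
  -- The functions u t are densities of finite measures that form a kernel; Radon–Nikodym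
  -- derivatives of kernels over a countably generated space are jointly measurable.
  let κ : ProbabilityTheory.Kernel ℝ Ω :=
    { toFun := fun t => P.withDensity (fun x => ENNReal.ofReal (u t x))
      measurable' := by
        refine Measure.measurable_of_measurable_coe _ fun A hA => ?_
        simp_rw [hset A hA]
        refine (ENNReal.continuous_ofReal.comp ?_).measurable
        have : (fun t => ∫ x in A, u t x ∂P) =
            fun t => inner ℝ (indicatorConstLp 2 hA (measure_ne_top P A) (1 : ℝ)) (u t) := by
          ext t
          rw [L2.inner_indicatorConstLp_one]
        rw [this]
        fun_prop }
  have hκ : ∀ t, κ t = P.withDensity (fun x => ENNReal.ofReal (u t x)) := fun t => rfl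
  have hfin : ProbabilityTheory.IsFiniteKernel κ := by
    refine ⟨⟨ENNReal.ofReal μ, ENNReal.ofReal_lt_top, fun t => ?_⟩⟩
    rw [hκ, hset _ MeasurableSet.univ, setIntegral_univ, hmass]
  let η : ProbabilityTheory.Kernel ℝ Ω := ProbabilityTheory.Kernel.const ℝ P
  refine ⟨fun x t => (ProbabilityTheory.Kernel.rnDeriv κ η t x).toReal, ?_, fun t => ?_⟩
  · exact ((ProbabilityTheory.Kernel.measurable_rnDeriv κ η).comp measurable_swap).ennreal_toReal
  · have h1 := ProbabilityTheory.Kernel.rnDeriv_eq_rnDeriv_measure (κ := κ) (η := η) (a := t)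
    have hη : η t = P := ProbabilityTheory.Kernel.const_apply _ _
    rw [hη, hκ] at h1
    have h2 := Measure.rnDeriv_withDensity₀ P
      (f := fun x => ENNReal.ofReal (u t x)) (Lp.aestronglyMeasurable (u t)).aemeasurable.ennreal_ofReal
    filter_upwards [h1, h2, hnn t] with x h1 h2 h3
    rw [h1, h2, ENNReal.toReal_ofReal h3]

/-- Bochner integrals of paths in `L²` can be computed pointwise. -/
theorem intervalIntegral_ae_eq {G : ℝ → Lp ℝ 2 P} {g : Ω → ℝ → ℝ} {a b : ℝ} (hab : a ≤ b)
    (hG : IntervalIntegrable G volume a b)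
    (hg : Integrable (Function.uncurry g) (P.prod (volume.restrict (Ioc a b))))
    (hGg : ∀ r ∈ Ioc a b, ∀ᵐ x ∂P, G r x = g x r) :
    ∀ᵐ x ∂P, (∫ r in a..b, G r) x = ∫ r in a..b, g x r := by
  -- The integral over A is a continuous functional on L², so it commutes with the Bochner integral
  -- in time; Fubini does the same for g.
  refine Integrable.ae_eq_of_forall_setIntegral_eq _ _ (integrable_coe _) ?_ fun A hA _ => ?_
  · simp_rw [intervalIntegral.integral_of_le hab]
    exact hg.integral_prod_left
  · have h1 : ∫ x in A, (∫ r in a..b, G r) x ∂P = ∫ r in a..b, ∫ x in A, G r x ∂P := by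
      have := (innerSL ℝ (indicatorConstLp 2 hA (measure_ne_top P A) (1 : ℝ))).intervalIntegral_comp_comm hG
      simp only [innerSL_apply_apply, L2.inner_indicatorConstLp_one] at this
      exact this.symm
    rw [h1]
    simp_rw [intervalIntegral.integral_of_le hab]
    have h2 : ∫ r in Ioc a b, ∫ x in A, G r x ∂P = ∫ r in Ioc a b, ∫ x in A, g x r ∂P := by
      refine setIntegral_congr_fun measurableSet_Ioc fun r hr => ?_
      exact integral_congr_ae (ae_restrict_of_ae (hGg r hr))
    rw [h2, integral_integral_swap]
    have hle : (P.restrict A).prod (volume.restrict (Ioc a b)) ≤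
        P.prod (volume.restrict (Ioc a b)) := Measure.prod_mono Measure.restrict_le_self le_rfl
    exact hg.swap.mono_measure (Measure.prod_mono le_rfl Measure.restrict_le_self)

/-- A representative `p = p(x,t)` of the path `u` that solves the equation pointwise. -/
structure IsPointwiseSolution (σ : ℝ → ℝ) (T : ℝ) (u : ℝ → Lp ℝ 2 P) (p : Ω → ℝ → ℝ) : Prop where
  aestronglyMeasurable : AEStronglyMeasurable (fun z : Ω × ℝ => p z.1 z.2)
    (P.prod (volume.restrict (Icc 0 T)))
  ae_eq : ∀ t ∈ Icc 0 T, ∀ᵐ x ∂P, p x t = u t x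
  pos : ∀ᵐ z : Ω × ℝ ∂(P.prod (volume.restrict (Icc 0 T))), 0 < p z.1 z.2
  integrable : ∀ᵐ t ∂(volume.restrict (Icc 0 T)), Integrable (fun x => σ (p x t)) P
  integrableOn : ∀ᵐ x ∂P, ∀ τ ∈ Ioo 0 T,
    IntegrableOn (fun t => σ (p x t) - ∫ y, σ (p y t) ∂P) (Ioo τ T)
  eq_sub_integral : ∀ᵐ x ∂P, ∀ s ∈ Ioc 0 T, ∀ t ∈ Ioc 0 T,
    p x t = p x s - ∫ r in s..t, (σ (p x r) - ∫ y, σ (p y r) ∂P)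

/-- A measurable representative q equals u t only off a null set depending on t. Redefining it by
integrating the equation in time produces p, which satisfies the equation for all times off a single
null set. -/
theorem IsStrongSolution.exists_isPointwiseSolution [MeasurableSpace.CountablyGenerated Ω]
    (hσ : IsAdmissibleStress σ) {u : ℝ → Lp ℝ 2 P} (hu : IsStrongSolution σ μ u)
    (h0 : ∀ᵐ x ∂P, 0 ≤ u 0 x) (h0m : ∫ x, u 0 x ∂P = μ) {T : ℝ} (hT : 0 < T) :
    ∃ p : Ω → ℝ → ℝ, IsPointwiseSolution σ T u p := by
  have hnn : ∀ t, 0 ≤ t → (∀ᵐ x ∂P, 0 ≤ u t x) ∧ ∫ x, u t x ∂P = μ := fun t ht => by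
    rcases ht.eq_or_lt with rfl | ht
    · exact ⟨h0, h0m⟩
    · exact hu.mem ht
  obtain ⟨q, hqm, hq⟩ := exists_measurable_representative (P := P) (u := fun t => u (max 0 t))
    (hu.continuousOn.comp_continuous (by fun_prop) fun t => le_max_left 0 t)
    (fun t => (hnn _ (le_max_left 0 t)).1) (fun t => (hnn _ (le_max_left 0 t)).2)
  have hqu : ∀ t, 0 ≤ t → ∀ᵐ x ∂P, q x t = u t x := fun t ht => by
    simpa only [max_eq_right ht] using hq t
  -- σ is arbitrary outside (0,∞) and might not be measurable there.
  set σ' : ℝ → ℝ := (Ioi 0).indicator σ with hσ'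
  have hσ'm : Measurable σ' := hσ.continuousOn.measurable_piecewise continuousOn_const measurableSet_Ioi
  have hσ'pos : ∀ z, 0 < z → σ' z = σ z := fun z hz => indicator_of_mem hz σ
  set c : ℝ → ℝ := fun r => ∫ y, σ' (q y r) ∂P with hc
  have hσqm : Measurable fun z : Ω × ℝ => σ' (q z.1 z.2) := hσ'm.comp hqm
  have hcm : Measurable c := by
    have : StronglyMeasurable fun z : ℝ × Ω => σ' (q z.2 z.1) :=
      (hσqm.comp measurable_swap).stronglyMeasurable
    exact this.integral_prod_right.measurable
  set g : Ω → ℝ → ℝ := fun x r => σ' (q x r) - c r with hg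
  have hgm : Measurable (Function.uncurry g) := hσqm.sub (hcm.comp measurable_snd)
  -- Integration runs backwards from T because g has no bound near time 0; for t ≤ 0 the value is
  -- taken from q.
  set p : Ω → ℝ → ℝ := fun x t => if t ≤ 0 then q x 0 else q x T + ∫ r in Ioc t T, g x r with hp
  have hpm : Measurable (Function.uncurry p) := by
    refine Measurable.ite (measurable_snd measurableSet_Iic) ?_ ?_
    · exact hqm.comp (measurable_fst.prodMk measurable_const)
    · refine (hqm.comp (measurable_fst.prodMk measurable_const)).add ?_
      have h1 : (fun z : Ω × ℝ => ∫ r in Ioc z.2 T, g z.1 r) =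
          fun z => ∫ r, {w : (Ω × ℝ) × ℝ | w.1.2 < w.2 ∧ w.2 ≤ T}.indicator
            (fun w => g w.1.1 w.2) (z, r) := by
        ext z
        rw [← integral_indicator measurableSet_Ioc]
        rfl
      have h2 : StronglyMeasurable ({w : (Ω × ℝ) × ℝ | w.1.2 < w.2 ∧ w.2 ≤ T}.indicator
            (fun w => g w.1.1 w.2)) := by
        refine Measurable.stronglyMeasurable (Measurable.indicator ?_ ?_)
        · exact hgm.comp (measurable_fst.fst.prodMk measurable_snd)
        · exact (measurableSet_lt measurable_fst.snd measurable_snd).inter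
            (measurableSet_le measurable_snd measurable_const)
      have h3 := h2.integral_prod_right' (ν := volume)
      change Measurable (fun z : Ω × ℝ => ∫ r in Ioc z.2 T, g z.1 r)
      rw [h1]
      exact h3.measurable
  -- bounds for `q` and `g` after positive times
  have hbd : ∀ τ, 0 < τ → ∃ B : ℝ, ∀ r, τ ≤ r → (∀ᵐ x ∂P, |g x r| ≤ B) := by
    intro τ hτ
    obtain ⟨ε, R, h⟩ := hu.bounded τ hτ
    obtain ⟨B, hB⟩ := hσ.exists_abs_truncation_le h.pos h.le
    have hB' : ∀ z ∈ Icc ε R, |σ' z| ≤ B := fun z hz => by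
      rw [hσ'pos z (h.pos.trans_le hz.1), ← truncation_of_mem (σ := σ) hz]
      exact hB z
    refine ⟨B + B, fun r hr => ?_⟩
    have h1 : ∀ᵐ x ∂P, |σ' (q x r)| ≤ B := by
      filter_upwards [hqu r (hτ.le.trans hr), h.mem r hr] with x h1 h2
      rw [h1]
      exact hB' _ h2
    have h2 : |c r| ≤ B := by
      have := norm_integral_le_of_norm_le_const (f := fun x => σ' (q x r)) h1
      simpa using this
    filter_upwards [h1] with x hx
    exact (abs_sub _ _).trans (add_le_add hx h2)
  have hgint : ∀ τ, 0 < τ → Integrable (Function.uncurry g) (P.prod (volume.restrict (Ioc τ T))) := by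
    intro τ hτ
    obtain ⟨B, hB⟩ := hbd τ hτ
    refine Integrable.of_bound hgm.aestronglyMeasurable B ?_
    have hms : MeasurableSet {z : Ω × ℝ | ‖Function.uncurry g z‖ ≤ B} :=
      measurableSet_le hgm.norm measurable_const
    rw [Measure.ae_prod_iff_ae_ae hms, Measure.ae_ae_comm hms]
    filter_upwards [ae_restrict_mem measurableSet_Ioc] with r hr using hB r hr.1.le
  have hpu : ∀ t ∈ Icc 0 T, ∀ᵐ x ∂P, p x t = u t x := by
    intro t ht
    rcases ht.1.eq_or_lt with rfl | ht0
    · filter_upwards [hqu 0 le_rfl] with x hx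
      rw [hp]
      simpa using hx
    · obtain ⟨ε, R, h⟩ := hu.bounded t ht0
      obtain ⟨L, hL⟩ := hσ.exists_lipschitzWith_truncation h.pos h.le
      set F : Lp ℝ 2 P → Lp ℝ 2 P := nonlocalField (truncation σ ε R) with hF
      have hFu : IntervalIntegrable (fun r => F (u r)) volume t T :=
        ContinuousOn.intervalIntegrable_of_Icc ht.2
          ((lipschitzWith_nonlocalField hL).continuous.comp_continuousOn
            (h.continuousOn.mono Icc_subset_Ici_self))
      have h1 := intervalIntegral_ae_eq (g := fun x r => - g x r) ht.2 hFu (hgint t ht0).neg ?_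
      · filter_upwards [h1, hqu T hT.le, Lp.coeFn_sub (u T) (u t)] with x h2 h3 h4
        rw [h.integral_nonlocalField_truncation hσ le_rfl ht.2, h4, Pi.sub_apply,
          intervalIntegral.integral_neg, intervalIntegral.integral_of_le ht.2] at h2
        simp only [hp, if_neg (not_le.2 ht0)]
        linarith
      · intro r hr
        have hmem := h.mem r hr.1.le
        have hrep := hqu r (ht0.le.trans hr.1.le)
        have hcr : c r = ∫ y, σ (u r y) ∂P := by
          refine integral_congr_ae ?_
          filter_upwards [hmem, hrep] with y h1 h2
          rw [h2, hσ'pos _ (h.pos.trans_le h1.1)]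
        rw [hF, nonlocalField_truncation hmem]
        filter_upwards [nonlocalField_ae_eq (h.memLp hσ hr.1.le), hmem, hrep] with x h1 h2 h3
        rw [h1, hg, ← hcr]
        simp only
        rw [h3, hσ'pos _ (h.pos.trans_le h2.1)]
        ring
  have hTpos : ∀ᵐ r ∂(volume.restrict (Icc 0 T)), r ∈ Ioc 0 T := by
    rw [← restrict_Ioc_eq_restrict_Icc]
    exact ae_restrict_mem measurableSet_Ioc
  have hpq : ∀ᵐ x ∂P, ∀ᵐ r ∂(volume.restrict (Icc 0 T)), p x r = q x r := by
    have hms : MeasurableSet {z : Ω × ℝ | p z.1 z.2 = q z.1 z.2} := measurableSet_eq_fun hpm hqm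
    rw [Measure.ae_ae_comm hms]
    filter_upwards [hTpos] with r hr
    filter_upwards [hpu r ⟨hr.1.le, hr.2⟩, hqu r hr.1.le] with x h1 h2
    rw [h1, h2]
  have hupos : ∀ r, 0 < r → ∀ᵐ x ∂P, 0 < u r x := fun r hr => by
    obtain ⟨ε, R, h⟩ := hu.bounded r hr
    filter_upwards [h.mem r le_rfl] with x hx using h.pos.trans_le hx.1
  have hppos : ∀ᵐ z : Ω × ℝ ∂(P.prod (volume.restrict (Icc 0 T))), 0 < p z.1 z.2 := by
    have hms : MeasurableSet {z : Ω × ℝ | 0 < p z.1 z.2} := measurableSet_lt measurable_const hpm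
    rw [Measure.ae_prod_iff_ae_ae hms, Measure.ae_ae_comm hms]
    filter_upwards [hTpos] with r hr
    filter_upwards [hpu r ⟨hr.1.le, hr.2⟩, hupos r hr.1] with x h1 h2
    rwa [h1]
  have hcp : ∀ r ∈ Ioc 0 T, ∫ y, σ (p y r) ∂P = c r := fun r hr => by
    refine integral_congr_ae ?_
    filter_upwards [hpu r ⟨hr.1.le, hr.2⟩, hqu r hr.1.le, hupos r hr.1] with y h1 h2 h3
    rw [h1, h2, hσ'pos _ h3]
  have hgp : ∀ᵐ x ∂P, ∀ᵐ r ∂(volume.restrict (Icc 0 T)),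
      σ (p x r) - ∫ y, σ (p y r) ∂P = g x r := by
    filter_upwards [hpq, Measure.ae_ae_of_ae_prod hppos] with x h1 h2
    filter_upwards [h1, h2, hTpos] with r h1 h2 h3
    rw [hcp r h3, hg]
    simp only
    rw [← h1, hσ'pos _ h2]
  have hgx : ∀ᵐ x ∂P, ∀ τ, 0 < τ → IntegrableOn (g x) (Ioc τ T) := by
    have : ∀ᵐ x ∂P, ∀ n : ℕ, IntegrableOn (g x) (Ioc (1 / ((n : ℝ) + 1)) T) :=
      ae_all_iff.2 fun n => (hgint _ (by positivity)).prod_right_ae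
    filter_upwards [this] with x hx τ hτ
    obtain ⟨n, hn⟩ := exists_nat_one_div_lt hτ
    exact (hx n).mono_set (Ioc_subset_Ioc_left hn.le)
  refine ⟨p, hpm.aestronglyMeasurable, hpu, hppos, ?_, ?_, ?_⟩
  · filter_upwards [hTpos] with r hr
    obtain ⟨ε, R, h⟩ := hu.bounded r hr.1
    refine ((h.memLp hσ le_rfl).integrable (by norm_num)).congr ?_
    filter_upwards [hpu r ⟨hr.1.le, hr.2⟩] with x hx
    rw [hx]
  · filter_upwards [hgp, hgx] with x h1 h2 τ hτ
    refine IntegrableOn.congr_fun_ae ((h2 τ hτ.1).mono_set Ioo_subset_Ioc_self) ?_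
    filter_upwards [ae_restrict_of_ae_restrict_of_subset
      (Ioo_subset_Icc_self.trans (Icc_subset_Icc_left hτ.1.le)) h1] with r hr using hr.symm
  · filter_upwards [hgp, hgx] with x h1 h2 s hs t ht
    have hii : ∀ a ∈ Ioc 0 T, ∀ b ∈ Ioc 0 T, IntervalIntegrable (g x) volume a b := by
      intro a ha b hb
      rw [intervalIntegrable_iff]
      exact (h2 _ (lt_min ha.1 hb.1)).mono_set (Ioc_subset_Ioc_right (max_le ha.2 hb.2))
    have h3 : ∫ r in s..t, (σ (p x r) - ∫ y, σ (p y r) ∂P) = ∫ r in s..t, g x r := by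
      refine intervalIntegral.integral_congr_ae_restrict ?_
      refine ae_restrict_of_ae_restrict_of_subset ?_ h1
      exact uIoc_subset_uIcc.trans (uIcc_subset_Icc ⟨hs.1.le, hs.2⟩ ⟨ht.1.le, ht.2⟩)
    rw [h3]
    simp only [hp, if_neg (not_le.2 hs.1), if_neg (not_le.2 ht.1)]
    rw [← intervalIntegral.integral_of_le hs.2, ← intervalIntegral.integral_of_le ht.2,
      ← intervalIntegral.integral_add_adjacent_intervals (hii s hs t ht) (hii t ht T ⟨hT, le_rfl⟩)]
    ring

end Representatives

/-- The primitive d is absolutely continuous with d' = -h almost everywhere, so the product rule for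
absolutely continuous functions applies to d · d. -/
theorem sq_sub_sq_eq_of_eq_sub_integral {d h : ℝ → ℝ} {s t : ℝ} (hst : s ≤ t)
    (hh : IntervalIntegrable h volume s t)
    (hd : ∀ r ∈ Icc s t, d r = d s - ∫ z in s..r, h z) :
    d t ^ 2 - d s ^ 2 = 2 * ∫ r in s..t, -(d r * h r) := by
  set D : ℝ → ℝ := fun r => d s - ∫ z in s..r, h z with hD
  have hac : AbsolutelyContinuousOnInterval D s t := by
    have h1 : AbsolutelyContinuousOnInterval (fun _ : ℝ => d s) s t :=
      LipschitzOnWith.absolutelyContinuousOnInterval (K := 0)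
        ((LipschitzWith.const (d s)).lipschitzOnWith)
    exact h1.sub (hh.absolutelyContinuousOnInterval_intervalIntegral left_mem_uIcc)
  have hint := hac.integral_deriv_mul_eq_sub hac
  have hderiv : ∀ᵐ r, r ∈ uIoc s t → deriv D r = - h r := by
    filter_upwards [hh.ae_hasDerivAt_integral] with r hr hrm
    have := (hr (uIoc_subset_uIcc hrm) s left_mem_uIcc).const_sub (d s)
    exact this.deriv
  have heq : ∫ r in s..t, (deriv D r * D r + D r * deriv D r) =
      ∫ r in s..t, 2 * -(d r * h r) := by
    refine intervalIntegral.integral_congr_ae ?_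
    filter_upwards [hderiv] with r hr hrm
    rw [hr hrm]
    rw [uIoc_of_le hst] at hrm
    have : D r = d r := (hd r ⟨hrm.1.le, hrm.2⟩).symm
    rw [this]
    ring
  rw [heq, intervalIntegral.integral_const_mul] at hint
  rw [hint]
  have h1 : D t = d t := (hd t ⟨hst, le_rfl⟩).symm
  have h2 : D s = d s := (hd s ⟨le_rfl, hst⟩).symm
  rw [h1, h2]
  ring

/-! ### Uniqueness in the pointwise class -/

section Uniqueness

variable {Ω : Type*} [MeasurableSpace Ω] {P : Measure Ω} [IsProbabilityMeasure P]
variable {σ : ℝ → ℝ} {μ : ℝ}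

namespace IsPointwiseSolution

variable {T : ℝ} {u : ℝ → Lp ℝ 2 P} {p : Ω → ℝ → ℝ}

theorem intervalIntegrable (h : IsPointwiseSolution σ T u p) :
    ∀ᵐ x ∂P, ∀ s ∈ Ioc 0 T, ∀ t ∈ Ioc 0 T,
      IntervalIntegrable (fun r => σ (p x r) - ∫ y, σ (p y r) ∂P) volume s t := by
  filter_upwards [h.integrableOn] with x hx s hs t ht
  rw [intervalIntegrable_iff]
  have hT : 0 < T := hs.1.trans_le hs.2
  have hm : 0 < min s t := lt_min hs.1 ht.1
  have h1 := hx (min s t / 2) ⟨half_pos hm, by linarith [min_le_left s t, hs.2]⟩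
  rw [← integrableOn_Ioc_iff_integrableOn_Ioo] at h1
  refine h1.mono_set (Ioc_subset_Ioc ?_ (max_le hs.2 ht.2))
  linarith

theorem continuousOn (h : IsPointwiseSolution σ T u p) :
    ∀ᵐ x ∂P, ∀ τ ∈ Ioc 0 T, ContinuousOn (p x) (Icc τ T) := by
  filter_upwards [h.intervalIntegrable, h.eq_sub_integral] with x h1 h2 τ hτ
  have hT : T ∈ Ioc 0 T := ⟨hτ.1.trans_le hτ.2, le_rfl⟩
  have h3 := intervalIntegral.continuousOn_primitive_interval' (h1 τ hτ T hT) left_mem_uIcc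
  rw [uIcc_of_le hτ.2] at h3
  refine (continuousOn_const.sub h3).congr fun t ht => h2 τ hτ t ⟨hτ.1.trans_le ht.1, ht.2⟩

/-- The nonlocal term of a pointwise solution of positive mass is integrable in time. -/
theorem integrableOn_integral_stress (h : IsPointwiseSolution σ T u p)
    (hσ : IsAdmissibleStress σ) (hmass : ∀ t ∈ Icc 0 T, 0 < ∫ x, u t x ∂P) {τ : ℝ}
    (hτ : τ ∈ Ioc 0 T) : IntegrableOn (fun r => ∫ y, σ (p y r) ∂P) (Icc τ T) := by
  refine LocallyIntegrableOn.integrableOn_isCompact (fun t₀ ht₀ => ?_) isCompact_Icc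
  -- Only the difference σ(p) - ∫ σ(p) is assumed integrable in time. Positive mass provides an x
  -- with p(x, t₀) > 0; near t₀ the continuous path p(x,·) stays where σ is bounded, so subtraction
  -- isolates the nonlocal term. Compactness makes this local argument suffice.
  have hfreq : ∃ᵐ x ∂P, 0 < u t₀ x := by
    intro hcon
    have h1 := hmass t₀ ⟨hτ.1.le.trans ht₀.1, ht₀.2⟩
    have h2 : ∫ x, u t₀ x ∂P ≤ 0 :=
      integral_nonpos_of_ae (hcon.mono fun x hx => not_lt.1 hx)
    exact absurd h1 (not_lt.2 h2)
  obtain ⟨x, hx, hpx, hc, hi⟩ := (hfreq.and_eventually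
    ((h.ae_eq t₀ ⟨hτ.1.le.trans ht₀.1, ht₀.2⟩).and
      (h.continuousOn.and h.intervalIntegrable))).exists
  rw [← hpx] at hx
  have hc := hc τ hτ
  have hf : IntegrableOn (fun r => σ (p x r) - ∫ y, σ (p y r) ∂P) (Icc τ T) := by
    have := hi τ hτ T ⟨hτ.1.trans_le hτ.2, le_rfl⟩
    rwa [intervalIntegrable_iff_integrableOn_Icc_of_le hτ.2] at this
  set a := p x t₀ with ha
  obtain ⟨L, hL⟩ := hσ.exists_lipschitzWith_truncation (half_pos hx)
    (by linarith : a / 2 ≤ 2 * a)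
  have htr : IntegrableOn (fun r => truncation σ (a / 2) (2 * a) (p x r)) (Icc τ T) :=
    (hL.continuous.comp_continuousOn hc).integrableOn_Icc
  have hnear : ∀ᶠ r in 𝓝[Icc τ T] t₀, p x r ∈ Ioo (a / 2) (2 * a) :=
    (hc t₀ ht₀).tendsto (Ioo_mem_nhds (by linarith) (by linarith))
  obtain ⟨δ, hδ, hball⟩ := Metric.mem_nhdsWithin_iff.1 hnear
  refine ⟨Metric.ball t₀ δ ∩ Icc τ T,
    inter_mem (mem_nhdsWithin_of_mem_nhds (Metric.ball_mem_nhds t₀ hδ)) self_mem_nhdsWithin, ?_⟩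
  refine ((htr.sub hf).mono_set inter_subset_right).congr_fun (fun r hr => ?_)
    (measurableSet_ball.inter measurableSet_Icc)
  have := hball hr
  simp only [Pi.sub_apply]
  rw [truncation_of_mem ⟨le_of_lt this.1, le_of_lt this.2⟩]
  ring

end IsPointwiseSolution

/-- Without bounds on p and q the calculus in L² is unavailable, so the square is differentiated for
fixed x and then integrated by Fubini. The term G(r) d(x, r) vanishes on integration over x by
equality of mass; its joint integrability is where `integrableOn_integral_stress` is needed. -/
theorem norm_sq_sub_le_of_isPointwiseSolution (hσ : IsAdmissibleStress σ) {K : ℝ}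
    (hK : MonotoneOn (fun z => σ z + K * z) (Ioi 0)) (hμ : 0 < μ) {T : ℝ}
    {u v : ℝ → Lp ℝ 2 P} {p q : Ω → ℝ → ℝ} (hp : IsPointwiseSolution σ T u p)
    (hq : IsPointwiseSolution σ T v q) (hu : ContinuousOn u (Icc 0 T))
    (hv : ContinuousOn v (Icc 0 T)) (hum : ∀ t ∈ Icc 0 T, ∫ x, u t x ∂P = μ)
    (hvm : ∀ t ∈ Icc 0 T, ∫ x, v t x ∂P = μ) {s t : ℝ} (hs : 0 < s) (hst : s ≤ t) (ht : t ≤ T) :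
    ‖u t - v t‖ ^ 2 - ‖u s - v s‖ ^ 2 ≤ 2 * K * ∫ r in s..t, ‖u r - v r‖ ^ 2 := by
  have hsT : s ∈ Ioc 0 T := ⟨hs, hst.trans ht⟩
  have htT : t ∈ Ioc 0 T := ⟨hs.trans_le hst, ht⟩
  have hsub : Ioc s t ⊆ Icc 0 T := fun r hr => ⟨hs.le.trans hr.1.le, hr.2.trans ht⟩
  set ν : Measure ℝ := volume.restrict (Ioc s t) with hν
  have hνle : ν ≤ volume.restrict (Icc 0 T) := Measure.restrict_mono hsub le_rfl
  have hprodle : P.prod ν ≤ P.prod (volume.restrict (Icc 0 T)) := Measure.prod_mono le_rfl hνle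
  set d : Ω → ℝ → ℝ := fun x r => p x r - q x r with hd
  set G : ℝ → ℝ := fun r => ∫ y, σ (p y r) ∂P - ∫ y, σ (q y r) ∂P with hG
  have hGi : Integrable G ν :=
    ((hp.integrableOn_integral_stress hσ (fun t ht => by rw [hum t ht]; exact hμ) hsT).sub
      (hq.integrableOn_integral_stress hσ (fun t ht => by rw [hvm t ht]; exact hμ) hsT)).mono_set
      (Ioc_subset_Icc_self.trans (Icc_subset_Icc_right ht))
  have hdu : ∀ r ∈ Icc 0 T, ∀ᵐ x ∂P, d x r = (u r - v r) x := fun r hr => by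
    filter_upwards [hp.ae_eq r hr, hq.ae_eq r hr, Lp.coeFn_sub (u r) (v r)] with x h1 h2 h3
    rw [h3, Pi.sub_apply, ← h1, ← h2]
  have hdm : AEStronglyMeasurable (fun z : Ω × ℝ => d z.1 z.2) (P.prod ν) :=
    (hp.aestronglyMeasurable.sub hq.aestronglyMeasurable).mono_measure hprodle
  have hνmem : ∀ᵐ r ∂ν, r ∈ Icc 0 T := by
    filter_upwards [ae_restrict_mem measurableSet_Ioc] with r hr using hsub hr
  have hE : ∀ r ∈ Icc 0 T, ∫ x, d x r ^ 2 ∂P = ‖u r - v r‖ ^ 2 := fun r hr => by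
    rw [norm_sq_eq_integral]
    refine integral_congr_ae ?_
    filter_upwards [hdu r hr] with x hx
    rw [hx]
  have hEc : ContinuousOn (fun r => ‖u r - v r‖ ^ 2) (Icc 0 T) := (hu.sub hv).norm.pow 2
  have hEi : Integrable (fun r => ‖u r - v r‖ ^ 2) ν :=
    (hEc.integrableOn_Icc).mono_set hsub
  have hd2 : Integrable (fun z : Ω × ℝ => d z.1 z.2 ^ 2) (P.prod ν) := by
    refine (integrable_prod_iff' (hdm.pow 2)).2 ⟨?_, ?_⟩
    · filter_upwards [hνmem] with r hr
      have h1 : Integrable (fun x => (u r - v r) x ^ 2) P := by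
        simpa only [sq] using integrable_mul_coe (u r - v r) (u r - v r)
      refine h1.congr ?_
      filter_upwards [hdu r hr] with x hx
      change _ = d x r ^ 2
      rw [hx]
    · refine hEi.congr ?_
      filter_upwards [hνmem] with r hr
      rw [← hE r hr]
      refine integral_congr_ae (Eventually.of_forall fun x => ?_)
      simp
  have hGd : Integrable (fun z : Ω × ℝ => G z.2 * d z.1 z.2) (P.prod ν) := by
    have hm : AEStronglyMeasurable (fun z : Ω × ℝ => G z.2 * d z.1 z.2) (P.prod ν) :=
      hGi.aestronglyMeasurable.comp_snd.mul hdm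
    rw [integrable_prod_iff' hm]
    constructor
    · filter_upwards [hνmem] with r hr
      refine ((integrable_coe (u r - v r)).const_mul (G r)).congr ?_
      filter_upwards [hdu r hr] with x hx
      rw [hx]
    · obtain ⟨C, hC⟩ := isCompact_Icc.exists_bound_of_continuousOn (hu.sub hv)
      refine (hGi.norm.mul_const C).mono' hm.norm.prod_swap.integral_prod_right' ?_
      filter_upwards [hνmem] with r hr
      have h1 : ∫ x, ‖G r * d x r‖ ∂P = ‖G r‖ * ∫ x, |(u r - v r) x| ∂P := by
        rw [← integral_const_mul]
        refine integral_congr_ae ?_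
        filter_upwards [hdu r hr] with x hx
        rw [norm_mul, hx, Real.norm_eq_abs ((u r - v r) x)]
      have h2 : ∫ x, |(u r - v r) x| ∂P ≤ C := by
        have h3 := abs_integral_le_norm |u r - v r|
        rw [norm_abs_eq_norm] at h3
        have h4 : ∫ x, |(u r - v r) x| ∂P = ∫ x, |u r - v r| x ∂P := by
          refine integral_congr_ae ?_
          filter_upwards [Lp.coeFn_abs (u r - v r)] with x hx
          rw [hx]
        rw [h4]
        exact (le_abs_self _).trans (h3.trans (hC r hr))
      change ‖∫ x, ‖G r * d x r‖ ∂P‖ ≤ _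
      rw [Real.norm_of_nonneg (integral_nonneg fun x => norm_nonneg _), h1]
      exact mul_le_mul_of_nonneg_left h2 (norm_nonneg _)
  have hpt : ∀ᵐ x ∂P, d x t ^ 2 - d x s ^ 2 ≤ ∫ r, 2 * (K * d x r ^ 2 + G r * d x r) ∂ν := by
    have hpp : ∀ᵐ x ∂P, ∀ᵐ r ∂ν, 0 < p x r :=
      Measure.ae_ae_of_ae_prod (ae_mono hprodle hp.pos)
    have hqp : ∀ᵐ x ∂P, ∀ᵐ r ∂ν, 0 < q x r :=
      Measure.ae_ae_of_ae_prod (ae_mono hprodle hq.pos)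
    filter_upwards [hpp, hqp, hp.eq_sub_integral, hq.eq_sub_integral, hp.intervalIntegrable,
      hq.intervalIntegrable, hp.continuousOn, hq.continuousOn, hd2.prod_right_ae,
      hGd.prod_right_ae] with x h1 h2 h3 h4 h5 h6 h7 h8 h9 h10
    have hi := (h5 s hsT t htT).sub (h6 s hsT t htT)
    have hdc : ContinuousOn (d x) (Icc s t) :=
      ((h7 s hsT).sub (h8 s hsT)).mono (Icc_subset_Icc_right ht)
    have hsq := sq_sub_sq_eq_of_eq_sub_integral (d := d x) hst hi fun r hr => by
      have hr' : r ∈ Ioc 0 T := ⟨hs.trans_le hr.1, hr.2.trans ht⟩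
      have h11 := intervalIntegral.integral_sub (h5 s hsT r hr') (h6 s hsT r hr')
      simp only [hd]
      rw [h3 s hsT r hr', h4 s hsT r hr']
      rw [h11]
      ring
    rw [hsq, ← intervalIntegral.integral_const_mul, intervalIntegral.integral_of_le hst]
    refine integral_mono_ae ?_ (((h9.const_mul K).add h10).const_mul 2) ?_
    · have h12 : IntervalIntegrable (fun r => d x r * ((σ (p x r) - ∫ y, σ (p y r) ∂P) -
          (σ (q x r) - ∫ y, σ (q y r) ∂P))) volume s t :=
        hi.continuousOn_mul (by rwa [uIcc_of_le hst])
      exact ((intervalIntegrable_iff_integrableOn_Ioc_of_le hst).1 h12).neg.const_mul 2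
    · filter_upwards [h1, h2] with r hr1 hr2
      simp only [hd, hG]
      rcases le_total (p x r) (q x r) with h | h
      · have := hK hr1 hr2 h
        simp only at this
        nlinarith
      · have := hK hr2 hr1 h
        simp only at this
        nlinarith
  have hI1 : ∀ r ∈ Icc 0 T, Integrable (fun x => d x r ^ 2) P := fun r hr => by
    have h1 : Integrable (fun x => (u r - v r) x ^ 2) P := by
      simpa only [sq] using integrable_mul_coe (u r - v r) (u r - v r)
    refine h1.congr ?_
    filter_upwards [hdu r hr] with x hx
    rw [hx]
  have htI : t ∈ Icc 0 T := ⟨htT.1.le, htT.2⟩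
  have hsI : s ∈ Icc 0 T := ⟨hsT.1.le, hsT.2⟩
  have hjoint : Integrable (fun z : Ω × ℝ => 2 * (K * d z.1 z.2 ^ 2 + G z.2 * d z.1 z.2))
      (P.prod ν) := ((hd2.const_mul K).add hGd).const_mul 2
  have hmono := integral_mono_ae ((hI1 t htI).sub (hI1 s hsI)) hjoint.integral_prod_left hpt
  simp only [Pi.sub_apply] at hmono
  rw [integral_sub (hI1 t htI) (hI1 s hsI), hE t htI, hE s hsI, integral_integral_swap hjoint]
    at hmono
  refine hmono.trans (le_of_eq ?_)
  rw [intervalIntegral.integral_of_le hst, ← integral_const_mul]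
  refine integral_congr_ae ?_
  filter_upwards [hνmem, hd2.prod_left_ae, hGd.prod_left_ae] with r hr h1 h2
  have hzero : ∫ x, G r * d x r ∂P = 0 := by
    rw [integral_const_mul]
    have : ∫ x, d x r ∂P = 0 := by
      rw [integral_congr_ae (hdu r hr), ← inner_Lp_const_one, inner_sub_right, inner_Lp_const_one,
        inner_Lp_const_one, hum r hr, hvm r hr, sub_self]
    rw [this, mul_zero]
  rw [integral_const_mul, integral_add (h1.const_mul K) h2, hzero, integral_const_mul, hE r hr]
  ring

/-- Uniqueness of solutions in the pointwise sense. -/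
theorem eqOn_of_isPointwiseSolution (hσ : IsAdmissibleStress σ) (hμ : 0 < μ) {T : ℝ}
    {u v : ℝ → Lp ℝ 2 P} {p q : Ω → ℝ → ℝ} (hp : IsPointwiseSolution σ T u p)
    (hq : IsPointwiseSolution σ T v q) (hu : ContinuousOn u (Icc 0 T))
    (hv : ContinuousOn v (Icc 0 T)) (hum : ∀ t ∈ Icc 0 T, ∫ x, u t x ∂P = μ)
    (hvm : ∀ t ∈ Icc 0 T, ∫ x, v t x ∂P = μ) (h0 : u 0 = v 0) : EqOn u v (Icc 0 T) := by
  obtain ⟨K, hK0, hK⟩ := hσ.exists_monotoneOn_add_linear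
  have hEc : ContinuousOn (fun r => ‖u r - v r‖ ^ 2) (Icc 0 T) := (hu.sub hv).norm.pow 2
  have hle : ∀ t ∈ Icc 0 T, ‖u t - v t‖ ^ 2 ≤ 2 * K * ∫ r in 0..t, ‖u r - v r‖ ^ 2 := by
    intro t ht
    rcases ht.1.eq_or_lt with rfl | ht0
    · simp [h0]
    -- The pointwise equation only relates positive times; s → 0 is reached by continuity in L².
    have h1 : ∀ s ∈ Ioc 0 t, ‖u t - v t‖ ^ 2 - 2 * K * ∫ r in 0..t, ‖u r - v r‖ ^ 2 ≤
        ‖u s - v s‖ ^ 2 := by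
      intro s hs
      have h2 := norm_sq_sub_le_of_isPointwiseSolution hσ hK hμ hp hq hu hv hum hvm hs.1 hs.2 ht.2
      have hi : ∀ a b, 0 ≤ a → a ≤ b → b ≤ T →
          IntervalIntegrable (fun r => ‖u r - v r‖ ^ 2) volume a b := fun a b ha hab hb =>
        ContinuousOn.intervalIntegrable_of_Icc hab (hEc.mono (Icc_subset_Icc ha hb))
      have h3 := intervalIntegral.integral_add_adjacent_intervals
        (hi 0 s le_rfl hs.1.le (hs.2.trans ht.2)) (hi s t hs.1.le hs.2 ht.2)
      have h4 : 0 ≤ ∫ r in 0..s, ‖u r - v r‖ ^ 2 :=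
        intervalIntegral.integral_nonneg hs.1.le fun r _ => sq_nonneg _
      have h5 : 2 * K * ∫ r in s..t, ‖u r - v r‖ ^ 2 ≤ 2 * K * ∫ r in 0..t, ‖u r - v r‖ ^ 2 :=
        mul_le_mul_of_nonneg_left (by linarith) (by linarith)
      linarith
    have hc : ContinuousWithinAt (fun s => ‖u s - v s‖ ^ 2) (Ioc 0 t) 0 :=
      (hEc 0 ⟨le_rfl, ht.1.trans ht.2⟩).mono fun s hs => ⟨hs.1.le, hs.2.trans ht.2⟩
    have hc' : Tendsto (fun s => ‖u s - v s‖ ^ 2) (𝓝[>] 0) (𝓝 (‖u 0 - v 0‖ ^ 2)) := by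
      have h6 := hc.tendsto
      rwa [nhdsWithin_Ioc_eq_nhdsGT ht0] at h6
    have h7 := ge_of_tendsto hc' (by filter_upwards [Ioc_mem_nhdsGT ht0] with s hs using h1 s hs)
    rw [h0, sub_self, norm_zero] at h7
    linarith
  intro t ht
  have := nonpos_of_le_mul_integral (by linarith : 0 ≤ 2 * K) hEc hle t ht
  have h8 : ‖u t - v t‖ = 0 := by
    have := le_antisymm this (sq_nonneg _)
    exact pow_eq_zero_iff two_ne_zero |>.1 this
  exact sub_eq_zero.1 (norm_eq_zero.1 h8)

end Uniqueness

/-! ### Helly's selection theorem -/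

section Helly

/-- The diagonal argument, as sequential compactness of a countable product of intervals. -/
theorem exists_subseq_tendsto_on_countable {a b : ℝ} {f : ℕ → ℝ → ℝ}
    (hf : ∀ n x, f n x ∈ Icc a b) {C : Set ℝ} (hC : C.Countable) :
    ∃ φ : ℕ → ℕ, StrictMono φ ∧ ∀ x ∈ C, ∃ y, Tendsto (fun n => f (φ n) x) atTop (𝓝 y) := by
  have : Countable C := hC.to_subtype
  obtain ⟨g, φ, hφ, hg⟩ := CompactSpace.tendsto_subseq
    (fun n => fun x : C => (⟨f n x, hf n x⟩ : Icc a b))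
  refine ⟨φ, hφ, fun x hx => ⟨g ⟨x, hx⟩, ?_⟩⟩
  have h1 := (tendsto_pi_nhds.1 hg) ⟨x, hx⟩
  exact (continuous_subtype_val.tendsto _).comp h1

/-- **Helly's selection theorem** for uniformly bounded sequences of monotone functions. -/
theorem exists_subseq_tendsto_of_monotone {a b : ℝ} {f : ℕ → ℝ → ℝ}
    (hf : ∀ n x, f n x ∈ Icc a b) (hmono : ∀ n, Monotone (f n)) :
    ∃ (φ : ℕ → ℕ) (g : ℝ → ℝ), StrictMono φ ∧
      ∀ x, Tendsto (fun n => f (φ n) x) atTop (𝓝 (g x)) := by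
  obtain ⟨φ, hφ, hlim⟩ := exists_subseq_tendsto_on_countable hf
    (countable_range (fun q : ℚ => (q : ℝ)))
  have hlim' : ∀ q : ℚ, ∃ y, Tendsto (fun n => f (φ n) q) atTop (𝓝 y) :=
    fun q => hlim q (mem_range_self q)
  choose G hG using hlim'
  have hGm : ∀ n, Monotone fun q : ℚ => f (φ n) (q : ℝ) := fun n q r h =>
    hmono _ (by exact_mod_cast h)
  have hGmono : Monotone G := fun q r h =>
    le_of_tendsto_of_tendsto' (hG q) (hG r) fun n => hGm n h
  have hGb : ∀ q, G q ≤ b := fun q => le_of_tendsto' (hG q) fun n => (hf _ _).2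
  -- h extends the limits at rationals monotonically. Squeezing between rationals gives convergence
  -- wherever h is continuous; a second extraction handles the countably many other points.
  set h : ℝ → ℝ := fun x => sSup (G '' {q : ℚ | (q : ℝ) ≤ x}) with hh
  have hbdd : ∀ x, BddAbove (G '' {q : ℚ | (q : ℝ) ≤ x}) := fun x =>
    ⟨b, by rintro _ ⟨q, -, rfl⟩; exact hGb q⟩
  have hne : ∀ x : ℝ, (G '' {q : ℚ | (q : ℝ) ≤ x}).Nonempty := fun x =>
    let ⟨q, hq⟩ := exists_rat_lt x
    ⟨G q, q, hq.le, rfl⟩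
  have hhmono : Monotone h := fun x y hxy =>
    csSup_le_csSup (hbdd y) (hne x) (image_mono fun q (hq : (q : ℝ) ≤ x) => hq.trans hxy)
  have hcont : ∀ x, ContinuousAt h x → Tendsto (fun n => f (φ n) x) atTop (𝓝 (h x)) := by
    intro x hx
    rw [tendsto_order]
    constructor
    · intro c hc
      have h1 : ∀ᶠ y in 𝓝[<] x, c < h y := (hx.tendsto.mono_left nhdsWithin_le_nhds).eventually_const_lt hc
      obtain ⟨y, hy, hyx⟩ := (h1.and self_mem_nhdsWithin).exists
      obtain ⟨q, hq1, hq2⟩ := exists_rat_btwn (show y < x from hyx)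
      have h2 : h y ≤ G q := csSup_le (hne y) (by
        rintro _ ⟨r, hr, rfl⟩
        refine hGmono ?_
        have : (r : ℝ) ≤ q := le_trans hr hq1.le
        exact_mod_cast this)
      filter_upwards [(hG q).eventually_const_lt (hy.trans_le h2)] with n hn
      exact hn.trans_le (hmono _ hq2.le)
    · intro c hc
      have h1 : ∀ᶠ y in 𝓝[>] x, h y < c := (hx.tendsto.mono_left nhdsWithin_le_nhds).eventually_lt_const hc
      obtain ⟨y, hy, hyx⟩ := (h1.and self_mem_nhdsWithin).exists
      obtain ⟨q, hq1, hq2⟩ := exists_rat_btwn (show x < y from hyx)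
      have h2 : G q ≤ h y := le_csSup (hbdd y) ⟨q, hq2.le, rfl⟩
      filter_upwards [(hG q).eventually_lt_const (h2.trans_lt hy)] with n hn
      exact (hmono _ hq1.le).trans_lt hn
  obtain ⟨ψ, hψ, hlim2⟩ := exists_subseq_tendsto_on_countable (f := fun n => f (φ n))
    (fun n x => hf _ x) hhmono.countable_not_continuousAt
  have hall : ∀ x, ∃ y, Tendsto (fun n => f (φ (ψ n)) x) atTop (𝓝 y) := by
    intro x
    by_cases hx : ContinuousAt h x
    · exact ⟨h x, (hcont x hx).comp hψ.tendsto_atTop⟩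
    · exact hlim2 x hx
  choose g hg using hall
  exact ⟨φ ∘ ψ, g, hφ.comp hψ, hg⟩

end Helly

/-! ### Order preservation and precompactness of orbits -/

section Orbits

variable {Ω : Type*} [MeasurableSpace Ω] {P : Measure Ω} [IsProbabilityMeasure P]
variable {σ : ℝ → ℝ} {μ : ℝ}

/-- The functions in `L²` that are monotone functions of a fixed function `v`, with values in a
fixed compact interval, form a sequentially precompact set. -/
theorem exists_subseq_tendsto_of_comonotone {a b : ℝ} (v : Lp ℝ 2 P) {w : ℕ → Lp ℝ 2 P}
    (hw : ∀ n, ∃ f : ℝ → ℝ, Monotone f ∧ (∀ x, f x ∈ Icc a b) ∧ ∀ᵐ x ∂P, w n x = f (v x)) :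
    ∃ (φ : ℕ → ℕ) (χ : Lp ℝ 2 P), StrictMono φ ∧ Tendsto (fun n => w (φ n)) atTop (𝓝 χ) := by
  choose f hmono hmem hfw using hw
  obtain ⟨φ, g, hφ, hg⟩ := exists_subseq_tendsto_of_monotone hmem hmono
  have hgmono : Monotone g := fun x y hxy =>
    le_of_tendsto_of_tendsto' (hg x) (hg y) fun n => hmono _ hxy
  have hgmem : ∀ x, g x ∈ Icc a b := fun x =>
    isClosed_Icc.mem_of_tendsto (hg x) (Eventually.of_forall fun n => hmem _ x)
  have hgv : MemLp (fun x => g (v x)) 2 P := by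
    refine MemLp.of_bound ?_ (max |a| |b|) (Eventually.of_forall fun x => ?_)
    · exact (hgmono.measurable.comp_aemeasurable
        (Lp.aestronglyMeasurable v).aemeasurable).aestronglyMeasurable
    · exact abs_le_max_abs_abs (hgmem _).1 (hgmem _).2
  refine ⟨φ, hgv.toLp _, hφ, ?_⟩
  rw [tendsto_iff_norm_sub_tendsto_zero]
  have hsq : Tendsto (fun n => ‖w (φ n) - hgv.toLp _‖ ^ 2) atTop (𝓝 0) := by
    have hlim : Tendsto (fun n => ∫ x, (f (φ n) (v x) - g (v x)) ^ 2 ∂P)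
        atTop (𝓝 (∫ _, (0 : ℝ) ∂P)) := by
      refine tendsto_integral_of_dominated_convergence (fun _ => (b - a) ^ 2) (fun n => ?_)
        (integrable_const _) (fun n => Eventually.of_forall fun x => ?_)
        (Eventually.of_forall fun x => ?_)
      · have h1 : AEStronglyMeasurable (fun x => f (φ n) (v x)) P :=
          ((hmono _).measurable.comp_aemeasurable
            (Lp.aestronglyMeasurable v).aemeasurable).aestronglyMeasurable
        exact (h1.sub hgv.1).pow 2
      · rw [Real.norm_of_nonneg (sq_nonneg _)]
        have h1 := hmem (φ n) (v x)
        have h2 := hgmem (v x)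
        exact sq_le_sq' (by linarith [h1.1, h2.2]) (by linarith [h1.2, h2.1])
      · have := ((hg (v x)).sub_const (g (v x))).pow 2
        simpa using this
    rw [integral_zero] at hlim
    refine hlim.congr fun n => ?_
    rw [norm_sq_eq_integral]
    refine integral_congr_ae ?_
    filter_upwards [hfw (φ n), hgv.coeFn_toLp, Lp.coeFn_sub (w (φ n)) (hgv.toLp _)] with x h1 h2 h3
    rw [h3, Pi.sub_apply, h1, h2]
  have := hsq.sqrt
  simpa [Real.sqrt_sq] using this

/-- Pointwise solutions preserve the order between different points. -/
theorem IsPointwiseSolution.exists_order_preserving (hσ : IsAdmissibleStress σ) {T : ℝ}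
    {u : ℝ → Lp ℝ 2 P} {p : Ω → ℝ → ℝ} (h : IsPointwiseSolution σ T u p) {s : ℝ}
    (hs : s ∈ Ioc 0 T) :
    ∃ A : Set Ω, (∀ᵐ x ∂P, x ∈ A) ∧ ∀ x ∈ A, ∀ y ∈ A, p x s ≤ p y s → p x T ≤ p y T := by
  obtain ⟨K, hK0, hK⟩ := hσ.exists_monotoneOn_add_linear
  have hall := (h.intervalIntegrable.and (h.eq_sub_integral.and
    (h.continuousOn.and (Measure.ae_ae_of_ae_prod h.pos))))
  refine ⟨_, hall, ?_⟩
  rintro x ⟨hx1, hx2, hx3, hx4⟩ y ⟨hy1, hy2, hy3, hy4⟩ hxy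
  -- The common nonlocal forcing cancels in D, so D' ≤ K D where D > 0, and Gronwall applies to D⁺.
  set D : ℝ → ℝ := fun r => p x r - p y r with hD
  have hDc : ContinuousOn D (Icc s T) := (hx3 s hs).sub (hy3 s hs)
  have hD' : ContinuousOn (fun r => max (D r) 0) (Icc s T) :=
    (continuous_id.max continuous_const).comp_continuousOn hDc
  have hle : ∀ t ∈ Icc s T, max (D t) 0 ≤ K * ∫ r in s..t, max (D r) 0 := by
    intro t ht
    have hnn : ∀ a b, a ≤ b → 0 ≤ ∫ r in a..b, max (D r) 0 := fun a b hab =>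
      intervalIntegral.integral_nonneg hab fun r _ => le_max_right _ _
    refine max_le ?_ (mul_nonneg hK0 (hnn _ _ ht.1))
    rcases le_or_gt (D t) 0 with hDt | hDt
    · exact hDt.trans (mul_nonneg hK0 (hnn _ _ ht.1))
    -- The bound on D' is available only where D > 0, hence integration starts at the last time
    -- before t with D ≤ 0.
    set Z : Set ℝ := {r ∈ Icc s t | D r ≤ 0} with hZ
    have hDct : ContinuousOn D (Icc s t) := hDc.mono (Icc_subset_Icc_right ht.2)
    have hZc : IsCompact Z := by
      have : IsClosed Z := hDct.preimage_isClosed_of_isClosed isClosed_Icc isClosed_Iic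
      exact isCompact_Icc.of_isClosed_subset this fun r hr => hr.1
    have hZne : Z.Nonempty := ⟨s, ⟨le_rfl, ht.1⟩, sub_nonpos.2 hxy⟩
    have ha := hZc.sSup_mem hZne
    set a := sSup Z with haZ
    have hpos : ∀ r, a < r → r ≤ t → 0 < D r := by
      intro r har hrt
      by_contra hcon
      exact absurd (le_csSup hZc.bddAbove ⟨⟨ha.1.1.trans har.le, hrt⟩, not_lt.1 hcon⟩)
        (not_le.2 har)
    have haT : a ∈ Ioc 0 T := ⟨hs.1.trans_le ha.1.1, ha.1.2.trans ht.2⟩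
    have htT : t ∈ Ioc 0 T := ⟨hs.1.trans_le ht.1, ht.2⟩
    have hdiff : D t - D a = ∫ r in a..t, ((σ (p y r) - ∫ z, σ (p z r) ∂P) -
        (σ (p x r) - ∫ z, σ (p z r) ∂P)) := by
      rw [intervalIntegral.integral_sub (hy1 a haT t htT) (hx1 a haT t htT)]
      simp only [hD]
      rw [hx2 a haT t htT, hy2 a haT t htT]
      ring
    have hI : ∀ c d, s ≤ c → c ≤ d → d ≤ T → IntervalIntegrable (fun r => max (D r) 0) volume c d :=
      fun c d hc hcd hd => ContinuousOn.intervalIntegrable_of_Icc hcd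
        (hD'.mono (Icc_subset_Icc hc hd))
    have hbound : D t - D a ≤ ∫ r in a..t, K * max (D r) 0 := by
      rw [hdiff]
      refine intervalIntegral.integral_mono_ae_restrict ha.1.2
        ((hy1 a haT t htT).sub (hx1 a haT t htT)) ((hI a t ha.1.1 ha.1.2 ht.2).const_mul K) ?_
      have hsub : Icc a t ⊆ Icc 0 T := Icc_subset_Icc haT.1.le ht.2
      have hne : ∀ᵐ r ∂(volume.restrict (Icc a t)), r ∈ Ioc a t := by
        rw [← restrict_Ioc_eq_restrict_Icc]
        exact ae_restrict_mem measurableSet_Ioc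
      filter_upwards [ae_restrict_of_ae_restrict_of_subset hsub hx4,
        ae_restrict_of_ae_restrict_of_subset hsub hy4, hne] with r h1 h2 h3
      have h4 := hpos r h3.1 h3.2
      have h5 := hK h2 h1 (sub_pos.1 h4).le
      simp only at h5
      rw [max_eq_left h4.le]
      simp only [hD]
      linarith
    rw [intervalIntegral.integral_const_mul] at hbound
    have hadd := intervalIntegral.integral_add_adjacent_intervals
      (hI s a le_rfl ha.1.1 haT.2) (hI a t ha.1.1 ha.1.2 ht.2)
    have h6 : K * ∫ r in a..t, max (D r) 0 ≤ K * ∫ r in s..t, max (D r) 0 :=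
      mul_le_mul_of_nonneg_left (by linarith [hnn s a ha.1.1]) hK0
    have h7 : D a ≤ 0 := ha.2
    linarith
  have := nonpos_of_le_mul_integral hK0 hD' hle T ⟨hs.2, le_rfl⟩
  exact sub_nonpos.1 ((le_max_left _ _).trans this)

/-- The state at time `t ≥ s` is a monotone function of the state at time `s`. -/
theorem IsStrongSolution.exists_monotone [MeasurableSpace.CountablyGenerated Ω]
    (hσ : IsAdmissibleStress σ) {u : ℝ → Lp ℝ 2 P} (hu : IsStrongSolution σ μ u)
    (h0 : ∀ᵐ x ∂P, 0 ≤ u 0 x) (h0m : ∫ x, u 0 x ∂P = μ) {ε R s t : ℝ} (hs : 0 < s)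
    (h : IsBoundedSolution σ μ ε R s u) (hst : s ≤ t) :
    ∃ f : ℝ → ℝ, Monotone f ∧ (∀ x, f x ∈ Icc ε R) ∧ ∀ᵐ x ∂P, u t x = f (u s x) := by
  obtain ⟨p, hp⟩ := hu.exists_isPointwiseSolution hσ h0 h0m (hs.trans_le hst)
  obtain ⟨A, hA, hAo⟩ := hp.exists_order_preserving hσ ⟨hs, hst⟩
  set A' : Set Ω := {x ∈ A | p x t ∈ Icc ε R} with hA'
  -- The supremum extends the order-preserving correspondence p(x, s) ↦ p(x, t) to a monotone
  -- function on ℝ; inserting ε keeps the set nonempty and the supremum at least ε.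
  set Y : ℝ → Set ℝ := fun a => insert ε ((fun x => p x t) '' {x ∈ A' | p x s ≤ a}) with hY
  have hYR : ∀ a, ∀ z ∈ Y a, z ≤ R := by
    rintro a z (rfl | ⟨x, hx, rfl⟩)
    · exact h.le
    · exact hx.1.2.2
  have hYb : ∀ a, BddAbove (Y a) := fun a => ⟨R, hYR a⟩
  have hYn : ∀ a, (Y a).Nonempty := fun a => ⟨ε, mem_insert _ _⟩
  refine ⟨fun a => sSup (Y a), fun a b hab => ?_, fun a => ⟨?_, ?_⟩, ?_⟩
  · refine csSup_le_csSup (hYb b) (hYn a) (insert_subset_insert (image_mono ?_))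
    exact fun x hx => ⟨hx.1, hx.2.trans hab⟩
  · exact le_csSup (hYb a) (mem_insert _ _)
  · exact csSup_le (hYn a) (hYR a)
  · filter_upwards [hA, hp.ae_eq t ⟨(hs.trans_le hst).le, le_rfl⟩, hp.ae_eq s ⟨hs.le, hst⟩,
      h.mem t hst] with x h1 h2 h3 h4
    rw [← h2] at h4 ⊢
    rw [← h3]
    refine le_antisymm (le_csSup (hYb _) (mem_insert_of_mem _ ⟨x, ⟨⟨h1, h4⟩, le_rfl⟩, rfl⟩)) ?_
    refine csSup_le (hYn _) ?_
    rintro z (rfl | ⟨y, hy, rfl⟩)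
    · exact h4.1
    · exact hAo y hy.1.1 x h1 hy.2

/-- Forward orbits are sequentially precompact. -/
theorem IsStrongSolution.exists_subseq_tendsto [MeasurableSpace.CountablyGenerated Ω]
    (hσ : IsAdmissibleStress σ) {u : ℝ → Lp ℝ 2 P} (hu : IsStrongSolution σ μ u)
    (h0 : ∀ᵐ x ∂P, 0 ≤ u 0 x) (h0m : ∫ x, u 0 x ∂P = μ) {t : ℕ → ℝ} (ht : ∀ n, 1 ≤ t n) :
    ∃ (φ : ℕ → ℕ) (χ : Lp ℝ 2 P), StrictMono φ ∧
      Tendsto (fun n => u (t (φ n))) atTop (𝓝 χ) := by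
  obtain ⟨ε, R, h⟩ := hu.bounded 1 one_pos
  exact exists_subseq_tendsto_of_comonotone (u 1) fun n =>
    hu.exists_monotone hσ h0 h0m one_pos h (ht n)

end Orbits

/-! ### The energy as a Lyapunov function -/

section Lyapunov

variable {Ω : Type*} [MeasurableSpace Ω] {P : Measure Ω} [IsProbabilityMeasure P]
variable {σ : ℝ → ℝ} {μ : ℝ}

/-- g ∘ v is a constant minus the field, and the field has mean zero, so the constant drops out.
This is the dissipation identity for ∫ G(u) with G' = g. -/
theorem inner_nemytskii_nonlocalField {g : ℝ → ℝ} {L : ℝ≥0} (hg : LipschitzWith L g)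
    (v : Lp ℝ 2 P) : inner ℝ (nemytskii g v) (nonlocalField g v) = -‖nonlocalField g v‖ ^ 2 := by
  set c := ∫ x, g (v x) ∂P with hc
  have h1 : nemytskii g v = c • Lp.const 2 P (1 : ℝ) - nonlocalField g v := by
    have : c • Lp.const 2 P (1 : ℝ) = Lp.const 2 P c := by
      have := (Lp.constL 2 P ℝ : ℝ →L[ℝ] Lp ℝ 2 P).map_smul c (1 : ℝ)
      rw [smul_eq_mul, mul_one] at this
      exact this.symm
    rw [this, nonlocalField]
    abel
  rw [h1, inner_sub_left, inner_smul_left, inner_Lp_const_one,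
    integral_nonlocalField (memLp_comp_of_lipschitzWith hg v), mul_zero, zero_sub,
    real_inner_self_eq_norm_sq]

/-- The limit points of a strong solution are equilibria. -/
theorem IsStrongSolution.nonlocalField_eq_zero_of_tendsto (hσ : IsAdmissibleStress σ)
    {u y : ℝ → Lp ℝ 2 P} (hu : IsStrongSolution σ μ u) (hy : IsStrongSolution σ μ y)
    {t : ℕ → ℝ} (ht : Tendsto t atTop atTop)
    (hty : ∀ s, 0 ≤ s → Tendsto (fun n => u (t n + s)) atTop (𝓝 (y s))) :
    ∃ ε R, 0 < ε ∧ (∀ᵐ x ∂P, y 0 x ∈ Icc ε R) ∧ nonlocalField σ (y 0) = 0 := by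
  obtain ⟨ε, R, h⟩ := hu.bounded 1 one_pos
  obtain ⟨L, hL⟩ := hσ.exists_lipschitzWith_truncation h.pos h.le
  obtain ⟨B, hB⟩ := hσ.exists_abs_truncation_le h.pos h.le
  set g := truncation σ ε R with hg
  have htail : ∀ s, 0 ≤ s → ∀ᶠ n in atTop, 1 ≤ t n + s := fun s hs => by
    filter_upwards [ht.eventually_ge_atTop 1] with n hn
    linarith
  have hymem : ∀ s, 0 ≤ s → ∀ᵐ x ∂P, y s x ∈ Icc ε R := fun s hs =>
    (isClosed_setOf_ae_mem isClosed_Icc).mem_of_tendsto (hty s hs)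
      ((htail s hs).mono fun n hn => h.mem _ hn)
  -- On [ε, R] this is the stored energy up to a constant; truncation makes V differentiable on all
  -- of L².
  set G : ℝ → ℝ := fun z => ∫ w in (0 : ℝ)..z, g w with hG
  have hGd : ∀ z, HasDerivAt G (g z) z := fun z =>
    intervalIntegral.integral_hasDerivAt_right (hL.continuous.intervalIntegrable _ _)
      hL.continuous.stronglyMeasurable.stronglyMeasurableAtFilter hL.continuous.continuousAt
  set V : Lp ℝ 2 P → ℝ := fun v => ∫ x, G (v x) ∂P with hV
  have hVc : Continuous V := continuous_integral_comp hL hGd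
  have hVd : ∀ r, 1 < r → HasDerivAt (fun r => V (u r)) (-‖nonlocalField g (u r)‖ ^ 2) r := by
    intro r hr
    have h1 := hasDerivAt_integral_comp hL hGd (h.hasDerivAt r hr)
    rwa [← nonlocalField_truncation (h.mem r hr.le), inner_nemytskii_nonlocalField hL] at h1
  have hanti : AntitoneOn (fun r => V (u r)) (Ici 1) := by
    refine antitoneOn_of_deriv_nonpos (convex_Ici 1) (hVc.comp_continuousOn h.continuousOn) ?_ ?_
    · rw [interior_Ici]
      exact fun r hr => (hVd r hr).differentiableAt.differentiableWithinAt
    · rw [interior_Ici]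
      intro r hr
      rw [(hVd r hr).deriv]
      exact neg_nonpos.2 (sq_nonneg _)
  obtain ⟨C, hC⟩ := isCompact_Icc.exists_bound_of_continuousOn
    (continuous_iff_continuousAt.2 fun z => (hGd z).continuousAt :
      Continuous G).continuousOn (s := Icc ε R)
  have hbelow : ∀ r, 1 ≤ r → -C ≤ V (u r) := by
    intro r hr
    have h1 : ∀ᵐ x ∂P, ‖G (u r x)‖ ≤ C := by
      filter_upwards [h.mem r hr] with x hx using hC _ hx
    have h2 : |V (u r)| ≤ C := by simpa using norm_integral_le_of_norm_le_const h1
    exact (abs_le.1 h2).1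
  obtain ⟨l, hl⟩ : ∃ l, Tendsto (fun r => V (u r)) atTop (𝓝 l) := by
    have h1 : Antitone fun r => V (u (max 1 r)) := fun a b hab =>
      hanti (le_max_left 1 a) (le_max_left 1 b) (max_le_max le_rfl hab)
    have h2 : BddBelow (range fun r => V (u (max 1 r))) :=
      ⟨-C, by rintro _ ⟨r, rfl⟩; exact hbelow _ (le_max_left 1 r)⟩
    refine ⟨_, (tendsto_atTop_ciInf h1 h2).congr' ?_⟩
    filter_upwards [eventually_ge_atTop 1] with r hr
    rw [max_eq_right hr]
  -- LaSalle's argument: V equals its limit along the whole limit trajectory, so the dissipation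
  -- vanishes there.
  have hVy : ∀ s, 0 ≤ s → V (y s) = l := by
    intro s hs
    refine tendsto_nhds_unique ((hVc.tendsto _).comp (hty s hs)) (hl.comp ?_)
    exact tendsto_atTop_add_const_right _ s ht
  have hF0 : ∀ s, 0 < s → nonlocalField g (y s) = 0 := by
    intro s hs
    obtain ⟨ε', R', h'⟩ := hy.bounded (s / 2) (half_pos hs)
    have h1 := hasDerivAt_integral_comp hL hGd (h'.hasDerivAt s (half_lt_self hs))
    rw [← nonlocalField_truncation (hymem s hs.le), inner_nemytskii_nonlocalField hL] at h1
    have h2 : HasDerivAt (fun r => V (y r)) 0 s := by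
      refine (hasDerivAt_const s l).congr_of_eventuallyEq ?_
      filter_upwards [Ioi_mem_nhds hs] with r hr using hVy r (le_of_lt hr)
    have h3 := h1.unique h2
    have h4 : ‖nonlocalField g (y s)‖ = 0 := by
      have : ‖nonlocalField g (y s)‖ ^ 2 = 0 := by linarith
      exact pow_eq_zero_iff two_ne_zero |>.1 this
    exact norm_eq_zero.1 h4
  refine ⟨ε, R, h.pos, hymem 0 le_rfl, ?_⟩
  rw [← nonlocalField_truncation (hymem 0 le_rfl)]
  have hcont : ContinuousWithinAt (fun s => nonlocalField g (y s)) (Ioi 0) 0 :=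
    ((lipschitzWith_nonlocalField hL).continuous.continuousAt).comp_continuousWithinAt
      ((hy.continuousOn 0 self_mem_Ici).mono Ioi_subset_Ici_self)
  refine tendsto_nhds_unique hcont.tendsto (tendsto_const_nhds.congr' ?_)
  filter_upwards [self_mem_nhdsWithin] with s hs using (hF0 s hs).symm

end Lyapunov

/-! ### Omega-limit sets of precompact orbits -/

section OmegaLimit

variable {α : Type}

theorem omegaLimitSet_nonempty_of_subseq [TopologicalSpace α] {S : Flow ℝ≥0 α} {p₀ : α}
    (h : ∀ t : ℕ → ℝ≥0, Tendsto t atTop atTop →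
      ∃ (φ : ℕ → ℕ) (χ : α), StrictMono φ ∧ Tendsto (fun n => S (t (φ n)) p₀) atTop (𝓝 χ)) :
    (omegaLimitSet S p₀).Nonempty := by
  obtain ⟨φ, χ, hφ, hχ⟩ := h (fun n => n) tendsto_natCast_atTop_atTop
  exact ⟨χ, _, tendsto_natCast_atTop_atTop.comp hφ.tendsto_atTop, hχ⟩

/-- Each `χ n` is shadowed within 1 / (n + 1) by an orbit point at a time at least n; a convergent
subsequence of these orbit points carries `χ` along. -/
theorem isCompact_omegaLimitSet_of_subseq [MetricSpace α] {S : Flow ℝ≥0 α} {p₀ : α}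
    (h : ∀ t : ℕ → ℝ≥0, Tendsto t atTop atTop →
      ∃ (φ : ℕ → ℕ) (χ : α), StrictMono φ ∧ Tendsto (fun n => S (t (φ n)) p₀) atTop (𝓝 χ)) :
    IsCompact (omegaLimitSet S p₀) := by
  refine IsSeqCompact.isCompact fun χ hχ => ?_
  have hex : ∀ n : ℕ, ∃ s : ℝ≥0, (n : ℝ≥0) ≤ s ∧ dist (S s p₀) (χ n) < 1 / ((n : ℝ) + 1) := by
    intro n
    obtain ⟨t, ht, htχ⟩ := hχ n
    have h1 : ∀ᶠ j in atTop, dist (S (t j) p₀) (χ n) < 1 / ((n : ℝ) + 1) :=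
      (tendsto_iff_dist_tendsto_zero.1 htχ).eventually_lt_const (by positivity)
    obtain ⟨j, hj1, hj2⟩ := (h1.and (ht.eventually_ge_atTop (n : ℝ≥0))).exists
    exact ⟨t j, hj2, hj1⟩
  choose s hs hsχ using hex
  have hst : Tendsto s atTop atTop := tendsto_atTop_mono hs tendsto_natCast_atTop_atTop
  obtain ⟨φ, ψ, hφ, hψ⟩ := h s hst
  refine ⟨ψ, ⟨_, hst.comp hφ.tendsto_atTop, hψ⟩, φ, hφ, ?_⟩
  rw [tendsto_iff_dist_tendsto_zero] at hψ ⊢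
  have h2 : Tendsto (fun n => 1 / ((φ n : ℝ) + 1) + dist (S (s (φ n)) p₀) ψ) atTop (𝓝 0) := by
    simpa using (tendsto_one_div_add_atTop_nhds_zero_nat (𝕜 := ℝ) |>.comp hφ.tendsto_atTop).add hψ
  refine squeeze_zero (fun n => dist_nonneg) (fun n => ?_) h2
  have h3 := dist_triangle_left (χ (φ n)) ψ (S (s (φ n)) p₀)
  have h4 := hsχ (φ n)
  simp only [Function.comp_apply]
  linarith

/-- `Metric.infDist` to the empty set is 0, so this has content only together with the nonemptiness
above. -/
theorem tendsto_infDist_omegaLimitSet_of_subseq [MetricSpace α] {S : Flow ℝ≥0 α} {p₀ : α}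
    (h : ∀ t : ℕ → ℝ≥0, Tendsto t atTop atTop →
      ∃ (φ : ℕ → ℕ) (χ : α), StrictMono φ ∧ Tendsto (fun n => S (t (φ n)) p₀) atTop (𝓝 χ)) :
    Tendsto (fun t : ℝ≥0 => Metric.infDist (S t p₀) (omegaLimitSet S p₀)) atTop (𝓝 0) := by
  refine tendsto_of_subseq_tendsto fun t ht => ?_
  obtain ⟨φ, χ, hφ, hχ⟩ := h t ht
  refine ⟨φ, squeeze_zero (fun n => Metric.infDist_nonneg) (fun n => ?_)
    (tendsto_iff_dist_tendsto_zero.1 hχ)⟩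
  exact Metric.infDist_le_dist_of_mem ⟨_, ht.comp hφ.tendsto_atTop, hχ⟩

end OmegaLimit

/-! ### The semiflow on the phase space -/

section Semiflow

variable {σ : ℝ → ℝ} {μ : ℝ}

instance : IsProbabilityMeasure (volume.restrict (Ioo (0 : ℝ) 1)) := ⟨by simp⟩

/-- Lebesgue measure restricted to the rectangle is the product of the restrictions, which links the
concrete notion to the one on a general probability space. -/
theorem isSolutionOn_iff {p₀ : L2} {T : ℝ} {u : ℝ → L2} :
    IsSolutionOn σ μ p₀ T u ↔ ContinuousOn u (Icc 0 T) ∧ u 0 = p₀ ∧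
      (∀ t ∈ Icc 0 T, ∫ x in Ioo (0 : ℝ) 1, u t x = μ) ∧
      ∃ p, IsPointwiseSolution σ T u p := by
  have hprod : (volume : Measure (ℝ × ℝ)).restrict (Ioo (0 : ℝ) 1 ×ˢ Icc 0 T) =
      (volume.restrict (Ioo (0 : ℝ) 1)).prod (volume.restrict (Icc 0 T)) := by
    rw [Measure.prod_restrict, Measure.volume_eq_prod]
  constructor
  · rintro ⟨h1, h2, h3, p, h4, h5, h6, h7, h8, h9⟩
    rw [hprod] at h4 h6
    exact ⟨h1, h2, h3, p, h4, h5, h6, h7, h8, h9⟩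
  · rintro ⟨h1, h2, h3, p, h4, h5, h6, h7, h8, h9⟩
    rw [← hprod] at h4 h6
    exact ⟨h1, h2, h3, p, h4, h5, h6, h7, h8, h9⟩

/-- The strong solution with a given initial value. -/
def strongSolution (hσ : IsAdmissibleStress σ) (hμ : 0 < μ) (p₀ : phaseSpace μ) : ℝ → L2 :=
  (exists_isStrongSolution hσ hμ (p₀ : L2) p₀.2.1 p₀.2.2).choose

theorem strongSolution_zero (hσ : IsAdmissibleStress σ) (hμ : 0 < μ) (p₀ : phaseSpace μ) :
    strongSolution hσ hμ p₀ 0 = p₀ :=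
  (exists_isStrongSolution hσ hμ (p₀ : L2) p₀.2.1 p₀.2.2).choose_spec.1

theorem isStrongSolution_strongSolution (hσ : IsAdmissibleStress σ) (hμ : 0 < μ)
    (p₀ : phaseSpace μ) : IsStrongSolution σ μ (strongSolution hσ hμ p₀) :=
  (exists_isStrongSolution hσ hμ (p₀ : L2) p₀.2.1 p₀.2.2).choose_spec.2

theorem strongSolution_mem (hσ : IsAdmissibleStress σ) (hμ : 0 < μ) (p₀ : phaseSpace μ) {t : ℝ}
    (ht : 0 ≤ t) : strongSolution hσ hμ p₀ t ∈ phaseSpace μ := by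
  rcases ht.eq_or_lt with rfl | ht
  · rw [strongSolution_zero]
    exact p₀.2
  · exact (isStrongSolution_strongSolution hσ hμ p₀).mem ht

/-- The semiflow of strong solutions. -/
def semiflow (hσ : IsAdmissibleStress σ) (hμ : 0 < μ) : Flow ℝ≥0 (phaseSpace μ) where
  toFun t p₀ := ⟨strongSolution hσ hμ p₀ t, strongSolution_mem hσ hμ p₀ t.2⟩
  cont' := by
    obtain ⟨K, hK0, hK⟩ := hσ.exists_monotoneOn_add_linear
    refine continuous_iff_continuousAt.2 fun ⟨t₀, q⟩ => ?_
    refine tendsto_subtype_rng.2 ?_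
    rw [tendsto_iff_norm_sub_tendsto_zero]
    have hq := isStrongSolution_strongSolution hσ hμ q
    -- Joint continuity splits into Lipschitz dependence on the data, with a constant locally
    -- bounded in time, and continuity in time of the single orbit of q.
    have h1 : Tendsto (fun z : ℝ≥0 × phaseSpace μ => Real.exp (K * z.1) * ‖(z.2 : L2) - q‖ +
        ‖strongSolution hσ hμ q z.1 - strongSolution hσ hμ q t₀‖) (𝓝 (t₀, q)) (𝓝 0) := by
      have hc : Continuous fun t : ℝ≥0 => strongSolution hσ hμ q t :=
        hq.continuousOn.comp_continuous NNReal.continuous_coe fun t => t.2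
      have : Continuous fun z : ℝ≥0 × phaseSpace μ =>
          Real.exp (K * z.1) * ‖(z.2 : L2) - q‖ +
          ‖strongSolution hσ hμ q z.1 - strongSolution hσ hμ q t₀‖ :=
        ((Real.continuous_exp.comp (continuous_const.mul
          (NNReal.continuous_coe.comp continuous_fst))).mul
          ((continuous_subtype_val.comp continuous_snd).sub continuous_const).norm).add
          ((hc.comp continuous_fst).sub continuous_const).norm
      simpa using this.tendsto (t₀, q)
    refine squeeze_zero (fun z => norm_nonneg _) (fun z => ?_) h1
    obtain ⟨t, p⟩ := z
    have h2 := (isStrongSolution_strongSolution hσ hμ p).norm_sub_le hσ hK hq t.2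
    rw [strongSolution_zero, strongSolution_zero] at h2
    have h3 := norm_sub_le_norm_sub_add_norm_sub (strongSolution hσ hμ p t)
      (strongSolution hσ hμ q t) (strongSolution hσ hμ q t₀)
    exact h3.trans (add_le_add h2 le_rfl)
  map_add' s t p₀ := by
    refine Subtype.ext ?_
    have h1 := (isStrongSolution_strongSolution hσ hμ p₀).shift (NNReal.coe_nonneg t)
    have h2 := isStrongSolution_strongSolution hσ hμ
      ⟨strongSolution hσ hμ p₀ t, strongSolution_mem hσ hμ p₀ t.2⟩
    have h3 := h1.eqOn hσ h2 (by rw [strongSolution_zero, add_zero]) s.2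
    exact (congrArg (strongSolution hσ hμ p₀)
      ((NNReal.coe_add s t).trans (add_comm _ _))).trans h3
  map_zero' p₀ := Subtype.ext (strongSolution_zero hσ hμ p₀)

theorem coe_semiflow (hσ : IsAdmissibleStress σ) (hμ : 0 < μ) (t : ℝ≥0) (p₀ : phaseSpace μ) :
    (semiflow hσ hμ t p₀ : L2) = strongSolution hσ hμ p₀ t := rfl

/-- One direction is uniqueness in the pointwise class. In the other, u is arbitrary outside [0, T],
and the representative of the strong solution carries over unchanged. -/
theorem isSolutionSemiflow_semiflow (hσ : IsAdmissibleStress σ) (hμ : 0 < μ) :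
    IsSolutionSemiflow σ μ (semiflow hσ hμ) := by
  intro p₀ T hT u
  have hS := isStrongSolution_strongSolution hσ hμ p₀
  have h0 := strongSolution_zero hσ hμ p₀
  obtain ⟨p, hp⟩ := hS.exists_isPointwiseSolution hσ (by rw [h0]; exact p₀.2.1)
    (by rw [h0]; exact p₀.2.2) hT
  have hmass : ∀ t ∈ Icc 0 T, ∫ x in Ioo (0 : ℝ) 1, strongSolution hσ hμ p₀ t x = μ :=
    fun t ht => (strongSolution_mem hσ hμ p₀ ht.1).2
  have hcont := hS.continuousOn.mono (Icc_subset_Ici_self : Icc 0 T ⊆ Ici 0)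
  rw [isSolutionOn_iff]
  constructor
  · rintro ⟨h1, h2, h3, q, hq⟩ t ht
    rw [coe_semiflow]
    exact eqOn_of_isPointwiseSolution hσ hμ hq hp h1 hcont h3 hmass (h2.trans h0.symm)
      ⟨t.2, ht⟩
  · intro h
    have heq : EqOn u (strongSolution hσ hμ p₀) (Icc 0 T) := fun t ht =>
      h ⟨t, ht.1⟩ ht.2
    refine ⟨hcont.congr heq, (heq ⟨le_rfl, hT.le⟩).trans h0, fun t ht => ?_, p,
      { hp with ae_eq := fun t ht => ?_ }⟩
    · rw [heq ht]
      exact hmass t ht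
    · rw [heq ht]
      exact hp.ae_eq t ht

theorem isClosed_phaseSpace : IsClosed (phaseSpace μ) :=
  (isClosed_setOf_ae_mem (P := volume.restrict (Ioo (0 : ℝ) 1)) isClosed_Ici).inter
    (isClosed_singleton.preimage continuous_integral_coe)

theorem exists_subseq_tendsto_semiflow (hσ : IsAdmissibleStress σ) (hμ : 0 < μ)
    (p₀ : phaseSpace μ) (t : ℕ → ℝ≥0) (ht : Tendsto t atTop atTop) :
    ∃ (φ : ℕ → ℕ) (χ : phaseSpace μ), StrictMono φ ∧
      Tendsto (fun n => semiflow hσ hμ (t (φ n)) p₀) atTop (𝓝 χ) := by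
  have h0 := strongSolution_zero hσ hμ p₀
  -- Precompactness is available only for times at least 1, hence the shift by N.
  obtain ⟨N, hN⟩ := eventually_atTop.1 (ht.eventually_ge_atTop 1)
  obtain ⟨φ, χ, hφ, hχ⟩ := (isStrongSolution_strongSolution hσ hμ p₀).exists_subseq_tendsto hσ
    (by rw [h0]; exact p₀.2.1) (by rw [h0]; exact p₀.2.2) (t := fun n => t (n + N))
    (fun n => by exact_mod_cast hN (n + N) (Nat.le_add_left N n))
  have hmem : χ ∈ phaseSpace μ := isClosed_phaseSpace.mem_of_tendsto hχ
    (Eventually.of_forall fun n => strongSolution_mem hσ hμ p₀ (t (φ n + N)).2)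
  exact ⟨fun n => φ n + N, ⟨χ, hmem⟩, fun a b hab => Nat.add_lt_add_right (hφ hab) N,
    tendsto_subtype_rng.2 hχ⟩

/-- Continuity of the semiflow upgrades convergence at the times `t n` to convergence of the shifted
orbits to the orbit of `χ`, as the Lyapunov argument requires. The vanishing of the field at `χ`
says that σ(χ) equals its mean. -/
theorem mem_equilibria_of_mem_omegaLimitSet (hσ : IsAdmissibleStress σ) (hμ : 0 < μ)
    {p₀ χ : phaseSpace μ} (hχ : χ ∈ omegaLimitSet (semiflow hσ hμ) p₀) :
    (χ : L2) ∈ equilibria σ μ := by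
  obtain ⟨t, ht, htχ⟩ := hχ
  have hlim : ∀ s : ℝ, 0 ≤ s → Tendsto (fun n => strongSolution hσ hμ p₀ (t n + s)) atTop
      (𝓝 (strongSolution hσ hμ χ s)) := by
    intro s hs
    lift s to ℝ≥0 using hs
    have h1 := ((semiflow hσ hμ).continuous_toFun s).tendsto χ |>.comp htχ
    have h2 := (continuous_subtype_val.tendsto _).comp h1
    refine h2.congr fun n => ?_
    have h3 := (semiflow hσ hμ).map_add s (t n) p₀
    have h4 := congrArg Subtype.val h3
    rw [coe_semiflow] at h4
    rw [Function.comp_apply, Function.comp_apply]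
    refine h4.symm.trans (congrArg (strongSolution hσ hμ p₀) ?_)
    rw [NNReal.coe_add, add_comm]
  obtain ⟨ε, R, hε, hmem, hF⟩ :=
    (isStrongSolution_strongSolution hσ hμ p₀).nonlocalField_eq_zero_of_tendsto hσ
    (isStrongSolution_strongSolution hσ hμ χ) (NNReal.tendsto_coe_atTop.2 ht) hlim
  rw [strongSolution_zero] at hmem hF
  refine ⟨?_, ⟨∫ y in Ioo (0 : ℝ) 1, σ ((χ : L2) y), ?_⟩, χ.2.2⟩
  · filter_upwards [hmem] with x hx using hε.trans_le hx.1
  · have h1 := nonlocalField_ae_eq (memLp_stress hσ hε hmem)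
    rw [hF] at h1
    filter_upwards [h1, Lp.coeFn_zero ℝ 2 (volume.restrict (Ioo (0 : ℝ) 1))] with x h2 h3
    rw [h3, Pi.zero_apply] at h2
    linarith

end Semiflow

end Viscoelastic

end

theorem propositionp (σ : ℝ → ℝ) (hσ : Viscoelastic.IsAdmissibleStress σ)
    (μ : ℝ) (hμ : 0 < μ) :
    ∃ S : Flow ℝ≥0 (Viscoelastic.phaseSpace μ),
      Viscoelastic.IsSolutionSemiflow σ μ S ∧
      ∀ p₀ : Viscoelastic.phaseSpace μ,
        (Viscoelastic.omegaLimitSet S p₀).Nonempty ∧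
        IsCompact (Viscoelastic.omegaLimitSet S p₀) ∧
        (∀ χ ∈ Viscoelastic.omegaLimitSet S p₀,
          (χ : Viscoelastic.L2) ∈ Viscoelastic.equilibria σ μ) ∧
        Tendsto (fun t : ℝ≥0 => Metric.infDist (S t p₀) (Viscoelastic.omegaLimitSet S p₀))
          atTop (𝓝 0) := by
  refine ⟨Viscoelastic.semiflow hσ hμ, Viscoelastic.isSolutionSemiflow_semiflow hσ hμ,
    fun p₀ => ?_⟩
  have h := Viscoelastic.exists_subseq_tendsto_semiflow hσ hμ p₀
  exact ⟨Viscoelastic.omegaLimitSet_nonempty_of_subseq h,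
    Viscoelastic.isCompact_omegaLimitSet_of_subseq h,
    fun χ hχ => Viscoelastic.mem_equilibria_of_mem_omegaLimitSet hσ hμ hχ,
    Viscoelastic.tendsto_infDist_omegaLimitSet_of_subseq h⟩
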